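/- **Theorem.** Let $p,d\ge 1$, let $g:\mathbb R^d\times\mathbb R^p\to\mathbb R^p$ be measurable in its first argument, and let $X\sim P_X$, $Y\sim P_Y$ be random vectors in $\mathbb R^d$. Let $\theta_{x_0},\theta_{y_0}\in\mathbb R^p$ be the unique solutions of $E\,g(X,\theta_x)=0$ and $E\,g(Y,\theta_y)=0$, let $\pi=\theta_y-\theta_x$ be the parameter of interest, and assume $H_0:\ \theta_{y_0}-\theta_{x_0}=\pi_0$. Assume: * $\mathrm{Var}[g(X,\theta_{x_0})]$ and $\mathrm{Var}[g(Y,\theta_{y_0})]$ are positive definite. * There is an open neighbourhood $U_x$ of $\theta_{x_0}$ on which, for $P_X$-almost every $x$, $\partial g(x,\theta)/\partial\theta$ and $\partial^2 g(x,\theta)/\partial\theta\partial\theta'$ are continuous in $\theta$ and bounded in norm by a $P_X$-integrable function $H_x(x)$; the same holds for $P_Y$, on an open neighbourhood $U_y$ of $\theta_{y_0}$, with a $P_Y$-integrable bound $H_y(y)$. * $E\|g(X,\theta_{x_0})\|^3<\infty$ and $\limsup_{\|t\|\to\infty}|E\exp\{i\,t'g(X,\theta_{x_0})\}|<1$, and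 likewise for $g(Y,\theta_{y_0})$. * The $p\times p$ matrices $E[\partial g(X,\theta_{x_0})/\partial\theta]$ and $E[\partial g(Y,\theta_{y_0})/\partial\theta]$ have rank $p$. Let $n_1,n_2\to\infty$ with $n_1/n_2\to c\in(0,\infty)$, and let the group size $m\ge1$ vary arbitrarily along the sequence (in particular it may be fixed or tend to infinity). At each stage let $X_{ik}$ ($i\le n_1$, $k\le m$) and $Y_{jt}$ ($j\le n_2$, $t\le m$) be mutually independent with $X_{ik}\sim P_X$, $Y_{jt}\sim P_Y$; put $N_1=mn_1$, $N_2=mn_2$. For sets $\Theta_x,\Theta_y\subseteq\mathbb R^p$ let $$R_G(\pi)=\sup\ \prod_{i=1}^{n_1}(N_1p_i)^m\prod_{j=1}^{n_2}(N_2q_j)^m ,$$ the supremum being over $p_i\ge0$, $q_j\ge0$ with $\sum_ip_i=\sum_jq_j=1/m$ for which there are $\theta_x\in\Theta_x$, $\theta_y\in\Theta_y$ with $$\sum_ip_i\sum_kg(X_{ik},\theta_x)=0,\qquad \sum_jq_j\sum_tg(Y_{jt},\theta_y)=0,\qquad \theta_y-\theta_x=\pi$$ (with $R_G(\pi)=0$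 and $-2\log R_G(\pi)=+\infty$ if there are none). Then $$\frac{-2\log R_G(\pi_0)}{m}\ \xrightarrow{d}\ \chi^2_p$$ in each of the following two cases: 1. $\Theta_x=\Theta_y=\mathbb R^p$, provided that the solutions $\theta_x(p)$, $\theta_y(q)$ are well defined, i.e. that with probability tending to one, for all positive weights $(p_i)$ with $\sum_i p_i=1/m$ the equation $\sum_ip_i\sum_kg(X_{ik},\theta)=0$ has at most one solution $\theta\in\mathbb R^p$, and likewise for the $Y$-sample; 2. without that proviso, $\Theta_x=K_x$ and $\Theta_y=K_y$ for any compact convex neighbourhoods $K_x\subseteq U_x$ of $\theta_{x_0}$ and $K_y\subseteq U_y$ of $\theta_{y_0}$. (Convergence in distribution of the possibly non-measurable statistic $T$ means that the outer probabilities of $\{T\le t\}$ and $\{T>t\}$ converge to $\chi^2_p((-\infty,t])$ and $\chi^2_p((t,\infty))$ for every $t\in\mathbb R$.) -/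

import Mathlib

open MeasureTheory ProbabilityTheory Filter Topology
open scoped ENNReal

noncomputable section

/-- `ℝⁿ` with its Euclidean norm. -/
abbrev Vec (n : ℕ) : Type := EuclideanSpace ℝ (Fin n)

/-! ### Population side: the estimating function and the regularity conditions -/

/-- `θ₀` is the parameter of the law `P`: the unique solution of `E[g(X, θ)] = 0`, `X ∼ P`
(an expectation is only said to vanish where it exists). -/
structure IsParameter {d p : ℕ} (g : Vec d → Vec p → Vec p) (P : Measure (Vec d))
    (θ₀ : Vec p) : Prop where
  integrable : Integrable (fun x => g x θ₀) P
  eq_zero : ∫ x, g x θ₀ ∂P = 0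
  unique : ∀ θ : Vec p, Integrable (fun x => g x θ) P → ∫ x, g x θ ∂P = 0 → θ = θ₀

/-- The covariance matrix `Var[g(X, θ)]`, `X ∼ P`. -/
def varMatrix {d p : ℕ} (g : Vec d → Vec p → Vec p) (P : Measure (Vec d)) (θ : Vec p) :
    Matrix (Fin p) (Fin p) ℝ :=
  Matrix.of fun i j => covariance (fun x => g x θ i) (fun x => g x θ j) P

/-- On the open set `U`, `g(x, ·)` has continuous first and second derivatives, and these are
bounded by a `P`-integrable function of `x`, which does not depend on `θ ∈ U`. -/
def RegularOn {d p : ℕ} (g : Vec d → Vec p → Vec p) (P : Measure (Vec d)) (U : Set (Vec p)) :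
    Prop :=
  ∃ H : Vec d → ℝ, Integrable H P ∧ ∀ᵐ x ∂P, ContDiffOn ℝ 2 (g x) U ∧
    ∀ θ ∈ U, ‖fderiv ℝ (g x) θ‖ ≤ H x ∧ ‖fderiv ℝ (fderiv ℝ (g x)) θ‖ ≤ H x

/-- The expected Jacobian `E[∂g(X, θ)/∂θ]`, `X ∼ P`, as a linear map. -/
def meanJacobian {d p : ℕ} (g : Vec d → Vec p → Vec p) (P : Measure (Vec d)) (θ : Vec p) :
    Vec p →L[ℝ] Vec p :=
  ∫ x, fderiv ℝ (g x) θ ∂P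

/-- `E[∂g(X, θ)/∂θ]` has rank `p`. -/
def FullRankJacobian {d p : ℕ} (g : Vec d → Vec p → Vec p) (P : Measure (Vec d))
    (θ : Vec p) : Prop :=
  Module.finrank ℝ (LinearMap.range (meanJacobian g P θ).toLinearMap) = p

/-- `E‖g(X, θ)‖³ < ∞` and `limsup_{‖t‖ → ∞} |E exp(i t'g(X, θ))| < 1`, `X ∼ P`. -/
structure MomentAndCramer {d p : ℕ} (g : Vec d → Vec p → Vec p) (P : Measure (Vec d))
    (θ : Vec p) : Prop where
  moment : Integrable (fun x => ‖g x θ‖ ^ 3) P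
  cramer : limsup (fun t : Vec p => ‖charFun (P.map fun x => g x θ) t‖)
    (Bornology.cobounded (Vec p)) < 1

/-! ### Sample side: the two-sample grouped empirical likelihood -/

/-- The group weights: `w₁, …, wₙ ≥ 0` with `∑ wᵢ = 1 / m`. -/
def IsGroupWeight {n : ℕ} (m : ℕ) (w : Fin n → ℝ) : Prop :=
  (∀ i, 0 ≤ w i) ∧ ∑ i, w i = 1 / (m : ℝ)

/-- `θ` solves the weighted estimating equation `∑ᵢ wᵢ ∑ₖ g(xᵢₖ, θ) = 0`. -/
def SolvesWeighted {d p n m : ℕ} (g : Vec d → Vec p → Vec p) (w : Fin n → ℝ)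
    (x : Fin n → Fin m → Vec d) (θ : Vec p) : Prop :=
  ∑ i, w i • ∑ k, g (x i k) θ = 0

/-- For every system of positive group weights, the weighted estimating equation has at most one
solution `θ`, so that this solution is a well-defined function `θ(w)` of the weights. -/
def SolutionWellDefined {d p n m : ℕ} (g : Vec d → Vec p → Vec p)
    (x : Fin n → Fin m → Vec d) : Prop :=
  ∀ w : Fin n → ℝ, IsGroupWeight m w → (∀ i, 0 < w i) →
    ∀ θ θ' : Vec p, SolvesWeighted g w x θ → SolvesWeighted g w x θ' → θ = θ'

/-- The two-sample grouped empirical likelihood ratio `R_G(π)`: the supremum of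
`∏ᵢ (N₁ vᵢ)ᵐ ∏ⱼ (N₂ wⱼ)ᵐ`, where `N₁ = m n₁`, `N₂ = m n₂`, over the group weights `v`, `w` for
which the two weighted estimating equations have solutions `θx ∈ Θx`, `θy ∈ Θy` with
`θy - θx = π`. Here `N₁⁻¹` and `N₂⁻¹` are the weights that maximize `∏ᵢ vᵢᵐ ∏ⱼ wⱼᵐ` when the
estimating equations are not imposed. The supremum is `0` if there are no such weights. -/
def gelRatio {d p n₁ n₂ m : ℕ} (g : Vec d → Vec p → Vec p) (Θx Θy : Set (Vec p)) (π : Vec p)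
    (x : Fin n₁ → Fin m → Vec d) (y : Fin n₂ → Fin m → Vec d) : ℝ≥0∞ :=
  sSup {r | ∃ (v : Fin n₁ → ℝ) (w : Fin n₂ → ℝ) (θx θy : Vec p),
    IsGroupWeight m v ∧ IsGroupWeight m w ∧ θx ∈ Θx ∧ θy ∈ Θy ∧
    SolvesWeighted g v x θx ∧ SolvesWeighted g w y θy ∧ θy - θx = π ∧
    r = ENNReal.ofReal ((∏ i, ((m : ℝ) * n₁ * v i) ^ m) * ∏ j, ((m : ℝ) * n₂ * w j) ^ m)}

/-- The grouped empirical log-likelihood ratio `-2 log R_G(π)`; it is `+∞` if `R_G(π) = 0`. -/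
def gelLogRatio {d p n₁ n₂ m : ℕ} (g : Vec d → Vec p → Vec p) (Θx Θy : Set (Vec p)) (π : Vec p)
    (x : Fin n₁ → Fin m → Vec d) (y : Fin n₂ → Fin m → Vec d) : EReal :=
  -2 * ENNReal.log (gelRatio g Θx Θy π x y)

/-- The sampling scheme with group size `m`: the `m n₁` observations `X i k` have law `PX`, the
`m n₂` observations `Y j t` have law `PY`, and all of them are independent. -/
structure IsTwoSample {Ω : Type*} [MeasurableSpace Ω] {d n₁ n₂ m : ℕ} (μ : Measure Ω)
    (PX PY : Measure (Vec d)) (X : Fin n₁ → Fin m → Ω → Vec d) (Y : Fin n₂ → Fin m → Ω → Vec d) :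
    Prop where
  law_X : ∀ i k, HasLaw (X i k) PX μ
  law_Y : ∀ j t, HasLaw (Y j t) PY μ
  indep : iIndepFun (Sum.elim (fun a : Fin n₁ × Fin m => X a.1 a.2)
    (fun b : Fin n₂ × Fin m => Y b.1 b.2)) μ

/-! ### Convergence in distribution to a chi-square law -/

/-- The chi-square law with `p` degrees of freedom: the law of `Z₁² + ⋯ + Z_p²` with independent
standard normal `Z₁, …, Z_p`. -/
def chiSquare (p : ℕ) : Measure ℝ :=
  (Measure.pi fun _ : Fin p => gaussianReal 0 1).map fun z => ∑ i, z i ^ 2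

/-- `T k` converges in distribution to `χ²_p` (`p ≥ 1`, so that the limiting distribution function
is continuous). As `T k` is a supremum over an uncountable family, it is not assumed to be
measurable: `μ` of a non-measurable set is its outer measure, and both `T k ≤ t` and its complement
are required to have the right limit. If `T k` is measurable, either limit implies the other. -/
def TendstoChiSquare {Ω : Type*} [MeasurableSpace Ω] (μ : Measure Ω) (T : ℕ → Ω → EReal)
    (p : ℕ) : Prop :=
  ∀ t : ℝ,
    Tendsto (fun k => μ {ω | T k ω ≤ (t : EReal)}) atTop (𝓝 (chiSquare p (Set.Iic t))) ∧
    Tendsto (fun k => μ {ω | (t : EReal) < T k ω}) atTop (𝓝 (chiSquare p (Set.Ioi t)))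

end

/-!
Weights whose log-likelihood ratio is bounded are `ℓ²`-close to the uniform ones (Hellinger
distance), so the weak laws of large numbers hold for the weighted averages too. Hence every
parameter that solves a weighted estimating equation with such weights is consistent, and then
`√N`-consistent, and the estimating equations may be linearized around the true parameter.

For a fixed parameter, the minimum of `-2 log ∏ wᵢ` under the constraint `∑ wᵢ zᵢ = 0` on the
weights is bounded below by weak duality and above by the explicit weights
`wᵢ = 1 - ⟪κ, zᵢ - z̄⟫ / √n`, and both bounds are the same quadratic form in the normalized sum. If
the two samples use the multipliers `κ` and `-A† κ`, where `A = ρ⁻¹ Jx Jy⁻¹` and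
`ρ² = lim n₂ / n₁`, the nuisance parameter drops out of the sum of the two bounds, and the statistic
is asymptotically `⟪Σ⁻¹ D, D⟫ = ‖M D‖²`, where `D = √N₁ ḡx - A (√N₂ ḡy)` is the contrast of the
normalized sums, `Σ` its limiting covariance and `M` a square root of `Σ⁻¹`. The central limit
theorem then makes the limit law `χ²_p`.

Apart from the limit theorems of probability, the argument is deterministic along the filter of the
events whose probability tends to one. The group sizes `m` may vary because the third moments of
the group sums, divided by `√m`, are bounded uniformly in `m`.
-/

noncomputable section

/-! ### Relative weights -/

/-- Positive weights relative to the uniform weights: `w₁, …, wₙ > 0` with `∑ wᵢ = n`. The group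
weights of the theorem are `vᵢ = wᵢ / (m n)`. -/
def IsRelWeight {n : ℕ} (w : Fin n → ℝ) : Prop :=
  (∀ i, 0 < w i) ∧ ∑ i, w i = n

/-- The empirical log-likelihood ratio `-2 ∑ log wᵢ` of relative weights. -/
def negTwoLog {n : ℕ} (w : Fin n → ℝ) : ℝ := -2 * ∑ i, Real.log (w i)

lemma sqrt_sub_one_sq_le_sub_log {x : ℝ} (hx : 0 < x) : (√x - 1) ^ 2 ≤ x - 1 - Real.log x := by
  have hlog : Real.log (√x) ≤ √x - 1 := Real.log_le_sub_one_of_pos (Real.sqrt_pos.2 hx)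
  rw [Real.log_sqrt hx.le] at hlog
  nlinarith [Real.sq_sqrt hx.le]

lemma isRelWeight_one {n : ℕ} : IsRelWeight (1 : Fin n → ℝ) := ⟨fun _ => one_pos, by simp⟩

namespace IsRelWeight

variable {n : ℕ} {w : Fin n → ℝ} {s : ℝ}

lemma negTwoLog_eq (hw : IsRelWeight w) :
    negTwoLog w = 2 * ∑ i, (w i - 1 - Real.log (w i)) := by
  simp only [negTwoLog, Finset.sum_sub_distrib, hw.2]
  simp

lemma sum_sqrt_sub_one_sq_le (hw : IsRelWeight w) :
    ∑ i, (√(w i) - 1) ^ 2 ≤ negTwoLog w / 2 := by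
  rw [hw.negTwoLog_eq, mul_div_cancel_left₀ _ two_ne_zero]
  exact Finset.sum_le_sum fun i _ => sqrt_sub_one_sq_le_sub_log (hw.1 i)

lemma negTwoLog_nonneg (hw : IsRelWeight w) : 0 ≤ negTwoLog w := by
  linarith [hw.sum_sqrt_sub_one_sq_le, Finset.sum_nonneg fun i (_ : i ∈ Finset.univ) =>
    sq_nonneg (√(w i) - 1)]

lemma sqrt_le (hw : IsRelWeight w) (hs : 0 ≤ s) (h : negTwoLog w ≤ 2 * s ^ 2) (i : Fin n) :
    √(w i) ≤ 1 + s := by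
  have hterm : (√(w i) - 1) ^ 2 ≤ s ^ 2 :=
    (Finset.single_le_sum (f := fun i => (√(w i) - 1) ^ 2) (fun _ _ => sq_nonneg _)
      (Finset.mem_univ i)).trans (by linarith [hw.sum_sqrt_sub_one_sq_le])
  linarith [abs_le_of_sq_le_sq' hterm hs]

lemma sum_sub_one_sq_le (hw : IsRelWeight w) (hs : 0 ≤ s) (h : negTwoLog w ≤ 2 * s ^ 2) :
    ∑ i, (w i - 1) ^ 2 ≤ ((2 + s) * s) ^ 2 := calc
  ∑ i, (w i - 1) ^ 2 ≤ ∑ i, (2 + s) ^ 2 * (√(w i) - 1) ^ 2 := by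
    gcongr with i
    have hfactor : w i - 1 = (√(w i) + 1) * (√(w i) - 1) := by
      linear_combination - Real.sq_sqrt (hw.1 i).le
    rw [hfactor, mul_pow]
    exact mul_le_mul_of_nonneg_right
      (pow_le_pow_left₀ (by positivity) (by linarith [hw.sqrt_le hs h i]) 2) (sq_nonneg _)
  _ = (2 + s) ^ 2 * ∑ i, (√(w i) - 1) ^ 2 := (Finset.mul_sum _ _ _).symm
  _ ≤ (2 + s) ^ 2 * s ^ 2 := by gcongr; linarith [hw.sum_sqrt_sub_one_sq_le]
  _ = ((2 + s) * s) ^ 2 := (mul_pow _ _ _).symm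

end IsRelWeight

/-! ### Weighted averages over grouped samples -/

section GroupAvg

variable {D F F' : Type*} [NormedAddCommGroup F] [NormedSpace ℝ F] [NormedAddCommGroup F']
  [NormedSpace ℝ F'] {n m : ℕ}

/-- The average of `f` over all the observations `x i k` of a grouped sample, where the
observations of the group `i` have the relative weight `w i`. -/
def groupAvg (w : Fin n → ℝ) (x : Fin n → Fin m → D) (f : D → F) : F :=
  ((n : ℝ) * m)⁻¹ • ∑ i, w i • ∑ k, f (x i k)

/-- The sum of `f` over the group `i`, divided by the square root of the group size. -/
def groupSum (x : Fin n → Fin m → D) (f : D → F) (i : Fin n) : F :=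
  (√(m : ℝ))⁻¹ • ∑ k, f (x i k)

lemma groupAvg_add (w : Fin n → ℝ) (x : Fin n → Fin m → D) (f f' : D → F) :
    groupAvg w x (fun y => f y + f' y) = groupAvg w x f + groupAvg w x f' := by
  simp [groupAvg, Finset.sum_add_distrib]

lemma groupAvg_sub (w : Fin n → ℝ) (x : Fin n → Fin m → D) (f f' : D → F) :
    groupAvg w x (fun y => f y - f' y) = groupAvg w x f - groupAvg w x f' := by
  simp [groupAvg, Finset.sum_sub_distrib, smul_sub]

lemma groupAvg_clm (w : Fin n → ℝ) (x : Fin n → Fin m → D) (f : D → F) (L : F →L[ℝ] F') :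
    groupAvg w x (fun y => L (f y)) = L (groupAvg w x f) := by
  simp [groupAvg]

lemma groupAvg_const_mul (w : Fin n → ℝ) (x : Fin n → Fin m → D) (f : D → ℝ) (c : ℝ) :
    groupAvg w x (fun y => c * f y) = c * groupAvg w x f :=
  groupAvg_clm w x f (c • ContinuousLinearMap.id ℝ ℝ)

lemma groupAvg_sub_groupAvg_one (w : Fin n → ℝ) (x : Fin n → Fin m → D) (f : D → F) :
    groupAvg w x f - groupAvg 1 x f = groupAvg (fun i => w i - 1) x f := by
  simp [groupAvg, sub_smul, Finset.sum_sub_distrib, smul_sub]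

lemma norm_groupAvg_le_groupAvg_abs (w : Fin n → ℝ) {x : Fin n → Fin m → D} {f : D → F}
    {f' : D → ℝ} (h : ∀ i k, ‖f (x i k)‖ ≤ f' (x i k)) :
    ‖groupAvg w x f‖ ≤ groupAvg (fun i => |w i|) x f' := by
  simp only [groupAvg]
  rw [norm_smul, Real.norm_of_nonneg (by positivity), smul_eq_mul]
  gcongr
  refine (norm_sum_le _ _).trans (Finset.sum_le_sum fun i _ => ?_)
  rw [norm_smul, Real.norm_eq_abs, smul_eq_mul]
  gcongr
  exact (norm_sum_le _ _).trans (Finset.sum_le_sum fun k _ => h i k)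

lemma norm_groupAvg_le {w : Fin n → ℝ} (hw : ∀ i, 0 ≤ w i) {x : Fin n → Fin m → D} {f : D → F}
    {f' : D → ℝ} (h : ∀ i k, ‖f (x i k)‖ ≤ f' (x i k)) : ‖groupAvg w x f‖ ≤ groupAvg w x f' := by
  simpa only [abs_of_nonneg (hw _)] using norm_groupAvg_le_groupAvg_abs w h

lemma groupAvg_const_le {u : Fin n → ℝ} {r M : ℝ} (hr : 0 ≤ r) (hu : ∑ i, u i ^ 2 ≤ r ^ 2)
    (hm : 0 < m) (x : Fin n → Fin m → D) (hM : 0 ≤ M) :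
    groupAvg (fun i => |u i|) x (fun _ => M) ≤ M * r / √n := by
  have hsum : ∑ i, |u i| ≤ √n * r := by
    rw [← abs_of_nonneg hr, ← Real.sqrt_sq_eq_abs, ← Real.sqrt_mul (Nat.cast_nonneg n)]
    refine Real.le_sqrt_of_sq_le ((sq_sum_le_card_mul_sum_sq (s := Finset.univ)).trans ?_)
    simp only [sq_abs, Finset.card_univ, Fintype.card_fin]
    gcongr
  calc groupAvg (fun i => |u i|) x (fun _ => M)
      = M * (∑ i, |u i|) / n := by
        simp only [groupAvg, Finset.sum_const, Finset.card_univ, Fintype.card_fin, nsmul_eq_mul,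
          smul_eq_mul, ← Finset.sum_mul]
        field_simp
    _ ≤ M * (√n * r) / n := by gcongr
    _ = M * r / √n := by rw [div_eq_mul_inv _ √(n : ℝ), ← Real.sqrt_div_self]; ring

lemma groupAvg_abs_le_mul {u : Fin n → ℝ} {r : ℝ} (hr : 0 ≤ r) (hu : ∑ i, u i ^ 2 ≤ r ^ 2)
    (x : Fin n → Fin m → D) {f : D → ℝ} (hf : ∀ y, 0 ≤ f y) :
    groupAvg (fun i => |u i|) x f ≤ r * groupAvg 1 x f := by
  have hur (i) : |u i| ≤ r := abs_le_of_sq_le_sq ((Finset.single_le_sum (f := fun i => u i ^ 2)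
    (fun _ _ => sq_nonneg _) (Finset.mem_univ i)).trans hu) hr
  simp only [groupAvg, smul_eq_mul, Pi.one_apply, one_mul]
  rw [mul_left_comm, Finset.mul_sum Finset.univ _ r]
  gcongr with i
  · exact Finset.sum_nonneg fun k _ => hf _
  · exact hur i

/-- Where `‖f‖ ≤ M` the weights enter through their `ℓ¹` distance from the uniform weights, and
beyond that level through their `ℓ^∞` distance. -/
lemma norm_groupAvg_sub_groupAvg_one_le {w : Fin n → ℝ} {r : ℝ} (hr : 0 ≤ r)
    (hw : ∑ i, (w i - 1) ^ 2 ≤ r ^ 2) (hm : 0 < m) (x : Fin n → Fin m → D) (f : D → F) {M : ℝ}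
    (hM : 0 ≤ M) :
    ‖groupAvg w x f - groupAvg 1 x f‖ ≤
      M * r / √n + r * groupAvg 1 x (fun y => max (‖f y‖ - M) 0) := by
  rw [groupAvg_sub_groupAvg_one]
  refine (norm_groupAvg_le_groupAvg_abs (f' := fun y => M + max (‖f y‖ - M) 0) _
    fun i k => by linarith [le_max_left (‖f (x i k)‖ - M) 0]).trans ?_
  rw [groupAvg_add]
  exact add_le_add (groupAvg_const_le hr hw hm x hM)
    (groupAvg_abs_le_mul hr hw x fun y => le_max_right _ _)

end GroupAvg

/-! ### Regular arrays of grouped samples -/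

/-- The second moment operator `n⁻¹ ∑ zᵢ zᵢᵀ`. -/
def secondMoment {E : Type*} [NormedAddCommGroup E] [InnerProductSpace ℝ E] {n : ℕ}
    (z : Fin n → E) : E →L[ℝ] E :=
  (n : ℝ)⁻¹ • ∑ i, InnerProductSpace.rankOne ℝ (z i) (z i)

/-- An array of grouped samples which, along the filter `l`, looks like independent observations
with law `P`: it eventually avoids every null set and satisfies the law of large numbers. Turning
convergence in probability into convergence along a filter makes all the arguments about the
likelihood ratio deterministic. -/
structure EmpiricalLaw {α D : Type*} [MeasurableSpace D] (l : Filter α) (P : Measure D)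
    (n m : α → ℕ) (x : ∀ a, Fin (n a) → Fin (m a) → D) : Prop where
  n_tendsto : Tendsto n l atTop
  m_pos : ∀ a, 0 < m a
  ae : ∀ q : D → Prop, (∀ᵐ y ∂P, q y) → ∀ᶠ a in l, ∀ i k, q (x a i k)
  lln : ∀ f : D → ℝ, Integrable f P → Tendsto (fun a => groupAvg 1 (x a) f) l (𝓝 (∫ y, f y ∂P))

/-- The normalized group sums of `ξ` have the right second moments along `l`, and none of them is
of the order `√n`. -/
structure RegularGroups {α D E : Type*} [MeasurableSpace D] [NormedAddCommGroup E]
    [InnerProductSpace ℝ E] (l : Filter α) (P : Measure D) (ξ : D → E)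
    (n m : α → ℕ) (x : ∀ a, Fin (n a) → Fin (m a) → D) : Prop where
  second : Tendsto (fun a => secondMoment (groupSum (x a) ξ)) l
    (𝓝 (∫ y, InnerProductSpace.rankOne ℝ (ξ y) (ξ y) ∂P))
  max_le : ∀ δ : ℝ, 0 < δ → ∀ᶠ a in l, ∀ i, ‖groupSum (x a) ξ i‖ ≤ δ * √(n a : ℝ)

/-- Relative weights with `-2 ∑ log wᵢ ≤ t` along `l`. -/
def LevelLE {α : Type*} (l : Filter α) (n : α → ℕ) (t : ℝ) (w : ∀ a, Fin (n a) → ℝ) : Prop :=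
  ∀ᶠ a in l, IsRelWeight (w a) ∧ negTwoLog (w a) ≤ t

section Truncation

variable {D F : Type*} [MeasurableSpace D] [NormedAddCommGroup F] {P : Measure D} {f : D → F}

lemma integrable_max_norm_sub (hf : Integrable f P) {M : ℝ} (hM : 0 ≤ M) :
    Integrable (fun y => max (‖f y‖ - M) 0) P := by
  refine hf.mono ((hf.norm.aestronglyMeasurable.sub aestronglyMeasurable_const).sup
      aestronglyMeasurable_const) (ae_of_all _ fun y => ?_)
  rw [Real.norm_of_nonneg (le_max_right _ _)]
  exact max_le (by simp [hM]) (norm_nonneg _)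

lemma tendsto_integral_max_norm_sub (hf : Integrable f P) :
    Tendsto (fun M : ℕ => ∫ y, max (‖f y‖ - M) 0 ∂P) atTop (𝓝 0) := by
  suffices h : Tendsto (fun M : ℕ => ∫ y, max (‖f y‖ - M) 0 ∂P) atTop (𝓝 (∫ _, (0 : ℝ) ∂P)) by
    simpa only [integral_zero] using h
  refine tendsto_integral_of_dominated_convergence (fun y => ‖f y‖)
    (fun M => (integrable_max_norm_sub hf M.cast_nonneg).aestronglyMeasurable) hf.norm
    (fun M => ae_of_all _ fun y => ?_) (ae_of_all _ fun y => ?_)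
  · rw [Real.norm_of_nonneg (le_max_right _ _)]
    exact max_le (by linarith [(Nat.cast_nonneg M : (0 : ℝ) ≤ M)]) (norm_nonneg _)
  · refine tendsto_const_nhds.congr' ?_
    filter_upwards [eventually_ge_atTop ⌈‖f y‖⌉₊] with M hM
    exact (max_eq_right (by linarith [Nat.ceil_le.1 hM])).symm

lemma exists_integral_max_norm_sub_lt (hf : Integrable f P) {ε : ℝ} (hε : 0 < ε) :
    ∃ M : ℝ, 0 ≤ M ∧ ∫ y, max (‖f y‖ - M) 0 ∂P < ε := by
  obtain ⟨M, hM⟩ := ((tendsto_integral_max_norm_sub hf).eventually (gt_mem_nhds hε)).exists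
  exact ⟨M, M.cast_nonneg, hM⟩

end Truncation

section Array

variable {α β D F : Type*} [MeasurableSpace D] [NormedAddCommGroup F] [NormedSpace ℝ F]
  {l : Filter α} {P : Measure D} {n m : α → ℕ} {x : ∀ a, Fin (n a) → Fin (m a) → D} {t : ℝ}
  {w : ∀ a, Fin (n a) → ℝ}

lemma levelLE_one (l : Filter α) (n : α → ℕ) : LevelLE l n 0 (fun _ => 1) :=
  Eventually.of_forall fun a => ⟨isRelWeight_one, by simp [negTwoLog]⟩

lemma LevelLE.exists_sum_sub_one_sq_le (h : LevelLE l n t w) :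
    ∃ r : ℝ, 0 < r ∧ ∀ᶠ a in l, ∑ i, (w a i - 1) ^ 2 ≤ r ^ 2 := by
  refine ⟨(2 + √(|t| / 2)) * √(|t| / 2) + 1, by positivity, h.mono fun a ha => ?_⟩
  refine (ha.1.sum_sub_one_sq_le (Real.sqrt_nonneg (|t| / 2)) ?_).trans
    (pow_le_pow_left₀ (by positivity) (by linarith) 2)
  rw [Real.sq_sqrt (by positivity)]
  linarith [ha.2, le_abs_self t]

lemma RegularGroups.comp {E : Type*} [NormedAddCommGroup E] [InnerProductSpace ℝ E] {ξ : D → E}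
    (h : RegularGroups l P ξ n m x) {l' : Filter β} {φ : β → α} (hφ : Tendsto φ l' l) :
    RegularGroups l' P ξ (fun b => n (φ b)) (fun b => m (φ b)) (fun b => x (φ b)) where
  second := h.second.comp hφ
  max_le δ hδ := hφ.eventually (h.max_le δ hδ)

namespace EmpiricalLaw

lemma comp (h : EmpiricalLaw l P n m x) {l' : Filter β} {φ : β → α} (hφ : Tendsto φ l' l) :
    EmpiricalLaw l' P (fun b => n (φ b)) (fun b => m (φ b)) (fun b => x (φ b)) where
  n_tendsto := h.n_tendsto.comp hφ
  m_pos _ := h.m_pos _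
  ae q hq := hφ.eventually (h.ae q hq)
  lln f hf := (h.lln f hf).comp hφ

lemma tendsto_cast (h : EmpiricalLaw l P n m x) : Tendsto (fun a => (n a : ℝ)) l atTop :=
  tendsto_natCast_atTop_atTop.comp h.n_tendsto

lemma tendsto_sqrt (h : EmpiricalLaw l P n m x) : Tendsto (fun a => √(n a : ℝ)) l atTop :=
  Real.tendsto_sqrt_atTop.comp h.tendsto_cast

lemma tendsto_groupAvg_one [FiniteDimensional ℝ F] (h : EmpiricalLaw l P n m x) {f : D → F}
    (hf : Integrable f P) : Tendsto (fun a => groupAvg 1 (x a) f) l (𝓝 (∫ y, f y ∂P)) := by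
  have : CompleteSpace F := FiniteDimensional.complete ℝ F
  let e : F ≃L[ℝ] (Fin (Module.finrank ℝ F) → ℝ) := ContinuousLinearEquiv.ofFinrankEq (by simp)
  have hcoord : Tendsto (fun a => e (groupAvg 1 (x a) f)) l (𝓝 (e (∫ y, f y ∂P))) := by
    refine tendsto_pi_nhds.2 fun j => ?_
    let L : F →L[ℝ] ℝ := (ContinuousLinearMap.proj (R := ℝ) (φ := fun _ => ℝ) j).comp
      (e : F →L[ℝ] (Fin (Module.finrank ℝ F) → ℝ))
    have hL := h.lln _ (L.integrable_comp hf)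
    simp_rw [L.integral_comp_comm hf, groupAvg_clm] at hL
    exact hL
  simpa [Function.comp_def] using (e.symm.continuous.tendsto _).comp hcoord

lemma tendsto_groupAvg_sub_groupAvg_one (h : EmpiricalLaw l P n m x) (hw : LevelLE l n t w)
    {f : D → F} (hf : Integrable f P) :
    Tendsto (fun a => groupAvg (w a) (x a) f - groupAvg 1 (x a) f) l (𝓝 0) := by
  obtain ⟨r, hr, hwr⟩ := hw.exists_sum_sub_one_sq_le
  rw [Metric.tendsto_nhds]
  intro ε hε
  obtain ⟨M, hM0, hM⟩ := exists_integral_max_norm_sub_lt hf (div_pos hε hr)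
  have hbound : Tendsto (fun a => M * r / √(n a) +
      r * groupAvg 1 (x a) (fun y => max (‖f y‖ - M) 0)) l
      (𝓝 (0 + r * ∫ y, max (‖f y‖ - M) 0 ∂P)) :=
    (tendsto_const_nhds.div_atTop h.tendsto_sqrt).add
      ((h.lln _ (integrable_max_norm_sub hf hM0)).const_mul r)
  have hlt : 0 + r * ∫ y, max (‖f y‖ - M) 0 ∂P < ε := by
    rwa [zero_add, mul_comm, ← lt_div_iff₀ hr]
  filter_upwards [hwr, hbound.eventually (gt_mem_nhds hlt)] with a hwa ha
  rw [dist_zero_right]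
  exact (norm_groupAvg_sub_groupAvg_one_le hr.le hwa (h.m_pos a) (x a) f hM0).trans_lt ha

lemma tendsto_groupAvg [FiniteDimensional ℝ F] (h : EmpiricalLaw l P n m x)
    (hw : LevelLE l n t w) {f : D → F} (hf : Integrable f P) :
    Tendsto (fun a => groupAvg (w a) (x a) f) l (𝓝 (∫ y, f y ∂P)) := by
  simpa using (h.tendsto_groupAvg_sub_groupAvg_one hw hf).add (h.tendsto_groupAvg_one hf)

lemma groupMean_abs_le (h : EmpiricalLaw l P n m x) {f : D → ℝ} (hf : Integrable f P) {δ : ℝ}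
    (hδ : 0 < δ) : ∀ᶠ a in l, ∀ i, (m a : ℝ)⁻¹ * ∑ k, |f (x a i k)| ≤ δ * n a := by
  obtain ⟨M, hM0, hM⟩ := exists_integral_max_norm_sub_lt hf (half_pos hδ)
  filter_upwards [(h.lln _ (integrable_max_norm_sub hf hM0)).eventually (gt_mem_nhds hM),
    h.tendsto_cast.eventually_ge_atTop (2 * M / δ), h.n_tendsto.eventually_gt_atTop 0]
    with a havg hlarge hn i
  have hm : (0 : ℝ) < m a := Nat.cast_pos.2 (h.m_pos a)
  have hn' : (0 : ℝ) < n a := Nat.cast_pos.2 hn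
  have htail : (m a : ℝ)⁻¹ * ∑ k, max (|f (x a i k)| - M) 0 ≤
      n a * groupAvg 1 (x a) (fun y => max (|f y| - M) 0) := by
    simp only [groupAvg, Pi.one_apply, smul_eq_mul, one_mul]
    rw [← mul_assoc, mul_inv, mul_inv_cancel_left₀ hn'.ne']
    gcongr
    exact Finset.single_le_sum (f := fun i => ∑ k, max (|f (x a i k)| - M) 0)
      (fun i _ => Finset.sum_nonneg fun k _ => le_max_right _ _) (Finset.mem_univ i)
  calc (m a : ℝ)⁻¹ * ∑ k, |f (x a i k)|
      ≤ (m a : ℝ)⁻¹ * ∑ k : Fin (m a), (M + max (|f (x a i k)| - M) 0) := by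
        gcongr with k
        linarith [le_max_left (|f (x a i k)| - M) 0]
    _ = M + (m a : ℝ)⁻¹ * ∑ k, max (|f (x a i k)| - M) 0 := by
        simp [Finset.sum_add_distrib, mul_add, hm.ne']
    _ ≤ δ / 2 * n a + n a * (δ / 2) := by
        refine add_le_add ?_ (htail.trans (by gcongr; exact havg.le))
        rw [div_le_iff₀ hδ] at hlarge
        linarith
    _ = δ * n a := by ring

end EmpiricalLaw

end Array

/-! ### Quadratic approximation of the empirical log-likelihood ratio -/

section Quadratic

open scoped RealInnerProductSpace

lemma abs_log_one_sub_add_le {b δ : ℝ} (hb : |b| ≤ δ) (hδ : δ ≤ 1 / 2) :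
    |Real.log (1 - b) + b + b ^ 2 / 2| ≤ 2 * δ * b ^ 2 := by
  have htaylor : |b + b ^ 2 / 2 + Real.log (1 - b)| ≤ |b| ^ 3 / (1 - |b|) := by
    have := Real.abs_log_sub_add_sum_range_le (x := b) (by linarith) 2
    norm_num [Finset.sum_range_succ] at this
    exact this
  have hcube : |b| ^ 3 ≤ δ * b ^ 2 := by
    rw [pow_succ', sq_abs]
    gcongr
  have hδ0 : 0 ≤ δ := (abs_nonneg b).trans hb
  calc |Real.log (1 - b) + b + b ^ 2 / 2| = |b + b ^ 2 / 2 + Real.log (1 - b)| := by ring_nf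
    _ ≤ δ * b ^ 2 / (1 / 2) := htaylor.trans (by gcongr; linarith)
    _ = 2 * δ * b ^ 2 := by ring

/-- Weak duality: `1 + a` is the reciprocal of a dual feasible tilt. -/
lemma IsRelWeight.le_negTwoLog {n : ℕ} {w a : Fin n → ℝ} (hw : IsRelWeight w) {δ : ℝ}
    (ha : ∀ i, |a i| ≤ δ) (hδ : δ ≤ 1 / 4) (hwa : ∑ i, w i * a i = 0) :
    2 * ∑ i, a i - (1 + 4 * δ) * ∑ i, a i ^ 2 ≤ negTwoLog w := by
  have hterm (i) :
      2 * Real.log (w i) ≤ 2 * (w i * a i + (w i - 1) - a i) + (1 + 4 * δ) * a i ^ 2 := by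
    have hpos : 0 < 1 + a i := by linarith [(abs_le.1 (ha i)).1]
    have hdual := Real.log_le_sub_one_of_pos (mul_pos (hw.1 i) hpos)
    rw [Real.log_mul (hw.1 i).ne' hpos.ne'] at hdual
    have htaylor := abs_log_one_sub_add_le (b := -a i) ((abs_neg _).trans_le (ha i))
      (by linarith)
    rw [sub_neg_eq_add, neg_sq] at htaylor
    linarith [(abs_le.1 htaylor).1]
  have hsum := Finset.sum_le_sum fun i (_ : i ∈ Finset.univ) => hterm i
  simp only [Finset.sum_add_distrib, Finset.sum_sub_distrib, ← Finset.mul_sum, hwa, hw.2,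
    Finset.sum_const, Finset.card_univ, Fintype.card_fin, nsmul_eq_mul, mul_one] at hsum
  simp only [negTwoLog]
  linarith

lemma negTwoLog_one_sub_le {n : ℕ} {b : Fin n → ℝ} {δ : ℝ} (hb : ∀ i, |b i| ≤ δ)
    (hδ : δ ≤ 1 / 4) :
    negTwoLog (fun i => 1 - b i) ≤ 2 * ∑ i, b i + (1 + 4 * δ) * ∑ i, b i ^ 2 := by
  simp only [negTwoLog, Finset.mul_sum, ← Finset.sum_add_distrib]
  refine Finset.sum_le_sum fun i _ => ?_
  linarith [(abs_le.1 (abs_log_one_sub_add_le (hb i) (by linarith))).1]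

variable {E : Type*} [NormedAddCommGroup E] [InnerProductSpace ℝ E]

/-- The sample `z` centred at its mean. -/
def centered {n : ℕ} (z : Fin n → E) (i : Fin n) : E := z i - (n : ℝ)⁻¹ • ∑ j, z j

lemma sum_centered {n : ℕ} (z : Fin n → E) : ∑ i, centered z i = 0 := by
  rcases n.eq_zero_or_pos with rfl | hn
  · simp
  · simp [centered, Finset.sum_sub_distrib, ← Nat.cast_smul_eq_nsmul ℝ, smul_smul, hn.ne']

lemma secondMoment_apply {n : ℕ} (z : Fin n → E) (v : E) :
    secondMoment z v = (n : ℝ)⁻¹ • ∑ i, ⟪v, z i⟫ • z i := by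
  simp [secondMoment, real_inner_comm]

lemma secondMoment_centered {n : ℕ} (z : Fin n → E) :
    secondMoment (centered z) = secondMoment z -
      InnerProductSpace.rankOne ℝ ((n : ℝ)⁻¹ • ∑ j, z j) ((n : ℝ)⁻¹ • ∑ j, z j) := by
  ext v
  have hmean : ∑ i, ⟪v, centered z i⟫ • ((n : ℝ)⁻¹ • ∑ j, z j) = 0 := by
    rw [← Finset.sum_smul, ← inner_sum, sum_centered, inner_zero_right, zero_smul]
  have hcross : ∑ i, ⟪v, (n : ℝ)⁻¹ • ∑ j, z j⟫ • z i =
      ⟪v, (n : ℝ)⁻¹ • ∑ j, z j⟫ • ∑ j, z j := (Finset.smul_sum ..).symm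
  calc secondMoment (centered z) v = (n : ℝ)⁻¹ • ∑ i, ⟪v, centered z i⟫ • z i := by
        rw [secondMoment_apply]
        congr 1
        conv_lhs => enter [2, i, 2]; rw [centered]
        simp only [smul_sub, Finset.sum_sub_distrib, hmean, sub_zero]
    _ = _ := by
        simp only [centered, inner_sub_right, sub_smul, Finset.sum_sub_distrib, hcross, smul_sub,
          sub_apply, secondMoment_apply, InnerProductSpace.rankOne_apply]
        rw [real_inner_comm, smul_comm (n : ℝ)⁻¹ ⟪_, _⟫]

lemma inner_secondMoment_self {n : ℕ} (z : Fin n → E) (v : E) :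
    ⟪secondMoment z v, v⟫ = (n : ℝ)⁻¹ * ∑ i, ⟪v, z i⟫ ^ 2 := by
  rw [secondMoment_apply, real_inner_comm, real_inner_smul_right, inner_sum]
  simp only [real_inner_smul_right, sq]

lemma sum_inv_sqrt_mul_inner_sq {n : ℕ} (z : Fin n → E) (v : E) :
    ∑ i, ((√(n : ℝ))⁻¹ * ⟪v, z i⟫) ^ 2 = ⟪secondMoment z v, v⟫ := by
  simp only [inner_secondMoment_self, mul_pow, inv_pow, Real.sq_sqrt n.cast_nonneg, Finset.mul_sum]

lemma abs_inv_sqrt_mul_inner_le {n : ℕ} {κ v : E} {δ : ℝ} (hn : 0 < n)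
    (h : ‖κ‖ * ‖v‖ ≤ δ * √(n : ℝ)) : |(√(n : ℝ))⁻¹ * ⟪κ, v⟫| ≤ δ := by
  have hsqrt : 0 < √(n : ℝ) := Real.sqrt_pos.2 (Nat.cast_pos.2 hn)
  rw [abs_mul, abs_of_pos (inv_pos.2 hsqrt), inv_mul_le_iff₀ hsqrt, mul_comm √(n : ℝ)]
  exact (abs_real_inner_le_norm _ _).trans h

lemma IsRelWeight.inner_sub_le_negTwoLog {n : ℕ} {w : Fin n → ℝ} (hw : IsRelWeight w)
    {z : Fin n → E} (hwz : ∑ i, w i • z i = 0) {κ : E} {δ : ℝ} (hδ : δ ≤ 1 / 4)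
    (hκz : ∀ i, ‖κ‖ * ‖z i‖ ≤ δ * √(n : ℝ)) :
    2 * ⟪κ, (√(n : ℝ))⁻¹ • ∑ i, z i⟫ - (1 + 4 * δ) * ⟪secondMoment z κ, κ⟫ ≤ negTwoLog w := by
  rw [← sum_inv_sqrt_mul_inner_sq, inner_smul_right, inner_sum, Finset.mul_sum]
  refine hw.le_negTwoLog (fun i => abs_inv_sqrt_mul_inner_le i.pos (hκz i)) hδ ?_
  calc ∑ i, w i * ((√(n : ℝ))⁻¹ * ⟪κ, z i⟫) = (√(n : ℝ))⁻¹ * ⟪κ, ∑ i, w i • z i⟫ := by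
        rw [inner_sum, Finset.mul_sum]
        simp only [inner_smul_right, mul_left_comm]
    _ = 0 := by rw [hwz, inner_zero_right, mul_zero]

lemma exists_isRelWeight_negTwoLog_le {n : ℕ} (hn : 0 < n) {z : Fin n → E} {κ : E} {δ : ℝ}
    (hδ : δ ≤ 1 / 4) (hκ : secondMoment (centered z) κ = (√(n : ℝ))⁻¹ • ∑ i, z i)
    (hκz : ∀ i, ‖κ‖ * ‖centered z i‖ ≤ δ * √(n : ℝ)) :
    ∃ w : Fin n → ℝ, IsRelWeight w ∧ ∑ i, w i • z i = 0 ∧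
      negTwoLog w ≤ (1 + 4 * δ) * ⟪(√(n : ℝ))⁻¹ • ∑ i, z i, κ⟫ := by
  have hsqrt : √(n : ℝ) ≠ 0 := (Real.sqrt_pos.2 (Nat.cast_pos.2 hn)).ne'
  set b : Fin n → ℝ := fun i => (√(n : ℝ))⁻¹ * ⟪κ, centered z i⟫
  have hb (i) : |b i| ≤ δ := abs_inv_sqrt_mul_inner_le hn (hκz i)
  have hb_sum : ∑ i, b i = 0 := by
    rw [← Finset.mul_sum, ← inner_sum, sum_centered, inner_zero_right, mul_zero]
  have hb_smul : ∑ i, b i • z i = ∑ i, z i := calc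
    ∑ i, b i • z i = ∑ i, b i • centered z i := by
      simp only [centered, smul_sub, Finset.sum_sub_distrib, ← Finset.sum_smul, hb_sum, zero_smul,
        sub_zero]
    _ = √(n : ℝ) • secondMoment (centered z) κ := by
      rw [secondMoment_apply, smul_smul, ← div_eq_mul_inv, Real.sqrt_div_self', one_div,
        Finset.smul_sum]
      exact Finset.sum_congr rfl fun i _ => mul_smul _ _ _
    _ = ∑ i, z i := by rw [hκ, smul_inv_smul₀ hsqrt]
  refine ⟨fun i => 1 - b i, ⟨fun i => by linarith [(abs_le.1 (hb i)).2], ?_⟩, ?_, ?_⟩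
  · simp [Finset.sum_sub_distrib, hb_sum]
  · simp [sub_smul, Finset.sum_sub_distrib, hb_smul]
  · refine (negTwoLog_one_sub_le hb hδ).trans_eq ?_
    rw [hb_sum, mul_zero, zero_add, sum_inv_sqrt_mul_inner_sq, hκ]

lemma exists_le_quarter_mul_le (C : ℝ) {ε : ℝ} (hε : 0 < ε) :
    ∃ δ : ℝ, 0 < δ ∧ δ ≤ 1 / 4 ∧ 4 * δ * C ≤ ε := by
  refine ⟨min (1 / 4) (ε / (4 * (|C| + 1))), by positivity, min_le_left _ _, ?_⟩
  have hδ : min (1 / 4) (ε / (4 * (|C| + 1))) ≤ ε / (4 * (|C| + 1)) := min_le_right _ _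
  rw [le_div_iff₀ (by positivity)] at hδ
  have : 0 < min (1 / 4) (ε / (4 * (|C| + 1))) := by positivity
  nlinarith [le_abs_self C]

variable {α : Type*} {l : Filter α}

lemma tendsto_clm_apply_sub {U : α → E →L[ℝ] E} {V : E →L[ℝ] E} (hU : Tendsto U l (𝓝 V))
    {κ : α → E} (hκ : IsBoundedUnder (· ≤ ·) l (fun a => ‖κ a‖)) :
    Tendsto (fun a => U a (κ a) - V (κ a)) l (𝓝 0) :=
  (tendsto_sub_nhds_zero_iff.2 hU).op_zero_isBoundedUnder_le hκ (fun L v => L v)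
    fun L v => L.le_opNorm v

lemma tendsto_inner_apply_self_sub {U : α → E →L[ℝ] E} {V : E →L[ℝ] E} (hU : Tendsto U l (𝓝 V))
    {κ : α → E} (hκ : IsBoundedUnder (· ≤ ·) l (fun a => ‖κ a‖)) :
    Tendsto (fun a => ⟪U a (κ a), κ a⟫ - ⟪V (κ a), κ a⟫) l (𝓝 0) := by
  simpa only [inner_sub_left] using (tendsto_clm_apply_sub hU hκ).op_zero_isBoundedUnder_le hκ
    (fun u v : E => ⟪u, v⟫) fun u v => norm_inner_le_norm u v

lemma exists_eventually_apply_eq [FiniteDimensional ℝ E] {U : α → E →L[ℝ] E} {V : E →L[ℝ] E}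
    (hU : Tendsto U l (𝓝 V)) (hV : Function.Injective V) {κ s : α → E}
    (hκ : IsBoundedUnder (· ≤ ·) l (fun a => ‖κ a‖))
    (hs : Tendsto (fun a => s a - V (κ a)) l (𝓝 0)) :
    ∃ κ' : α → E, (∀ᶠ a in l, U a (κ' a) = s a) ∧ Tendsto (fun a => κ' a - κ a) l (𝓝 0) := by
  have : CompleteSpace E := FiniteDimensional.complete ℝ E
  let e : E ≃L[ℝ] E := (LinearEquiv.ofInjectiveEndo (V : E →ₗ[ℝ] E) hV).toContinuousLinearEquiv
  have he : (e : E →L[ℝ] E) = V := by ext v; rfl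
  rw [← he] at hU
  have hinv : Tendsto (fun a => (U a).inverse) l (𝓝 (e.symm : E →L[ℝ] E)) := by
    simpa [Function.comp_def] using
      (contDiffAt_map_inverse (𝕜 := ℝ) (n := 1) e).continuousAt.tendsto.comp hU
  have hresidual : Tendsto (fun a => s a - U a (κ a)) l (𝓝 0) := by
    simpa [he] using hs.sub (tendsto_clm_apply_sub hU hκ)
  refine ⟨fun a => κ a + (U a).inverse (s a - U a (κ a)), ?_, ?_⟩
  · filter_upwards [hU.eventually (ContinuousLinearEquiv.nhds e)] with a ⟨e', he'⟩
    simp [← he']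
  · simpa only [add_sub_cancel_left, map_zero, Function.comp_def] using
      (isBoundedBilinearMap_apply.continuous.tendsto ((e.symm : E →L[ℝ] E), (0 : E))).comp
        (hinv.prodMk_nhds hresidual)

variable {n : α → ℕ} {z : ∀ a, Fin (n a) → E} {V : E →L[ℝ] E} {κ : α → E} {R ε : ℝ}

lemma eventually_le_negTwoLog (hV : Tendsto (fun a => secondMoment (z a)) l (𝓝 V))
    (hmax : ∀ δ : ℝ, 0 < δ → ∀ᶠ a in l, ∀ i, ‖z a i‖ ≤ δ * √(n a : ℝ))
    (hκ : ∀ᶠ a in l, ‖κ a‖ ≤ R)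
    {w : ∀ a, Fin (n a) → ℝ} (hw : ∀ᶠ a in l, IsRelWeight (w a))
    (hwz : ∀ᶠ a in l, ∑ i, w a i • z a i = 0) (hε : 0 < ε) :
    ∀ᶠ a in l, 2 * ⟪κ a, (√(n a : ℝ))⁻¹ • ∑ i, z a i⟫ - ⟪V (κ a), κ a⟫ - ε ≤
      negTwoLog (w a) := by
  obtain ⟨δ, hδ, hδ4, hδC⟩ := exists_le_quarter_mul_le (‖V‖ * (|R| + 1) ^ 2 + ε / 2) (half_pos hε)
  filter_upwards [hκ, hw, hwz, hmax (δ / (|R| + 1)) (by positivity),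
    (tendsto_inner_apply_self_sub hV (isBoundedUnder_of_eventually_le hκ)).eventually
      (gt_mem_nhds (half_pos hε))] with a hκ hw hwz hmax hV
  have hκR : ‖κ a‖ ≤ |R| + 1 := by linarith [le_abs_self R]
  have hlower := hw.inner_sub_le_negTwoLog hwz (κ := κ a) hδ4 fun i => calc
    ‖κ a‖ * ‖z a i‖ ≤ (|R| + 1) * (δ / (|R| + 1) * √(n a : ℝ)) := by gcongr; exact hmax i
    _ = δ * √(n a : ℝ) := by field_simp
  have hVκ : ⟪V (κ a), κ a⟫ ≤ ‖V‖ * (|R| + 1) ^ 2 := calc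
    ⟪V (κ a), κ a⟫ ≤ ‖V‖ * ‖κ a‖ * ‖κ a‖ :=
      (real_inner_le_norm _ _).trans (by gcongr; exact V.le_opNorm _)
    _ ≤ ‖V‖ * (|R| + 1) ^ 2 := by rw [sq, mul_assoc]; gcongr
  have hδV : 4 * δ * ⟪secondMoment (z a) (κ a), κ a⟫ ≤ ε / 2 :=
    (mul_le_mul_of_nonneg_left (by linarith) (by positivity)).trans hδC
  linarith

lemma tendsto_secondMoment_centered (hn : Tendsto n l atTop)
    (hV : Tendsto (fun a => secondMoment (z a)) l (𝓝 V))
    (hz : IsBoundedUnder (· ≤ ·) l fun a => ‖(√(n a : ℝ))⁻¹ • ∑ i, z a i‖) :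
    Tendsto (fun a => secondMoment (centered (z a))) l (𝓝 V) ∧
      Tendsto (fun a => (n a : ℝ)⁻¹ • ∑ i, z a i) l (𝓝 0) := by
  have hsqrt : Tendsto (fun a => (√(n a : ℝ))⁻¹) l (𝓝 0) :=
    tendsto_inv_atTop_zero.comp (Real.tendsto_sqrt_atTop.comp
      (tendsto_natCast_atTop_atTop.comp hn))
  have hmean : Tendsto (fun a => (n a : ℝ)⁻¹ • ∑ i, z a i) l (𝓝 0) := by
    refine (hsqrt.zero_smul_isBoundedUnder_le hz).congr fun a => ?_
    rw [smul_smul, ← mul_inv, Real.mul_self_sqrt (Nat.cast_nonneg _)]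
  refine ⟨?_, hmean⟩
  have hrankOne : Tendsto (fun a => InnerProductSpace.rankOne ℝ ((n a : ℝ)⁻¹ • ∑ i, z a i)
      ((n a : ℝ)⁻¹ • ∑ i, z a i)) l (𝓝 0) := by
    rw [tendsto_zero_iff_norm_tendsto_zero]
    simpa only [InnerProductSpace.norm_rankOne, norm_zero, mul_zero]
      using hmean.norm.mul hmean.norm
  simpa only [secondMoment_centered, sub_zero] using hV.sub hrankOne

lemma eventually_exists_negTwoLog_le [FiniteDimensional ℝ E] (hn : Tendsto n l atTop)
    (hV : Tendsto (fun a => secondMoment (z a)) l (𝓝 V)) (hVinj : Function.Injective V)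
    (hmax : ∀ δ : ℝ, 0 < δ → ∀ᶠ a in l, ∀ i, ‖z a i‖ ≤ δ * √(n a : ℝ))
    (hκ : ∀ᶠ a in l, ‖κ a‖ ≤ R)
    (hs : Tendsto (fun a => (√(n a : ℝ))⁻¹ • ∑ i, z a i - V (κ a)) l (𝓝 0)) (hε : 0 < ε) :
    ∀ᶠ a in l, ∃ w : Fin (n a) → ℝ, IsRelWeight w ∧ ∑ i, w i • z a i = 0 ∧
      negTwoLog w ≤ ⟪V (κ a), κ a⟫ + ε := by
  set s : α → E := fun a => (√(n a : ℝ))⁻¹ • ∑ i, z a i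
  have hκ_bdd : IsBoundedUnder (· ≤ ·) l fun a => ‖κ a‖ := isBoundedUnder_of_eventually_le hκ
  have hVκ : ∀ᶠ a in l, ‖V (κ a)‖ ≤ ‖V‖ * R := hκ.mono fun a h => V.le_opNorm_of_le h
  have hs_le : ∀ᶠ a in l, ‖s a‖ ≤ ‖V‖ * R + 1 := by
    filter_upwards [hVκ, hs.norm.eventually (ge_mem_nhds (by simp : ‖(0 : E)‖ < 1))] with a h₁ h₂
    linarith [norm_le_norm_add_norm_sub' (s a) (V (κ a))]
  obtain ⟨hcov, hmean⟩ :=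
    tendsto_secondMoment_centered hn hV (isBoundedUnder_of_eventually_le hs_le)
  obtain ⟨κ', hκ'_eq, hκ'⟩ := exists_eventually_apply_eq hcov hVinj hκ_bdd hs
  have hκ'_le : ∀ᶠ a in l, ‖κ' a‖ ≤ |R| + 1 := by
    filter_upwards [hκ, hκ'.norm.eventually (ge_mem_nhds (by simp : ‖(0 : E)‖ < 1))] with a h₁ h₂
    linarith [norm_le_norm_add_norm_sub' (κ' a) (κ a), le_abs_self R]
  have hval : Tendsto (fun a => ⟪s a, κ' a⟫ - ⟪V (κ a), κ a⟫) l (𝓝 0) := by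
    have h₁ := hs.op_zero_isBoundedUnder_le (isBoundedUnder_of_eventually_le hκ'_le)
      (fun u v : E => ⟪u, v⟫) fun u v => norm_inner_le_norm u v
    have h₂ := hκ'.op_zero_isBoundedUnder_le (isBoundedUnder_of_eventually_le hVκ)
      (fun u v : E => ⟪v, u⟫) fun u v => (norm_inner_le_norm v u).trans_eq (mul_comm _ _)
    simpa [inner_sub_left, inner_sub_right] using h₁.add h₂
  obtain ⟨δ, hδ, hδ4, hδC⟩ :=
    exists_le_quarter_mul_le ((‖V‖ * R + 1) * (|R| + 1)) (half_pos hε)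
  have hη : 0 < δ / (2 * (|R| + 1)) := by positivity
  filter_upwards [hκ'_eq, hκ'_le, hs_le, hmax _ hη, hn.eventually_gt_atTop 0,
    hval.eventually (gt_mem_nhds (half_pos hε)),
    hmean.norm.eventually (gt_mem_nhds (by simpa using hη))]
    with a hκ'_eq hκ'_le hs_le hmax hn hval hmean
  have hsqrt : 1 ≤ √(n a : ℝ) := Real.one_le_sqrt.2 (by exact_mod_cast hn)
  have hcentered (i) : ‖centered (z a) i‖ ≤ 2 * (δ / (2 * (|R| + 1)) * √(n a : ℝ)) :=
    (norm_sub_le _ _).trans (by linarith [hmax i, le_mul_of_one_le_right hη.le hsqrt])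
  obtain ⟨w, hw, hwz, hle⟩ := exists_isRelWeight_negTwoLog_le hn hδ4 hκ'_eq fun i => calc
    ‖κ' a‖ * ‖centered (z a) i‖ ≤ (|R| + 1) * (2 * (δ / (2 * (|R| + 1)) * √(n a : ℝ))) := by
      gcongr; exact hcentered i
    _ = δ * √(n a : ℝ) := by field_simp
  have hδs : 4 * δ * ⟪s a, κ' a⟫ ≤ ε / 2 := (mul_le_mul_of_nonneg_left
    ((real_inner_le_norm _ _).trans (mul_le_mul hs_le hκ'_le (norm_nonneg _)
      ((norm_nonneg _).trans hs_le))) (by positivity)).trans hδC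
  exact ⟨w, hw, hwz, hle.trans (by linarith)⟩

end Quadratic

/-! ### Local linear approximation of the weighted estimating equations -/

/-- On `U`, `f` has continuous first and second derivatives, both bounded by `H`: the condition
which `RegularOn` imposes on almost every `g x`. -/
def C2BoundOn {E F : Type*} [NormedAddCommGroup E] [NormedSpace ℝ E] [NormedAddCommGroup F]
    [NormedSpace ℝ F] (f : E → F) (U : Set E) (H : ℝ) : Prop :=
  ContDiffOn ℝ 2 f U ∧ ∀ θ ∈ U, ‖fderiv ℝ f θ‖ ≤ H ∧ ‖fderiv ℝ (fderiv ℝ f) θ‖ ≤ H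

section Smooth

variable {E F D : Type*} [NormedAddCommGroup E] [NormedSpace ℝ E] [NormedAddCommGroup F]
  [NormedSpace ℝ F] {f : E → F} {U K : Set E} {H δ : ℝ} {θ₀ θ θ' : E}

namespace C2BoundOn

lemma differentiableAt (hf : C2BoundOn f U H) (hU : IsOpen U) (hθ : θ ∈ U) :
    DifferentiableAt ℝ f θ :=
  (hf.1.differentiableOn two_ne_zero).differentiableAt (hU.mem_nhds hθ)

lemma differentiableAt_fderiv (hf : C2BoundOn f U H) (hU : IsOpen U) (hθ : θ ∈ U) :
    DifferentiableAt ℝ (fderiv ℝ f) θ :=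
  ((hf.1.fderiv_of_isOpen hU (m := 1) (by norm_num)).differentiableOn one_ne_zero).differentiableAt
    (hU.mem_nhds hθ)

lemma norm_image_sub_le (hf : C2BoundOn f U H) (hU : IsOpen U) (hK : Convex ℝ K) (hKU : K ⊆ U)
    (hθ : θ ∈ K) (hθ' : θ' ∈ K) : ‖f θ - f θ'‖ ≤ H * ‖θ - θ'‖ :=
  hK.norm_image_sub_le_of_norm_fderiv_le (fun _ hy => hf.differentiableAt hU (hKU hy))
    (fun _ hy => (hf.2 _ (hKU hy)).1) hθ' hθ

lemma norm_image_sub_sub_fderiv_le (hf : C2BoundOn f U H) (hU : IsOpen U)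
    (hδU : Metric.closedBall θ₀ δ ⊆ U) (hθ : θ ∈ Metric.closedBall θ₀ δ)
    (hθ' : θ' ∈ Metric.closedBall θ₀ δ) :
    ‖f θ - f θ' - fderiv ℝ f θ₀ (θ - θ')‖ ≤ H * δ * ‖θ - θ'‖ := by
  have hθ₀ : θ₀ ∈ Metric.closedBall θ₀ δ :=
    Metric.mem_closedBall_self (dist_nonneg.trans (Metric.mem_closedBall.1 hθ))
  have hH : 0 ≤ H := (norm_nonneg _).trans (hf.2 θ₀ (hδU hθ₀)).1
  refine (convex_closedBall θ₀ δ).norm_image_sub_le_of_norm_hasFDerivWithin_le'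
    (f' := fderiv ℝ f)
    (fun y hy => (hf.differentiableAt hU (hδU hy)).hasFDerivAt.hasFDerivWithinAt)
    (fun y hy => ?_) hθ' hθ
  calc ‖fderiv ℝ f y - fderiv ℝ f θ₀‖ ≤ H * ‖y - θ₀‖ :=
        (convex_closedBall θ₀ δ).norm_image_sub_le_of_norm_fderiv_le
          (fun y hy => hf.differentiableAt_fderiv hU (hδU hy)) (fun y hy => (hf.2 y (hδU hy)).2)
          hθ₀ hy
    _ ≤ H * δ := mul_le_mul_of_nonneg_left (mem_closedBall_iff_norm.1 hy) hH

end C2BoundOn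

lemma norm_groupAvg_sub_sub_fderiv_le {g : D → E → F} {H : D → ℝ} {n m : ℕ} {w : Fin n → ℝ}
    (hw : ∀ i, 0 ≤ w i) {x : Fin n → Fin m → D} (hg : ∀ i k, C2BoundOn (g (x i k)) U (H (x i k)))
    (hU : IsOpen U) (hδU : Metric.closedBall θ₀ δ ⊆ U) (hθ : θ ∈ Metric.closedBall θ₀ δ)
    (hθ' : θ' ∈ Metric.closedBall θ₀ δ) :
    ‖groupAvg w x (fun y => g y θ) - groupAvg w x (fun y => g y θ') -
      groupAvg w x (fun y => fderiv ℝ (g y) θ₀) (θ - θ')‖ ≤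
      δ * groupAvg w x H * ‖θ - θ'‖ := by
  have happly := groupAvg_clm w x (fun y => fderiv ℝ (g y) θ₀)
    (ContinuousLinearMap.apply ℝ F (θ - θ'))
  simp only [ContinuousLinearMap.apply_apply] at happly
  rw [← happly, ← groupAvg_sub, ← groupAvg_sub, mul_right_comm, ← groupAvg_const_mul]
  refine norm_groupAvg_le hw fun i k => ?_
  rw [mul_comm, ← mul_assoc]
  exact (hg i k).norm_image_sub_sub_fderiv_le hU hδU hθ hθ'

lemma exists_pos_mul_norm_le_of_injective [FiniteDimensional ℝ E] {J : E →L[ℝ] F}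
    (hJ : Function.Injective J) : ∃ c > 0, ∀ v, c * ‖v‖ ≤ ‖J v‖ := by
  obtain ⟨K, hK, hJK⟩ := (J : E →ₗ[ℝ] F).exists_antilipschitzWith (LinearMap.ker_eq_bot.2 hJ)
  refine ⟨(K : ℝ)⁻¹, by positivity, fun v => ?_⟩
  rw [inv_mul_le_iff₀ (by positivity)]
  simpa only [dist_zero_right, map_zero, ContinuousLinearMap.coe_coe] using hJK.le_mul_dist v 0

/-- A quantitative inverse function theorem, uniform in `f`. -/
lemma exists_pos_forall_exists_eq_zero [FiniteDimensional ℝ E] {J : E →L[ℝ] E}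
    (hJ : Function.Injective J) :
    ∃ ε > 0, ∀ (f : E → E) (θ₀ : E) (δ : ℝ), 0 ≤ δ → ‖f θ₀‖ ≤ ε * δ →
      (∀ θ ∈ Metric.closedBall θ₀ δ, ∀ θ' ∈ Metric.closedBall θ₀ δ,
        ‖f θ - f θ' - J (θ - θ')‖ ≤ ε * ‖θ - θ'‖) →
      ∃ θ ∈ Metric.closedBall θ₀ δ, f θ = 0 := by
  have : CompleteSpace E := FiniteDimensional.complete ℝ E
  let e : E ≃L[ℝ] E := (LinearEquiv.ofInjectiveEndo (J : E →ₗ[ℝ] E) hJ).toContinuousLinearEquiv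
  rcases subsingleton_or_nontrivial E with hE | hE
  · exact ⟨1, one_pos, fun f θ₀ δ hδ _ _ =>
      ⟨θ₀, Metric.mem_closedBall_self hδ, Subsingleton.elim _ _⟩⟩
  set ε : NNReal := ‖(e.symm : E →L[ℝ] E)‖₊⁻¹ / 2 with hε
  have hε_pos : 0 < ε := half_pos (inv_pos.2 e.nnnorm_symm_pos)
  refine ⟨ε, hε_pos, fun f θ₀ δ hδ hf₀ hf => ?_⟩
  have happrox : ApproximatesLinearOn f (e : E →L[ℝ] E) (Metric.closedBall θ₀ δ) ε := hf
  obtain ⟨θ, hθ, hfθ⟩ := happrox.surjOn_closedBall_of_nonlinearRightInverse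
    e.toNonlinearRightInverse hδ subset_rfl (a := (0 : E)) (by
      have hconst : (e.toNonlinearRightInverse.nnnorm : ℝ)⁻¹ - ε = ε := by
        change ((‖(e.symm : E →L[ℝ] E)‖₊ : NNReal) : ℝ)⁻¹ - ε = ε
        rw [hε]
        push_cast
        ring
      rwa [hconst, mem_closedBall_iff_norm', sub_zero])
  exact ⟨θ, hθ, hfθ⟩

end Smooth

section SecondMoment

open scoped RealInnerProductSpace

variable {E : Type*} [NormedAddCommGroup E] [InnerProductSpace ℝ E] {n : ℕ}

lemma inv_mul_sum_norm_sq_le [FiniteDimensional ℝ E] (z : Fin n → E) :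
    (n : ℝ)⁻¹ * ∑ i, ‖z i‖ ^ 2 ≤ Module.finrank ℝ E * ‖secondMoment z‖ := by
  set b := stdOrthonormalBasis ℝ E
  calc (n : ℝ)⁻¹ * ∑ i, ‖z i‖ ^ 2 = ∑ j, ⟪secondMoment z (b j), b j⟫ := by
        simp_rw [inner_secondMoment_self, ← b.sum_sq_norm_inner_right (z _), Real.norm_eq_abs,
          sq_abs]
        rw [← Finset.mul_sum, Finset.sum_comm]
    _ ≤ ∑ _j : Fin (Module.finrank ℝ E), ‖secondMoment z‖ := by
        gcongr with j
        simpa [b.norm_eq_one] using (real_inner_le_norm _ _).trans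
          (mul_le_mul_of_nonneg_right ((secondMoment z).le_opNorm (b j)) (norm_nonneg (b j)))
    _ = Module.finrank ℝ E * ‖secondMoment z‖ := by simp

lemma norm_sq_inv_sqrt_smul_sum_le {F : Type*} [NormedAddCommGroup F] [NormedSpace ℝ F]
    (u : Fin n → ℝ) (z : Fin n → F) :
    ‖(√(n : ℝ))⁻¹ • ∑ i, u i • z i‖ ^ 2 ≤ (∑ i, u i ^ 2) * ((n : ℝ)⁻¹ * ∑ i, ‖z i‖ ^ 2) := by
  have htriangle : ‖∑ i, u i • z i‖ ≤ ∑ i, |u i| * ‖z i‖ :=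
    (norm_sum_le _ _).trans_eq (Finset.sum_congr rfl fun i _ => norm_smul _ _)
  have hcauchy := Finset.sum_mul_sq_le_sq_mul_sq Finset.univ (fun i => |u i|) (fun i => ‖z i‖)
  simp only [sq_abs] at hcauchy
  rw [norm_smul, mul_pow, norm_inv, inv_pow, Real.norm_of_nonneg (Real.sqrt_nonneg _),
    Real.sq_sqrt (Nat.cast_nonneg _), mul_left_comm]
  gcongr
  exact (pow_le_pow_left₀ (norm_nonneg _) htriangle 2).trans hcauchy

lemma norm_rankOne_self_sub_le (u v : E) :
    ‖InnerProductSpace.rankOne ℝ u u - InnerProductSpace.rankOne ℝ v v‖ ≤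
      ‖u - v‖ * (‖u‖ + ‖v‖) := by
  have hsplit : InnerProductSpace.rankOne ℝ u u - InnerProductSpace.rankOne ℝ v v =
      InnerProductSpace.rankOne ℝ (u - v) u + InnerProductSpace.rankOne ℝ v (u - v) := by
    simp
  rw [hsplit]
  refine (norm_add_le _ _).trans_eq ?_
  simp only [InnerProductSpace.norm_rankOne]
  ring

lemma norm_secondMoment_sub_le {z z' : Fin n → E} {B : ℝ} (hz : ∀ i, ‖z i‖ ≤ B)
    (hz' : ∀ i, ‖z' i‖ ≤ B) :
    ‖secondMoment z - secondMoment z'‖ ≤ 2 * B * ((n : ℝ)⁻¹ * ∑ i, ‖z i - z' i‖) := by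
  simp only [secondMoment, ← smul_sub, ← Finset.sum_sub_distrib]
  rw [norm_smul, Real.norm_of_nonneg (by positivity), mul_left_comm, Finset.mul_sum]
  gcongr
  refine (norm_sum_le _ _).trans (Finset.sum_le_sum fun i _ => ?_)
  rw [mul_comm]
  exact (norm_rankOne_self_sub_le _ _).trans (by gcongr; linarith [hz i, hz' i])

end SecondMoment

section Estimation

variable {α : Type*} {d p : ℕ} {l : Filter α} {P : Measure (Vec d)} {g : Vec d → Vec p → Vec p}
  {U : Set (Vec p)} {θ₀ : Vec p} {n m : α → ℕ} {x : ∀ a, Fin (n a) → Fin (m a) → Vec d}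
  {R t ε δ : ℝ} {w : ∀ a, Fin (n a) → ℝ} {θ : α → Vec p}

/-- `√N` times the average of `g(x, θ)` over the grouped sample. -/
def normSum {n m : ℕ} (g : Vec d → Vec p → Vec p) (θ : Vec p) (x : Fin n → Fin m → Vec d) :
    Vec p :=
  √((n : ℝ) * m) • groupAvg 1 x (fun y => g y θ)

lemma inv_sqrt_smul_sum_smul_groupSum {n m : ℕ} (w : Fin n → ℝ) (x : Fin n → Fin m → Vec d)
    (f : Vec d → Vec p) :
    (√(n : ℝ))⁻¹ • ∑ i, w i • groupSum x f i = √((n : ℝ) * m) • groupAvg w x f := by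
  have hscale : √((n : ℝ) * m) * ((n : ℝ) * m)⁻¹ = (√(n : ℝ))⁻¹ * (√(m : ℝ))⁻¹ := by
    rw [← div_eq_mul_inv, Real.sqrt_div_self', one_div, Real.sqrt_mul (Nat.cast_nonneg _), mul_inv]
  simp only [groupAvg, groupSum, smul_comm (w _)]
  rw [← Finset.smul_sum, smul_smul, smul_smul, hscale]

lemma normSum_eq {n m : ℕ} (g : Vec d → Vec p → Vec p) (θ : Vec p) (x : Fin n → Fin m → Vec d) :
    normSum g θ x = (√(n : ℝ))⁻¹ • ∑ i, groupSum x (fun y => g y θ) i := by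
  simpa only [normSum, Pi.one_apply, one_smul] using
    (inv_sqrt_smul_sum_smul_groupSum 1 x fun y => g y θ).symm

namespace EmpiricalLaw

lemma tendsto_sqrt_mul (h : EmpiricalLaw l P n m x) :
    Tendsto (fun a => √((n a : ℝ) * m a)) l atTop := by
  refine tendsto_atTop_mono (fun a => ?_) h.tendsto_sqrt
  refine Real.sqrt_le_sqrt (le_mul_of_one_le_right (Nat.cast_nonneg _) ?_)
  exact_mod_cast h.m_pos a

lemma eventually_groupAvg_lt (h : EmpiricalLaw l P n m x) (hw : LevelLE l n t w) {f : Vec d → ℝ}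
    (hf : Integrable f P) : ∀ᶠ a in l, groupAvg (w a) (x a) f < |∫ y, f y ∂P| + 1 :=
  (h.tendsto_groupAvg hw hf).eventually
    (gt_mem_nhds (by linarith [le_abs_self (∫ y, f y ∂P)]))

lemma approximatesLinear (h : EmpiricalLaw l P n m x) (hU : IsOpen U) (hθ₀ : θ₀ ∈ U)
    (hR : RegularOn g P U) (hJ : Integrable (fun y => fderiv ℝ (g y) θ₀) P) (hε : 0 < ε) :
    ∃ δ > 0, ∀ (t : ℝ) (w : ∀ a, Fin (n a) → ℝ), LevelLE l n t w →
      ∀ᶠ a in l, ∀ θ ∈ Metric.closedBall θ₀ δ, ∀ θ' ∈ Metric.closedBall θ₀ δ,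
        ‖groupAvg (w a) (x a) (fun y => g y θ) - groupAvg (w a) (x a) (fun y => g y θ')
          - meanJacobian g P θ₀ (θ - θ')‖ ≤ ε * ‖θ - θ'‖ := by
  obtain ⟨H, hH, hae⟩ : ∃ H, Integrable H P ∧ ∀ᵐ y ∂P, C2BoundOn (g y) U (H y) := hR
  obtain ⟨δ₀, hδ₀, hδ₀U⟩ := Metric.nhds_basis_closedBall.mem_iff.1 (hU.mem_nhds hθ₀)
  set C : ℝ := |∫ y, H y ∂P| + 1
  have hC : 0 < C := by positivity
  refine ⟨min δ₀ (ε / (2 * C)), by positivity, fun t w hw => ?_⟩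
  have hδC : min δ₀ (ε / (2 * C)) * C ≤ ε / 2 :=
    (mul_le_mul_of_nonneg_right (min_le_right _ _) hC.le).trans_eq (by field_simp)
  filter_upwards [h.ae _ hae, h.eventually_groupAvg_lt hw hH,
    (tendsto_iff_norm_sub_tendsto_zero.1 (h.tendsto_groupAvg hw hJ)).eventually
      (gt_mem_nhds (half_pos hε)), hw] with a hg hHC hjac hw θ hθ θ' hθ'
  set J := groupAvg (w a) (x a) fun y => fderiv ℝ (g y) θ₀
  have hremainder := norm_groupAvg_sub_sub_fderiv_le (fun i => (hw.1.1 i).le) hg hU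
    ((Metric.closedBall_subset_closedBall (min_le_left _ _)).trans hδ₀U) hθ hθ'
  have hlinear : ‖J (θ - θ') - meanJacobian g P θ₀ (θ - θ')‖ ≤ ε / 2 * ‖θ - θ'‖ := by
    rw [← sub_apply]
    exact (ContinuousLinearMap.le_opNorm _ _).trans (by gcongr; exact hjac.le)
  calc _ ≤ min δ₀ (ε / (2 * C)) * groupAvg (w a) (x a) H * ‖θ - θ'‖ + ε / 2 * ‖θ - θ'‖ :=
        (norm_sub_le_norm_sub_add_norm_sub _ (J (θ - θ')) _).trans (add_le_add hremainder hlinear)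
    _ ≤ ε / 2 * ‖θ - θ'‖ + ε / 2 * ‖θ - θ'‖ := by
        gcongr
        exact (mul_le_mul_of_nonneg_left hHC.le (by positivity)).trans hδC
    _ = ε * ‖θ - θ'‖ := by ring

end EmpiricalLaw

lemma RegularGroups.exists_bound_groupAvg (hG : RegularGroups l P (fun y => g y θ₀) n m x)
    (hS : ∀ᶠ a in l, ‖normSum g θ₀ (x a)‖ ≤ R) (hw : LevelLE l n t w) :
    ∃ C : ℝ, ∀ᶠ a in l, √((n a : ℝ) * m a) * ‖groupAvg (w a) (x a) (fun y => g y θ₀)‖ ≤ C := by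
  obtain ⟨r, hr, hwr⟩ := hw.exists_sum_sub_one_sq_le
  set V : Vec p →L[ℝ] Vec p := ∫ y, InnerProductSpace.rankOne ℝ (g y θ₀) (g y θ₀) ∂P
  refine ⟨R + √(r ^ 2 * (p * (‖V‖ + 1))), ?_⟩
  filter_upwards [hwr, hS, hG.second.norm.eventually (gt_mem_nhds (lt_add_one ‖V‖))]
    with a hw hS hV
  set z := groupSum (x a) (fun y => g y θ₀)
  have hsplit : √((n a : ℝ) * m a) • groupAvg (w a) (x a) (fun y => g y θ₀) =
      normSum g θ₀ (x a) + (√(n a : ℝ))⁻¹ • ∑ i, (w a i - 1) • z i := by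
    rw [inv_sqrt_smul_sum_smul_groupSum, ← groupAvg_sub_groupAvg_one, normSum, smul_sub,
      add_sub_cancel]
  have hz : (n a : ℝ)⁻¹ * ∑ i, ‖z i‖ ^ 2 ≤ p * (‖V‖ + 1) := by
    refine (inv_mul_sum_norm_sq_le z).trans ?_
    rw [finrank_euclideanSpace_fin]
    gcongr
  calc √((n a : ℝ) * m a) * ‖groupAvg (w a) (x a) (fun y => g y θ₀)‖
      = ‖normSum g θ₀ (x a) + (√(n a : ℝ))⁻¹ • ∑ i, (w a i - 1) • z i‖ := by
        rw [← hsplit, norm_smul, Real.norm_of_nonneg (Real.sqrt_nonneg _)]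
    _ ≤ R + √(r ^ 2 * (p * (‖V‖ + 1))) :=
        (norm_add_le _ _).trans (add_le_add hS (Real.le_sqrt_of_sq_le
          ((norm_sq_inv_sqrt_smul_sum_le _ _).trans (by gcongr))))

lemma RegularGroups.exists_rate (hG : RegularGroups l P (fun y => g y θ₀) n m x)
    (h : EmpiricalLaw l P n m x) (hU : IsOpen U) (hθ₀ : θ₀ ∈ U) (hR : RegularOn g P U)
    (hJ : Integrable (fun y => fderiv ℝ (g y) θ₀) P)
    (hJinj : Function.Injective (meanJacobian g P θ₀))
    (hS : ∀ᶠ a in l, ‖normSum g θ₀ (x a)‖ ≤ R) (hw : LevelLE l n t w)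
    (hθ : ∀ᶠ a in l, groupAvg (w a) (x a) (fun y => g y (θ a)) = 0)
    (hloc : ∀ δ > 0, ∀ᶠ a in l, θ a ∈ Metric.closedBall θ₀ δ) :
    ∃ C : ℝ, ∀ᶠ a in l, √((n a : ℝ) * m a) * ‖θ a - θ₀‖ ≤ C := by
  obtain ⟨c, hc, hcJ⟩ := exists_pos_mul_norm_le_of_injective hJinj
  obtain ⟨δ, hδ, happrox⟩ := h.approximatesLinear hU hθ₀ hR hJ (half_pos hc)
  obtain ⟨C, hC⟩ := hG.exists_bound_groupAvg hS hw
  refine ⟨2 * C / c, ?_⟩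
  filter_upwards [hloc δ hδ, happrox t w hw, hC, hθ] with a hloc happrox hC hθ
  have hlinear := happrox _ hloc _ (Metric.mem_closedBall_self hδ.le)
  rw [hθ, zero_sub, ← neg_add', norm_neg, add_comm] at hlinear
  have hdist : c / 2 * ‖θ a - θ₀‖ ≤ ‖groupAvg (w a) (x a) (fun y => g y θ₀)‖ := by
    linarith [hcJ (θ a - θ₀), norm_le_add_norm_add (meanJacobian g P θ₀ (θ a - θ₀))
      (groupAvg (w a) (x a) fun y => g y θ₀)]
  rw [le_div_iff₀ hc]
  linarith [mul_le_mul_of_nonneg_left hdist (Real.sqrt_nonneg ((n a : ℝ) * m a))]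

lemma RegularGroups.localized_of_unique (hG : RegularGroups l P (fun y => g y θ₀) n m x)
    (h : EmpiricalLaw l P n m x) (hU : IsOpen U) (hθ₀ : θ₀ ∈ U) (hR : RegularOn g P U)
    (hJ : Integrable (fun y => fderiv ℝ (g y) θ₀) P)
    (hJinj : Function.Injective (meanJacobian g P θ₀))
    (hS : ∀ᶠ a in l, ‖normSum g θ₀ (x a)‖ ≤ R) (hw : LevelLE l n t w)
    (hθ : ∀ᶠ a in l, ∀ θ', groupAvg (w a) (x a) (fun y => g y θ') = 0 → θ' = θ a)
    (hδ : 0 < δ) : ∀ᶠ a in l, θ a ∈ Metric.closedBall θ₀ δ := by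
  obtain ⟨ε, hε, hzero⟩ := exists_pos_forall_exists_eq_zero hJinj
  obtain ⟨δ₁, hδ₁, happrox⟩ := h.approximatesLinear hU hθ₀ hR hJ hε
  obtain ⟨C, hC⟩ := hG.exists_bound_groupAvg hS hw
  have hδ₂ : 0 < min δ δ₁ := lt_min hδ hδ₁
  filter_upwards [happrox t w hw, hC, hθ,
    h.tendsto_sqrt_mul.eventually_gt_atTop (C / (ε * min δ δ₁)),
    h.tendsto_sqrt_mul.eventually_gt_atTop 0] with a happrox hC hθ hNC hN
  have hsmall : ‖groupAvg (w a) (x a) (fun y => g y θ₀)‖ ≤ ε * min δ δ₁ := by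
    rw [div_lt_iff₀ (by positivity)] at hNC
    exact le_of_mul_le_mul_left (hC.trans hNC.le) hN
  have hsub := Metric.closedBall_subset_closedBall (x := θ₀) (min_le_right δ δ₁)
  obtain ⟨θ', hθ', hzero'⟩ := hzero (fun θ => groupAvg (w a) (x a) fun y => g y θ) θ₀ _ hδ₂.le
    hsmall fun θ hθ θ' hθ' => happrox θ (hsub hθ) θ' (hsub hθ')
  rw [← hθ θ' hzero']
  exact Metric.closedBall_subset_closedBall (min_le_left δ δ₁) hθ'

lemma RegularOn.integrable (hR : RegularOn g P U) (hU : IsOpen U)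
    (hg : ∀ θ, Measurable fun y => g y θ) (h₀ : Integrable (fun y => g y θ₀) P) {K : Set (Vec p)}
    (hK : Convex ℝ K) (hKU : K ⊆ U) (hθ₀ : θ₀ ∈ K) {θ : Vec p} (hθ : θ ∈ K) :
    Integrable (fun y => g y θ) P := by
  obtain ⟨H, hH, hae⟩ : ∃ H, Integrable H P ∧ ∀ᵐ y ∂P, C2BoundOn (g y) U (H y) := hR
  have hsub : Integrable (fun y => g y θ - g y θ₀) P :=
    (hH.mul_const ‖θ - θ₀‖).mono' ((hg θ).sub (hg θ₀)).aestronglyMeasurable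
      (hae.mono fun y hy => hy.norm_image_sub_le hU hK hKU hθ hθ₀)
  exact (hsub.add h₀).congr (ae_of_all _ fun y => sub_add_cancel _ _)

lemma EmpiricalLaw.eventually_notMem_ball (h : EmpiricalLaw l P n m x) (hU : IsOpen U)
    (hR : RegularOn g P U) {K : Set (Vec p)} (hK : Convex ℝ K) (hKU : K ⊆ U) {θ' : Vec p}
    (hθ'K : θ' ∈ K) (hint : Integrable (fun y => g y θ') P) (hne : ∫ y, g y θ' ∂P ≠ 0)
    (hw : LevelLE l n t w) (hθ : ∀ᶠ a in l, θ a ∈ K)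
    (hθ0 : ∀ᶠ a in l, groupAvg (w a) (x a) (fun y => g y (θ a)) = 0) :
    ∃ r > 0, ∀ᶠ a in l, θ a ∉ Metric.ball θ' r := by
  obtain ⟨H, hH, hae⟩ : ∃ H, Integrable H P ∧ ∀ᵐ y ∂P, C2BoundOn (g y) U (H y) := hR
  set η := ‖∫ y, g y θ' ∂P‖
  have hη : 0 < η := norm_pos_iff.2 hne
  set C : ℝ := |∫ y, H y ∂P| + 1
  have hC : 0 < C := by positivity
  refine ⟨η / (2 * C), by positivity, ?_⟩
  filter_upwards [(h.tendsto_groupAvg hw hint).norm.eventually (lt_mem_nhds (half_lt_self hη)),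
    h.eventually_groupAvg_lt hw hH, h.ae _ hae, hθ, hθ0, hw] with a hηa hHC hae hθ hθ0 hw hmem
  have hlip : ‖groupAvg (w a) (x a) fun y => g y θ'‖ ≤
      ‖θ' - θ a‖ * groupAvg (w a) (x a) H := by
    have hbound := norm_groupAvg_le (w := w a) (fun i => (hw.1.1 i).le) (x := x a)
      (f := fun y => g y θ' - g y (θ a)) (f' := fun y => ‖θ' - θ a‖ * H y) fun i k => by
        rw [mul_comm]
        exact (hae i k).norm_image_sub_le hU hK hKU hθ'K hθ
    rwa [groupAvg_sub, hθ0, sub_zero, groupAvg_const_mul] at hbound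
  have hclose : ‖θ' - θ a‖ ≤ η / (2 * C) := by
    rw [← dist_eq_norm, dist_comm]
    exact (Metric.mem_ball.1 hmem).le
  have : ‖θ' - θ a‖ * groupAvg (w a) (x a) H ≤ η / 2 := calc
    _ ≤ ‖θ' - θ a‖ * C := by gcongr
    _ ≤ η / (2 * C) * C := by gcongr
    _ = η / 2 := by field_simp
  linarith

lemma EmpiricalLaw.localized_of_compact (h : EmpiricalLaw l P n m x)
    (hP : IsParameter g P θ₀) (hg : ∀ θ, Measurable fun y => g y θ)
    (hU : IsOpen U) (hR : RegularOn g P U)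
    {K : Set (Vec p)} (hK : IsCompact K) (hKc : Convex ℝ K) (hKU : K ⊆ U) (hθK : θ₀ ∈ K)
    (hw : LevelLE l n t w) (hθ : ∀ᶠ a in l, θ a ∈ K)
    (hθ0 : ∀ᶠ a in l, groupAvg (w a) (x a) (fun y => g y (θ a)) = 0)
    (hδ : 0 < δ) : ∀ᶠ a in l, θ a ∈ Metric.closedBall θ₀ δ := by
  have haway : ∀ᶠ a in l, θ a ∉ K \ Metric.ball θ₀ δ := by
    refine (hK.diff Metric.isOpen_ball).induction_on (p := fun s => ∀ᶠ a in l, θ a ∉ s) (by simp)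
      (fun s s' hss' hs' => hs'.mono fun a ha h => ha (hss' h))
      (fun s s' hs hs' => hs.and hs' |>.mono fun a ha h => h.elim ha.1 ha.2) fun θ' hθ' => ?_
    have hint := hR.integrable hU hg hP.integrable hKc hKU hθK hθ'.1
    have hne : ∫ y, g y θ' ∂P ≠ 0 := fun h0 =>
      hθ'.2 (hP.unique θ' hint h0 ▸ Metric.mem_ball_self hδ)
    obtain ⟨r, hr, hball⟩ :=
      h.eventually_notMem_ball hU hR hKc hKU hθ'.1 hint hne hw hθ hθ0
    exact ⟨_, mem_nhdsWithin_of_mem_nhds (Metric.ball_mem_nhds _ hr), hball⟩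
  filter_upwards [haway, hθ] with a haway hθ
  by_contra hfar
  exact haway ⟨hθ, fun hball => hfar (Metric.ball_subset_closedBall hball)⟩

section LocalParameter

lemma EmpiricalLaw.localized_of_rate (h : EmpiricalLaw l P n m x)
    (hθ : ∀ᶠ a in l, √((n a : ℝ) * m a) * ‖θ a - θ₀‖ ≤ R) (hδ : 0 < δ) :
    ∀ᶠ a in l, θ a ∈ Metric.closedBall θ₀ δ := by
  filter_upwards [hθ, h.tendsto_sqrt_mul.eventually_gt_atTop (R / δ),
    h.tendsto_sqrt_mul.eventually_gt_atTop 0] with a hθ hNR hN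
  rw [div_lt_iff₀ hδ] at hNR
  exact mem_closedBall_iff_norm.2 (le_of_mul_le_mul_left (hθ.trans hNR.le) hN)

lemma EmpiricalLaw.tendsto_normSum_sub (h : EmpiricalLaw l P n m x)
    (hU : IsOpen U) (hθ₀ : θ₀ ∈ U) (hR : RegularOn g P U)
    (hJ : Integrable (fun y => fderiv ℝ (g y) θ₀) P)
    (hθ : ∀ᶠ a in l, √((n a : ℝ) * m a) * ‖θ a - θ₀‖ ≤ R) :
    Tendsto (fun a => normSum g (θ a) (x a) - (normSum g θ₀ (x a) +
      meanJacobian g P θ₀ (√((n a : ℝ) * m a) • (θ a - θ₀)))) l (𝓝 0) := by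
  rw [Metric.tendsto_nhds]
  intro ε hε
  set η : ℝ := ε / (2 * (|R| + 1))
  have hη : 0 < η := by positivity
  obtain ⟨δ, hδ, happrox⟩ := h.approximatesLinear hU hθ₀ hR hJ hη
  filter_upwards [happrox 0 _ (levelLE_one l n), hθ, h.localized_of_rate hθ hδ]
    with a happrox hθ hloc
  have hfactor : normSum g (θ a) (x a) - (normSum g θ₀ (x a) +
      meanJacobian g P θ₀ (√((n a : ℝ) * m a) • (θ a - θ₀))) = √((n a : ℝ) * m a) •
      (groupAvg 1 (x a) (fun y => g y (θ a)) - groupAvg 1 (x a) (fun y => g y θ₀)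
          - meanJacobian g P θ₀ (θ a - θ₀)) := by
    rw [ContinuousLinearMap.map_smul]
    simp only [normSum, smul_sub]
    abel
  rw [dist_zero_right, hfactor, norm_smul, Real.norm_of_nonneg (Real.sqrt_nonneg _)]
  calc _ ≤ √((n a : ℝ) * m a) * (η * ‖θ a - θ₀‖) := by
        gcongr
        exact happrox _ hloc _ (Metric.mem_closedBall_self hδ.le)
    _ = η * (√((n a : ℝ) * m a) * ‖θ a - θ₀‖) := by ring
    _ ≤ η * (|R| + 1) := mul_le_mul_of_nonneg_left (by linarith [le_abs_self R]) hη.le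
    _ = ε / 2 := by simp only [η]; field_simp
    _ < ε := half_lt_self hε

lemma EmpiricalLaw.exists_norm_groupSum_sub_le (h : EmpiricalLaw l P n m x) (hU : IsOpen U)
    (hθ₀ : θ₀ ∈ U) (hR : RegularOn g P U)
    (hθ : ∀ᶠ a in l, √((n a : ℝ) * m a) * ‖θ a - θ₀‖ ≤ R) :
    ∃ H, Integrable H P ∧ ∀ᶠ a in l, ∀ i,
      ‖groupSum (x a) (fun y => g y (θ a)) i - groupSum (x a) (fun y => g y θ₀) i‖ ≤
        (√(n a : ℝ))⁻¹ * ((m a : ℝ)⁻¹ * ∑ k, |H (x a i k)|) := by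
  obtain ⟨H, hH, hae⟩ : ∃ H, Integrable H P ∧ ∀ᵐ y ∂P, C2BoundOn (g y) U (H y) := hR
  obtain ⟨δ, hδ, hδU⟩ := Metric.nhds_basis_closedBall.mem_iff.1 (hU.mem_nhds hθ₀)
  refine ⟨fun y => R * H y, hH.const_mul R, ?_⟩
  filter_upwards [h.ae _ hae, hθ, h.localized_of_rate hθ hδ, h.n_tendsto.eventually_gt_atTop 0]
    with a hae hθ hloc hn i
  have : (0 : ℝ) < √(n a : ℝ) := Real.sqrt_pos.2 (Nat.cast_pos.2 hn)
  have hm' : (0 : ℝ) < √(m a : ℝ) := Real.sqrt_pos.2 (Nat.cast_pos.2 (h.m_pos a))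
  have hR0 : 0 ≤ R := (by positivity : 0 ≤ √((n a : ℝ) * m a) * ‖θ a - θ₀‖).trans hθ
  have hrate : ‖θ a - θ₀‖ ≤ R * ((√(n a : ℝ))⁻¹ * (√(m a : ℝ))⁻¹) := by
    rwa [← mul_inv, ← div_eq_mul_inv, le_div_iff₀ (by positivity),
      ← Real.sqrt_mul (Nat.cast_nonneg _), mul_comm]
  simp only [groupSum, ← smul_sub, ← Finset.sum_sub_distrib]
  rw [norm_smul, Real.norm_of_nonneg (inv_pos.2 hm').le]
  calc (√(m a : ℝ))⁻¹ * ‖∑ k, (g (x a i k) (θ a) - g (x a i k) θ₀)‖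
      ≤ (√(m a : ℝ))⁻¹ * ∑ k, |H (x a i k)| * (R * ((√(n a : ℝ))⁻¹ * (√(m a : ℝ))⁻¹)) := by
        gcongr
        refine (norm_sum_le _ _).trans (Finset.sum_le_sum fun k _ => ?_)
        exact ((hae i k).norm_image_sub_le hU (convex_closedBall θ₀ δ) hδU hloc
          (Metric.mem_closedBall_self hδ.le)).trans (by gcongr; exact le_abs_self _)
    _ = (√(n a : ℝ))⁻¹ * ((√(m a : ℝ) * √(m a : ℝ))⁻¹ * ∑ k, |R * H (x a i k)|) := by
        simp only [abs_mul, abs_of_nonneg hR0, ← Finset.sum_mul, ← Finset.mul_sum, mul_inv]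
        ring
    _ = _ := by rw [Real.mul_self_sqrt (Nat.cast_nonneg _)]

lemma RegularGroups.eventually_norm_groupSum_le
    (hG : RegularGroups l P (fun y => g y θ₀) n m x) (h : EmpiricalLaw l P n m x) (hU : IsOpen U)
    (hθ₀ : θ₀ ∈ U) (hR : RegularOn g P U)
    (hθ : ∀ᶠ a in l, √((n a : ℝ) * m a) * ‖θ a - θ₀‖ ≤ R) (hδ : 0 < δ) :
    ∀ᶠ a in l, ∀ i, ‖groupSum (x a) (fun y => g y (θ a)) i‖ ≤ δ * √(n a : ℝ) := by
  obtain ⟨H, hH, hdiff⟩ := h.exists_norm_groupSum_sub_le hU hθ₀ hR hθ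
  filter_upwards [hdiff, hG.max_le (δ / 2) (half_pos hδ), h.groupMean_abs_le hH (half_pos hδ)]
    with a hdiff hmax hmean i
  have hsmall : (√(n a : ℝ))⁻¹ * ((m a : ℝ)⁻¹ * ∑ k, |H (x a i k)|) ≤ δ / 2 * √(n a : ℝ) := calc
    _ ≤ (√(n a : ℝ))⁻¹ * (δ / 2 * n a) := mul_le_mul_of_nonneg_left (hmean i) (by positivity)
    _ = δ / 2 * √(n a : ℝ) := by rw [mul_left_comm, inv_mul_eq_div, Real.div_sqrt]
  linarith [hdiff i, hmax i, norm_le_norm_add_norm_sub' (groupSum (x a) (fun y => g y (θ a)) i)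
    (groupSum (x a) (fun y => g y θ₀) i)]

lemma RegularGroups.tendsto_secondMoment (hG : RegularGroups l P (fun y => g y θ₀) n m x)
    (h : EmpiricalLaw l P n m x) (hU : IsOpen U) (hθ₀ : θ₀ ∈ U) (hR : RegularOn g P U)
    (hθ : ∀ᶠ a in l, √((n a : ℝ) * m a) * ‖θ a - θ₀‖ ≤ R) :
    Tendsto (fun a => secondMoment (groupSum (x a) (fun y => g y (θ a)))) l
      (𝓝 (∫ y, InnerProductSpace.rankOne ℝ (g y θ₀) (g y θ₀) ∂P)) := by
  obtain ⟨H, hH, hdiff⟩ := h.exists_norm_groupSum_sub_le hU hθ₀ hR hθ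
  suffices hsub : Tendsto (fun a => secondMoment (groupSum (x a) (fun y => g y (θ a))) -
      secondMoment (groupSum (x a) (fun y => g y θ₀))) l (𝓝 0) by simpa using hsub.add hG.second
  rw [Metric.tendsto_nhds]
  intro ε hε
  set C : ℝ := |∫ y, |H y| ∂P| + 1
  have hC : 0 < C := by positivity
  have hδ : 0 < ε / (4 * C) := by positivity
  filter_upwards [hdiff, hG.max_le _ hδ, hG.eventually_norm_groupSum_le h hU hθ₀ hR hθ hδ,
    h.eventually_groupAvg_lt (levelLE_one l n) hH.abs, h.n_tendsto.eventually_gt_atTop 0]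
    with a hdiff hmax₀ hmax hHC hn
  have : 0 < √(n a : ℝ) := Real.sqrt_pos.2 (Nat.cast_pos.2 hn)
  have hsum : (n a : ℝ)⁻¹ * ∑ i, ‖groupSum (x a) (fun y => g y (θ a)) i -
      groupSum (x a) (fun y => g y θ₀) i‖ ≤ (√(n a : ℝ))⁻¹ * C := calc
    _ ≤ (n a : ℝ)⁻¹ * ∑ i, (√(n a : ℝ))⁻¹ * ((m a : ℝ)⁻¹ * ∑ k, |H (x a i k)|) := by
      gcongr with i; exact hdiff i
    _ = (√(n a : ℝ))⁻¹ * groupAvg 1 (x a) (fun y => |H y|) := by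
      simp only [groupAvg, Pi.one_apply, smul_eq_mul, one_mul, ← Finset.mul_sum, mul_inv]
      ring
    _ ≤ (√(n a : ℝ))⁻¹ * C := by gcongr
  rw [dist_zero_right]
  calc _ ≤ 2 * (ε / (4 * C) * √(n a : ℝ)) * ((√(n a : ℝ))⁻¹ * C) :=
        (norm_secondMoment_sub_le hmax hmax₀).trans (by gcongr)
    _ = ε / 2 := by field_simp; norm_num
    _ < ε := half_lt_self hε

end LocalParameter

end Estimation

/-! ### The two-sample contrast -/

section TwoSample

open Asymptotics
open scoped RealInnerProductSpace

/-- The second moment operator of `g(X, θ)`, `X ∼ P`. -/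
def momentOp {d p : ℕ} (g : Vec d → Vec p → Vec p) (P : Measure (Vec d)) (θ : Vec p) :
    Vec p →L[ℝ] Vec p :=
  ∫ y, InnerProductSpace.rankOne ℝ (g y θ) (g y θ) ∂P

/-- The difference of the normalized sums of the two samples which remains after the nuisance
parameter has been eliminated; `A` stands for `ρ⁻¹ Jx Jy⁻¹` with `ρ² = lim n₂ / n₁`. -/
def contrast {d p : ℕ} (g : Vec d → Vec p → Vec p) (θx θy : Vec p) (A : Vec p →L[ℝ] Vec p)
    {n₁ n₂ m : ℕ} (x : Fin n₁ → Fin m → Vec d) (y : Fin n₂ → Fin m → Vec d) : Vec p :=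
  normSum g θx x - A (normSum g θy y)

/-- The asymptotic covariance operator of `contrast g θx θy A`. -/
def contrastCov {d p : ℕ} (g : Vec d → Vec p → Vec p) (PX PY : Measure (Vec d)) (θx θy : Vec p)
    (A : Vec p →L[ℝ] Vec p) : Vec p →L[ℝ] Vec p :=
  momentOp g PX θx + A ∘L momentOp g PY θy ∘L A.adjoint

/-- The conditions on the population which the asymptotic expansion of the likelihood ratio
uses. -/
structure RegularModel {d p : ℕ} (g : Vec d → Vec p → Vec p) (P : Measure (Vec d))
    (U : Set (Vec p)) (θ₀ : Vec p) : Prop where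
  isOpen : IsOpen U
  mem : θ₀ ∈ U
  regularOn : RegularOn g P U
  integrable_fderiv : Integrable (fun y => fderiv ℝ (g y) θ₀) P
  injective_jacobian : Function.Injective (meanJacobian g P θ₀)
  inner_momentOp_pos : ∀ v, v ≠ 0 → 0 < ⟪momentOp g P θ₀ v, v⟫

/-- The properties of a sequence of grouped samples which hold with high probability and from
which the expansion of the likelihood ratio follows deterministically. -/
structure GoodSample {α : Type*} {d p : ℕ} (l : Filter α) (g : Vec d → Vec p → Vec p)
    (P : Measure (Vec d)) (θ₀ : Vec p) (n m : α → ℕ) (x : ∀ a, Fin (n a) → Fin (m a) → Vec d) :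
    Prop where
  law : EmpiricalLaw l P n m x
  groups : RegularGroups l P (fun y => g y θ₀) n m x
  bounded : (fun a => normSum g θ₀ (x a)) =O[l] (fun _ => (1 : ℝ))

section Algebra

variable {E : Type*} [NormedAddCommGroup E] [InnerProductSpace ℝ E]

lemma injective_of_inner_pos {T : E →L[ℝ] E} (hT : ∀ v, v ≠ 0 → 0 < ⟪T v, v⟫) :
    Function.Injective T := by
  refine (injective_iff_map_eq_zero T).2 fun v hv => ?_
  by_contra hne
  simpa [hv] using hT v hne

variable [CompleteSpace E] {S T A M J K : E →L[ℝ] E}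

lemma inner_add_inner_neg_adjoint_eq (hM : ∀ v, (S + A ∘L T ∘L A.adjoint) (M.adjoint (M v)) = v)
    (v : E) :
    ⟪S (M.adjoint (M v)), M.adjoint (M v)⟫ +
      ⟪T (-A.adjoint (M.adjoint (M v))), -A.adjoint (M.adjoint (M v))⟫ = ‖M v‖ ^ 2 := by
  rw [map_neg, inner_neg_neg, ContinuousLinearMap.adjoint_inner_right A, ← inner_add_left]
  change ⟪(S + A ∘L T ∘L A.adjoint) (M.adjoint (M v)), M.adjoint (M v)⟫ = _
  rw [hM, ContinuousLinearMap.adjoint_inner_right, real_inner_self_eq_norm_sq]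

/-- The displacement `h` of the common parameter drops out: this is why `κ` and `-A† κ` are the
right pair of multipliers. -/
lemma inner_add_inner_neg_adjoint_add {ρ : ℝ} (hA : ∀ v, ρ • A (K v) = J v) (κ u v h : E) :
    ⟪κ, u + J h⟫ + ⟪-A.adjoint κ, v + ρ • K h⟫ = ⟪κ, u - A v⟫ := by
  rw [inner_neg_left, ContinuousLinearMap.adjoint_inner_left, map_add, map_smul, hA]
  simp only [inner_add_right, inner_sub_right]
  ring

lemma add_smul_eq_of_add_eq [FiniteDimensional ℝ E] {ρ : ℝ} (hA : ∀ v, ρ • A (K v) = J v)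
    (hJ : Function.Surjective J) {κ u v h : E} (hκ : (S + A ∘L T ∘L A.adjoint) κ = u - A v)
    (hh : u + J h = S κ) : v + ρ • K h = T (-A.adjoint κ) := by
  have hA_surj : Function.Surjective (A : E →ₗ[ℝ] E) := fun v => by
    obtain ⟨w, rfl⟩ := hJ v
    exact ⟨ρ • K w, by rw [ContinuousLinearMap.coe_coe, map_smul, hA]⟩
  apply LinearMap.injective_iff_surjective.2 hA_surj
  have hκ : S κ + A (T (A.adjoint κ)) = u - A v := hκ
  simp only [ContinuousLinearMap.coe_coe, map_add, map_smul, hA, map_neg]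
  linear_combination (norm := module) hh + hκ

end Algebra

section BoundedSequences

variable {α E F : Type*} [NormedAddCommGroup E] [NormedAddCommGroup F] {l : Filter α} {u : α → E}

lemma tendsto_inner_of_isBigO_one [InnerProductSpace ℝ E] (hu : u =O[l] (fun _ => (1 : ℝ)))
    {v : α → E} (hv : Tendsto v l (𝓝 0)) : Tendsto (fun a => ⟪u a, v a⟫) l (𝓝 0) :=
  hv.op_zero_isBoundedUnder_le ((isBigO_one_iff ℝ).1 hu) (fun v u => ⟪u, v⟫)
    fun v u => (norm_inner_le_norm u v).trans_eq (mul_comm _ _)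

lemma clm_apply_isBigO_one [NormedSpace ℝ E] [NormedSpace ℝ F] (L : E →L[ℝ] F)
    (hu : u =O[l] (fun _ => (1 : ℝ))) : (fun a => L (u a)) =O[l] (fun _ => (1 : ℝ)) :=
  (L.isBigO_comp u l).trans hu

end BoundedSequences

variable {α β : Type*} {d p : ℕ} {l : Filter α} {P PX PY : Measure (Vec d)}
  {g : Vec d → Vec p → Vec p} {U Ux Uy : Set (Vec p)} {θ₀ θx₀ θy₀ : Vec p} {n n₁ n₂ m : α → ℕ}
  {x : ∀ a, Fin (n a) → Fin (m a) → Vec d} {θ κ : α → Vec p} {C ε ρ : ℝ}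
  {xs : ∀ a, Fin (n₁ a) → Fin (m a) → Vec d} {ys : ∀ a, Fin (n₂ a) → Fin (m a) → Vec d}
  {A M : Vec p →L[ℝ] Vec p}

namespace GoodSample

lemma comp (h : GoodSample l g P θ₀ n m x) {l' : Filter β} {φ : β → α} (hφ : Tendsto φ l' l) :
    GoodSample l' g P θ₀ (fun b => n (φ b)) (fun b => m (φ b)) (fun b => x (φ b)) where
  law := h.law.comp hφ
  groups := h.groups.comp hφ
  bounded := h.bounded.comp_tendsto hφ

lemma exists_norm_normSum_le (h : GoodSample l g P θ₀ n m x) :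
    ∃ R : ℝ, ∀ᶠ a in l, ‖normSum g θ₀ (x a)‖ ≤ R := by
  simpa only [norm_one, mul_one] using h.bounded.bound

lemma eventually_le_negTwoLog (h : GoodSample l g P θ₀ n m x) (hM : RegularModel g P U θ₀)
    (hθ : ∀ᶠ a in l, √((n a : ℝ) * m a) * ‖θ a - θ₀‖ ≤ C) (hκ : κ =O[l] (fun _ => (1 : ℝ)))
    {w : ∀ a, Fin (n a) → ℝ} (hw : ∀ᶠ a in l, IsRelWeight (w a))
    (hwθ : ∀ᶠ a in l, groupAvg (w a) (x a) (fun y => g y (θ a)) = 0) (hε : 0 < ε) :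
    ∀ᶠ a in l, 2 * ⟪κ a, normSum g (θ a) (x a)⟫ - ⟪momentOp g P θ₀ (κ a), κ a⟫ - ε ≤
      negTwoLog (w a) := by
  obtain ⟨R, hR⟩ := hκ.bound
  simp only [norm_one, mul_one] at hR
  simp_rw [normSum_eq]
  refine _root_.eventually_le_negTwoLog
    (h.groups.tendsto_secondMoment h.law hM.isOpen hM.mem hM.regularOn hθ)
    (fun _ => h.groups.eventually_norm_groupSum_le h.law hM.isOpen hM.mem hM.regularOn hθ)
    hR hw ?_ hε
  filter_upwards [hwθ, h.law.n_tendsto.eventually_gt_atTop 0] with a hwθ hn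
  have hn' : (√(n a : ℝ))⁻¹ ≠ 0 := (inv_pos.2 (Real.sqrt_pos.2 (Nat.cast_pos.2 hn))).ne'
  refine (smul_eq_zero.1 ?_).resolve_left hn'
  rw [inv_sqrt_smul_sum_smul_groupSum, hwθ, smul_zero]

lemma eventually_exists_negTwoLog_le (h : GoodSample l g P θ₀ n m x) (hM : RegularModel g P U θ₀)
    (hθ : ∀ᶠ a in l, √((n a : ℝ) * m a) * ‖θ a - θ₀‖ ≤ C) (hκ : κ =O[l] (fun _ => (1 : ℝ)))
    (hs : Tendsto (fun a => normSum g (θ a) (x a) - momentOp g P θ₀ (κ a)) l (𝓝 0))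
    (hε : 0 < ε) :
    ∀ᶠ a in l, ∃ w : Fin (n a) → ℝ, IsRelWeight w ∧
      groupAvg w (x a) (fun y => g y (θ a)) = 0 ∧
      negTwoLog w ≤ ⟪momentOp g P θ₀ (κ a), κ a⟫ + ε := by
  obtain ⟨R, hR⟩ := hκ.bound
  simp only [norm_one, mul_one] at hR
  simp_rw [normSum_eq] at hs
  filter_upwards [_root_.eventually_exists_negTwoLog_le h.law.n_tendsto
    (h.groups.tendsto_secondMoment h.law hM.isOpen hM.mem hM.regularOn hθ)
    (injective_of_inner_pos hM.inner_momentOp_pos)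
    (fun _ => h.groups.eventually_norm_groupSum_le h.law hM.isOpen hM.mem hM.regularOn hθ)
    hR hs hε, h.law.tendsto_sqrt_mul.eventually_gt_atTop 0] with a ⟨w, hw, hw0, hle⟩ hN
  refine ⟨w, hw, (smul_eq_zero.1 ?_).resolve_left hN.ne', hle⟩
  rw [← inv_sqrt_smul_sum_smul_groupSum, hw0, smul_zero]

end GoodSample

lemma sqrt_mul_eq_sqrt_div_mul_sqrt_mul {a b c : ℝ} (ha : 0 < a) (hb : 0 ≤ b) :
    √(b * c) = √(b / a) * √(a * c) := by
  rw [← Real.sqrt_mul (by positivity)]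
  congr 1
  field_simp

lemma eventually_sqrt_mul_norm_le_of_ratio (hx : EmpiricalLaw l PX n₁ m xs)
    (hρ : Tendsto (fun a => √((n₂ a : ℝ) / n₁ a)) l (𝓝 ρ))
    (hθ : ∀ᶠ a in l, √((n₁ a : ℝ) * m a) * ‖θ a‖ ≤ C) :
    ∀ᶠ a in l, √((n₂ a : ℝ) * m a) * ‖θ a‖ ≤ (|ρ| + 1) * |C| := by
  filter_upwards [hx.n_tendsto.eventually_gt_atTop 0, hθ,
    hρ.eventually (gt_mem_nhds (show ρ < |ρ| + 1 by linarith [le_abs_self ρ]))] with a hn hθ hratio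
  rw [sqrt_mul_eq_sqrt_div_mul_sqrt_mul (Nat.cast_pos.2 hn) (Nat.cast_nonneg _), mul_assoc]
  exact mul_le_mul hratio.le (hθ.trans (le_abs_self C)) (by positivity) (by positivity)

lemma isBigO_one_sqrt_mul_smul {r : α → ℝ} (hθ : ∀ᶠ a in l, √(r a) * ‖θ a‖ ≤ C) :
    (fun a => √(r a) • θ a) =O[l] (fun _ => (1 : ℝ)) := by
  refine IsBigO.of_bound C (hθ.mono fun a ha => ?_)
  rwa [norm_smul, Real.norm_of_nonneg (Real.sqrt_nonneg _), norm_one, mul_one]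

lemma tendsto_normSum_shift_sub (hx : EmpiricalLaw l PX n₁ m xs) (hy : EmpiricalLaw l PY n₂ m ys)
    (hMy : RegularModel g PY Uy θy₀) (hρ : Tendsto (fun a => √((n₂ a : ℝ) / n₁ a)) l (𝓝 ρ))
    (hθ : ∀ᶠ a in l, √((n₁ a : ℝ) * m a) * ‖θ a - θx₀‖ ≤ C) :
    Tendsto (fun a => normSum g (θ a + (θy₀ - θx₀)) (ys a) - (normSum g θy₀ (ys a) +
      ρ • meanJacobian g PY θy₀ (√((n₁ a : ℝ) * m a) • (θ a - θx₀)))) l (𝓝 0) := by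
  have hshift : ∀ a, θ a + (θy₀ - θx₀) - θy₀ = θ a - θx₀ := fun a => by abel
  have hlinear := hy.tendsto_normSum_sub hMy.isOpen hMy.mem hMy.regularOn hMy.integrable_fderiv
    (θ := fun a => θ a + (θy₀ - θx₀)) (R := (|ρ| + 1) * |C|) (by
      simpa only [hshift] using eventually_sqrt_mul_norm_le_of_ratio hx hρ hθ)
  have hratio : Tendsto (fun a => (√((n₂ a : ℝ) / n₁ a) - ρ) •
      meanJacobian g PY θy₀ (√((n₁ a : ℝ) * m a) • (θ a - θx₀))) l (𝓝 0) :=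
    (tendsto_sub_nhds_zero_iff.2 hρ).zero_smul_isBoundedUnder_le
      ((isBigO_one_iff ℝ).1 (clm_apply_isBigO_one _ (isBigO_one_sqrt_mul_smul hθ)))
  rw [← add_zero (0 : Vec p)]
  refine (hlinear.add hratio).congr' ?_
  filter_upwards [hx.n_tendsto.eventually_gt_atTop 0] with a hn
  rw [hshift, sqrt_mul_eq_sqrt_div_mul_sqrt_mul (Nat.cast_pos.2 hn) (Nat.cast_nonneg _), mul_smul,
    map_smul _ √((n₂ a : ℝ) / n₁ a), sub_smul]
  abel

lemma isBigO_one_contrast (hx : GoodSample l g PX θx₀ n₁ m xs)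
    (hy : GoodSample l g PY θy₀ n₂ m ys) (A : Vec p →L[ℝ] Vec p) :
    (fun a => contrast g θx₀ θy₀ A (xs a) (ys a)) =O[l] (fun _ => (1 : ℝ)) :=
  hx.bounded.sub (clm_apply_isBigO_one A hy.bounded)

lemma eventually_norm_contrast_sq_le_negTwoLog_add (hx : GoodSample l g PX θx₀ n₁ m xs)
    (hy : GoodSample l g PY θy₀ n₂ m ys)
    (hMx : RegularModel g PX Ux θx₀) (hMy : RegularModel g PY Uy θy₀)
    (hρ : Tendsto (fun a => √((n₂ a : ℝ) / n₁ a)) l (𝓝 ρ))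
    (hA : ∀ v, ρ • A (meanJacobian g PY θy₀ v) = meanJacobian g PX θx₀ v)
    (hM : ∀ v, contrastCov g PX PY θx₀ θy₀ A (M.adjoint (M v)) = v)
    (hθ : ∀ᶠ a in l, √((n₁ a : ℝ) * m a) * ‖θ a - θx₀‖ ≤ C)
    {w : ∀ a, Fin (n₁ a) → ℝ} (hw : ∀ᶠ a in l, IsRelWeight (w a))
    (hwθ : ∀ᶠ a in l, groupAvg (w a) (xs a) (fun y => g y (θ a)) = 0)
    {u : ∀ a, Fin (n₂ a) → ℝ} (hu : ∀ᶠ a in l, IsRelWeight (u a))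
    (huθ : ∀ᶠ a in l, groupAvg (u a) (ys a) (fun y => g y (θ a + (θy₀ - θx₀))) = 0)
    (hε : 0 < ε) :
    ∀ᶠ a in l, ‖M (contrast g θx₀ θy₀ A (xs a) (ys a))‖ ^ 2 - ε ≤
      negTwoLog (w a) + negTwoLog (u a) := by
  set D : α → Vec p := fun a => contrast g θx₀ θy₀ A (xs a) (ys a)
  set κ : α → Vec p := fun a => M.adjoint (M (D a))
  set κ' : α → Vec p := fun a => -A.adjoint (κ a)
  have hκO : κ =O[l] (fun _ => (1 : ℝ)) := clm_apply_isBigO_one (M.adjoint ∘L M)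
    (isBigO_one_contrast hx hy A)
  have hκ'O : κ' =O[l] (fun _ => (1 : ℝ)) := (clm_apply_isBigO_one A.adjoint hκO).neg_left
  have hθy : ∀ᶠ a in l, √((n₂ a : ℝ) * m a) * ‖θ a + (θy₀ - θx₀) - θy₀‖ ≤ (|ρ| + 1) * |C| :=
    (eventually_sqrt_mul_norm_le_of_ratio hx.law hρ hθ).mono fun a ha => by
      rwa [show θ a + (θy₀ - θx₀) - θy₀ = θ a - θx₀ by abel]
  have hlinear := ((tendsto_inner_of_isBigO_one hκO (hx.law.tendsto_normSum_sub hMx.isOpen hMx.mem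
    hMx.regularOn hMx.integrable_fderiv hθ)).add (tendsto_inner_of_isBigO_one hκ'O
    (tendsto_normSum_shift_sub hx.law hy.law hMy hρ hθ))).eventually
    (lt_mem_nhds (show -(ε / 6) < 0 + 0 by linarith))
  filter_upwards [hx.eventually_le_negTwoLog hMx hθ hκO hw hwθ (show 0 < ε / 3 by positivity),
    hy.eventually_le_negTwoLog hMy hθy hκ'O hu huθ (show 0 < ε / 3 by positivity), hlinear]
    with a hlex hley hlinear
  have hquad : ⟪momentOp g PX θx₀ (κ a), κ a⟫ + ⟪momentOp g PY θy₀ (κ' a), κ' a⟫ =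
      ‖M (D a)‖ ^ 2 := inner_add_inner_neg_adjoint_eq hM (D a)
  have hcross := inner_add_inner_neg_adjoint_add hA (κ a) (normSum g θx₀ (xs a))
    (normSum g θy₀ (ys a)) (√((n₁ a : ℝ) * m a) • (θ a - θx₀))
  have hcontrast : ⟪κ a, D a⟫ = ‖M (D a)‖ ^ 2 := by
    rw [ContinuousLinearMap.adjoint_inner_left, real_inner_self_eq_norm_sq]
  rw [inner_sub_right, inner_sub_right] at hlinear
  change _ = ⟪κ a, D a⟫ at hcross
  linarith

/-- The local parameter solves the linearized estimating equations of the two tilted samples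
simultaneously. -/
lemma exists_local_parameter (hx : GoodSample l g PX θx₀ n₁ m xs)
    (hMx : RegularModel g PX Ux θx₀)
    (hA : ∀ v, ρ • A (meanJacobian g PY θy₀ v) = meanJacobian g PX θx₀ v)
    (hκ : ∀ a, contrastCov g PX PY θx₀ θy₀ A (κ a) = contrast g θx₀ θy₀ A (xs a) (ys a))
    (hκO : κ =O[l] (fun _ => (1 : ℝ))) :
    ∃ h : α → Vec p, h =O[l] (fun _ => (1 : ℝ)) ∧
      (∀ a, normSum g θx₀ (xs a) + meanJacobian g PX θx₀ (h a) = momentOp g PX θx₀ (κ a)) ∧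
      ∀ a, normSum g θy₀ (ys a) + ρ • meanJacobian g PY θy₀ (h a) =
        momentOp g PY θy₀ (-A.adjoint (κ a)) := by
  let e : Vec p ≃L[ℝ] Vec p := (LinearEquiv.ofInjectiveEndo
    (meanJacobian g PX θx₀ : Vec p →ₗ[ℝ] Vec p) hMx.injective_jacobian).toContinuousLinearEquiv
  have he : ∀ v, meanJacobian g PX θx₀ (e.symm v) = v := e.apply_symm_apply
  have hhx : ∀ a, normSum g θx₀ (xs a) + meanJacobian g PX θx₀
      (e.symm (momentOp g PX θx₀ (κ a) - normSum g θx₀ (xs a))) = momentOp g PX θx₀ (κ a) :=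
    fun a => by rw [he, add_sub_cancel]
  exact ⟨fun a => e.symm (momentOp g PX θx₀ (κ a) - normSum g θx₀ (xs a)),
    clm_apply_isBigO_one (e.symm : Vec p →L[ℝ] Vec p)
      ((clm_apply_isBigO_one _ hκO).sub hx.bounded), hhx,
    fun a => add_smul_eq_of_add_eq hA (fun v => ⟨_, he v⟩) (hκ a) (hhx a)⟩

lemma eventually_exists_negTwoLog_add_le (hx : GoodSample l g PX θx₀ n₁ m xs)
    (hy : GoodSample l g PY θy₀ n₂ m ys)
    (hMx : RegularModel g PX Ux θx₀) (hMy : RegularModel g PY Uy θy₀)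
    (hρ : Tendsto (fun a => √((n₂ a : ℝ) / n₁ a)) l (𝓝 ρ))
    (hA : ∀ v, ρ • A (meanJacobian g PY θy₀ v) = meanJacobian g PX θx₀ v)
    (hM : ∀ v, contrastCov g PX PY θx₀ θy₀ A (M.adjoint (M v)) = v)
    {Kx Ky : Set (Vec p)} (hKx : Kx ∈ 𝓝 θx₀) (hKy : Ky ∈ 𝓝 θy₀) (hε : 0 < ε) :
    ∀ᶠ a in l, ∃ θ ∈ Kx, θ + (θy₀ - θx₀) ∈ Ky ∧ ∃ (w : Fin (n₁ a) → ℝ) (u : Fin (n₂ a) → ℝ),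
      IsRelWeight w ∧ IsRelWeight u ∧ groupAvg w (xs a) (fun y => g y θ) = 0 ∧
      groupAvg u (ys a) (fun y => g y (θ + (θy₀ - θx₀))) = 0 ∧
      negTwoLog w + negTwoLog u ≤ ‖M (contrast g θx₀ θy₀ A (xs a) (ys a))‖ ^ 2 + ε := by
  set D : α → Vec p := fun a => contrast g θx₀ θy₀ A (xs a) (ys a)
  set κ : α → Vec p := fun a => M.adjoint (M (D a))
  have hκO : κ =O[l] (fun _ => (1 : ℝ)) := clm_apply_isBigO_one (M.adjoint ∘L M)
    (isBigO_one_contrast hx hy A)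
  obtain ⟨h, hhO, hhx, hhy⟩ := exists_local_parameter hx hMx hA (fun a => hM (D a)) hκO
  set θ : α → Vec p := fun a => θx₀ + (√((n₁ a : ℝ) * m a))⁻¹ • h a
  have hθh : ∀ᶠ a in l, √((n₁ a : ℝ) * m a) • (θ a - θx₀) = h a := by
    filter_upwards [hx.law.tendsto_sqrt_mul.eventually_gt_atTop 0] with a ha
    simp only [θ, add_sub_cancel_left, smul_smul, mul_inv_cancel₀ ha.ne', one_smul]
  obtain ⟨C, hC⟩ := hhO.bound
  have hθ : ∀ᶠ a in l, √((n₁ a : ℝ) * m a) * ‖θ a - θx₀‖ ≤ C := by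
    filter_upwards [hC, hθh] with a hC hθh
    rwa [← hθh, norm_smul, Real.norm_of_nonneg (Real.sqrt_nonneg _), norm_one, mul_one] at hC
  have hθy : ∀ᶠ a in l, √((n₂ a : ℝ) * m a) * ‖θ a + (θy₀ - θx₀) - θy₀‖ ≤ (|ρ| + 1) * |C| :=
    (eventually_sqrt_mul_norm_le_of_ratio hx.law hρ hθ).mono fun a ha => by
      rwa [show θ a + (θy₀ - θx₀) - θy₀ = θ a - θx₀ by abel]
  have hsx : Tendsto (fun a => normSum g (θ a) (xs a) - momentOp g PX θx₀ (κ a)) l (𝓝 0) :=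
    (hx.law.tendsto_normSum_sub hMx.isOpen hMx.mem hMx.regularOn hMx.integrable_fderiv hθ).congr'
      (hθh.mono fun a ha => by rw [ha, hhx])
  have hsy : Tendsto (fun a => normSum g (θ a + (θy₀ - θx₀)) (ys a) -
      momentOp g PY θy₀ (-A.adjoint (κ a))) l (𝓝 0) :=
    (tendsto_normSum_shift_sub hx.law hy.law hMy hρ hθ).congr'
      (hθh.mono fun a ha => by rw [ha, hhy])
  obtain ⟨δx, hδx, hδKx⟩ := Metric.nhds_basis_closedBall.mem_iff.1 hKx
  obtain ⟨δy, hδy, hδKy⟩ := Metric.nhds_basis_closedBall.mem_iff.1 hKy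
  filter_upwards [hx.eventually_exists_negTwoLog_le hMx hθ hκO hsx (half_pos hε),
    hy.eventually_exists_negTwoLog_le hMy hθy (clm_apply_isBigO_one A.adjoint hκO).neg_left hsy
      (half_pos hε), hx.law.localized_of_rate hθ hδx, hy.law.localized_of_rate hθy hδy]
    with a ⟨w, hw, hw0, hwle⟩ ⟨u, hu, hu0, hule⟩ hθx hθy
  refine ⟨θ a, hδKx hθx, hδKy hθy, w, u, hw, hu, hw0, hu0, ?_⟩
  have hquad : ⟪momentOp g PX θx₀ (κ a), κ a⟫ +
      ⟪momentOp g PY θy₀ (-A.adjoint (κ a)), -A.adjoint (κ a)⟫ = ‖M (D a)‖ ^ 2 :=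
    inner_add_inner_neg_adjoint_eq hM (D a)
  linarith

end TwoSample

/-! ### The log-likelihood ratio in terms of relative weights -/

section Ratio

lemma neg_two_mul_div_le_coe_iff {L : EReal} {m : ℕ} (hm : 0 < m) {t : ℝ} :
    -2 * L / (m : EReal) ≤ (t : EReal) ↔ ((-(m * t) / 2 : ℝ) : EReal) ≤ L := by
  have h_two : (-2 : EReal) = ((-2 : ℝ) : EReal) := by rw [EReal.coe_neg]; rfl
  have hm_coe : (m : EReal) = ((m : ℝ) : EReal) := by norm_cast
  rw [EReal.div_le_iff_le_mul (by exact_mod_cast hm) (EReal.natCast_ne_top m), h_two, hm_coe,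
    ← EReal.coe_mul]
  induction L with
  | bot =>
    rw [EReal.coe_mul_bot_of_neg (by norm_num)]
    simp only [top_le_iff, le_bot_iff, EReal.coe_ne_top, EReal.coe_ne_bot]
  | top =>
    rw [EReal.coe_mul_top_of_neg (by norm_num)]
    simp only [bot_le, le_top]
  | coe L =>
    rw [← EReal.coe_mul, EReal.coe_le_coe_iff, EReal.coe_le_coe_iff]
    constructor <;> intro h <;> linarith

variable {d p n n₁ n₂ m : ℕ} {g : Vec d → Vec p → Vec p} {Θx Θy : Set (Vec p)} {π θ : Vec p}
  {x : Fin n₁ → Fin m → Vec d} {y : Fin n₂ → Fin m → Vec d} {z : Fin n → Fin m → Vec d}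
  {v w : Fin n → ℝ} {t s : ℝ}

lemma gelLogRatio_div_le_iff (hm : 0 < m) :
    gelLogRatio g Θx Θy π x y / (m : EReal) ≤ (t : EReal) ↔
      ENNReal.ofReal (Real.exp (-(m * t) / 2)) ≤ gelRatio g Θx Θy π x y := by
  rw [gelLogRatio, neg_two_mul_div_le_coe_iff hm, ← ENNReal.log_le_log_iff,
    ENNReal.log_ofReal_of_pos (Real.exp_pos _), Real.log_exp]

lemma solvesWeighted_iff (hn : 0 < n) (hm : 0 < m) (hwv : ∀ i, (m : ℝ) * n * v i = w i) :
    SolvesWeighted g v z θ ↔ groupAvg w z (fun y => g y θ) = 0 := by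
  have h_eq : groupAvg w z (fun y => g y θ) = ∑ i, v i • ∑ k, g (z i k) θ := by
    rw [groupAvg, Finset.smul_sum]
    refine Finset.sum_congr rfl fun i _ => ?_
    rw [smul_smul, ← hwv i]
    congr 1
    field_simp
  rw [h_eq, SolvesWeighted]

lemma isRelWeight_iff (hn : 0 < n) (hm : 0 < m) (hwv : ∀ i, (m : ℝ) * n * v i = w i) :
    IsRelWeight w ↔ IsGroupWeight m v ∧ ∀ i, 0 < v i := by
  have hm' : (m : ℝ) ≠ 0 := Nat.cast_ne_zero.2 hm.ne'
  have hn' : (n : ℝ) ≠ 0 := Nat.cast_ne_zero.2 hn.ne'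
  have hsum : ∑ i, w i = n ↔ ∑ i, v i = 1 / (m : ℝ) := by
    rw [← Finset.sum_congr rfl fun i _ => hwv i, ← Finset.mul_sum, eq_div_iff hm', mul_assoc,
      mul_left_comm, mul_eq_left₀ hn', mul_comm]
  have hpos : (∀ i, 0 < w i) ↔ ∀ i, 0 < v i := forall_congr' fun i => by
    rw [← hwv i, mul_pos_iff_of_pos_left (by positivity)]
  rw [IsRelWeight, IsGroupWeight, hsum, hpos]
  exact ⟨fun h => ⟨⟨fun i => (h.1 i).le, h.2⟩, h.1⟩, fun h => ⟨h.2, h.1.2⟩⟩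

lemma prod_pow_eq_exp (hw : ∀ i, 0 < w i) :
    ∏ i, w i ^ m = Real.exp (-(m * negTwoLog w) / 2) := by
  have h_log : -(m * negTwoLog w) / 2 = ∑ i, m * Real.log (w i) := by
    rw [negTwoLog, ← Finset.mul_sum]
    ring
  rw [h_log, Real.exp_sum]
  refine Finset.prod_congr rfl fun i _ => ?_
  rw [mul_comm, Real.exp_mul, Real.exp_log (hw i), Real.rpow_natCast]

lemma pos_of_prod_pow_ne_zero {c : ℝ} (hm : m ≠ 0) (hv : ∀ i, 0 ≤ v i)
    (h : ∏ i, (c * v i) ^ m ≠ 0) (i : Fin n) : 0 < v i := by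
  have hi : (c * v i) ^ m ≠ 0 := Finset.prod_ne_zero_iff.1 h i (Finset.mem_univ i)
  exact (hv i).lt_of_ne' (right_ne_zero_of_mul ((pow_ne_zero_iff hm).1 hi))

lemma gelLogRatio_div_le (hn₁ : 0 < n₁) (hn₂ : 0 < n₂) (hm : 0 < m) {w : Fin n₁ → ℝ}
    {u : Fin n₂ → ℝ} {θx θy : Vec p} (hw : IsRelWeight w) (hu : IsRelWeight u)
    (hθx : θx ∈ Θx) (hθy : θy ∈ Θy) (hwx : groupAvg w x (fun y => g y θx) = 0)
    (huy : groupAvg u y (fun y => g y θy) = 0) (hπ : θy - θx = π)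
    (ht : negTwoLog w + negTwoLog u ≤ t) :
    gelLogRatio g Θx Θy π x y / (m : EReal) ≤ (t : EReal) := by
  have hw_scale : ∀ i, (m : ℝ) * n₁ * (w i / (m * n₁)) = w i := fun i =>
    mul_div_cancel₀ _ (by positivity)
  have hu_scale : ∀ i, (m : ℝ) * n₂ * (u i / (m * n₂)) = u i := fun i =>
    mul_div_cancel₀ _ (by positivity)
  rw [gelLogRatio_div_le_iff hm]
  refine le_trans ?_ (le_sSup ⟨fun i => w i / (m * n₁), fun i => u i / (m * n₂), θx, θy,
    ((isRelWeight_iff hn₁ hm hw_scale).1 hw).1, ((isRelWeight_iff hn₂ hm hu_scale).1 hu).1, hθx,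
    hθy, (solvesWeighted_iff hn₁ hm hw_scale).2 hwx, (solvesWeighted_iff hn₂ hm hu_scale).2 huy,
    hπ, rfl⟩)
  simp only [hw_scale, hu_scale]
  rw [prod_pow_eq_exp hw.1, prod_pow_eq_exp hu.1, ← Real.exp_add]
  refine ENNReal.ofReal_le_ofReal (Real.exp_le_exp.2 ?_)
  linarith [mul_le_mul_of_nonneg_left ht m.cast_nonneg (α := ℝ)]

lemma exists_of_gelLogRatio_div_le (hn₁ : 0 < n₁) (hn₂ : 0 < n₂) (hm : 0 < m)
    (ht : gelLogRatio g Θx Θy π x y / (m : EReal) ≤ (t : EReal)) (hts : t < s) :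
    ∃ (w : Fin n₁ → ℝ) (u : Fin n₂ → ℝ), ∃ θx ∈ Θx, ∃ θy ∈ Θy, IsRelWeight w ∧ IsRelWeight u ∧
      groupAvg w x (fun y => g y θx) = 0 ∧ groupAvg u y (fun y => g y θy) = 0 ∧ θy - θx = π ∧
      negTwoLog w + negTwoLog u ≤ s := by
  have hm' : (0 : ℝ) < m := Nat.cast_pos.2 hm
  have h_lt : ENNReal.ofReal (Real.exp (-(m * s) / 2)) < gelRatio g Θx Θy π x y := by
    refine lt_of_lt_of_le ?_ ((gelLogRatio_div_le_iff hm).1 ht)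
    rw [ENNReal.ofReal_lt_ofReal_iff (Real.exp_pos _), Real.exp_lt_exp]
    nlinarith
  obtain ⟨_, ⟨v, w, θx, θy, hv, hw, hθx, hθy, hvx, hwy, hπ, rfl⟩, hr⟩ := lt_sSup_iff.1 h_lt
  have hprod := ENNReal.ofReal_pos.1 (lt_of_le_of_lt bot_le hr)
  have hv_pos := pos_of_prod_pow_ne_zero hm.ne' hv.1 (left_ne_zero_of_mul hprod.ne')
  have hw_pos := pos_of_prod_pow_ne_zero hm.ne' hw.1 (right_ne_zero_of_mul hprod.ne')
  have hv_rel := (isRelWeight_iff hn₁ hm (w := fun i => m * n₁ * v i) fun _ => rfl).2 ⟨hv, hv_pos⟩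
  have hw_rel := (isRelWeight_iff hn₂ hm (w := fun i => m * n₂ * w i) fun _ => rfl).2 ⟨hw, hw_pos⟩
  refine ⟨fun i => m * n₁ * v i, fun i => m * n₂ * w i, θx, hθx, θy, hθy, hv_rel, hw_rel,
    (solvesWeighted_iff hn₁ hm fun _ => rfl).1 hvx,
    (solvesWeighted_iff hn₂ hm fun _ => rfl).1 hwy, hπ, ?_⟩
  rw [ENNReal.ofReal_lt_ofReal_iff hprod, prod_pow_eq_exp (w := fun i => m * n₁ * v i) hv_rel.1,
    prod_pow_eq_exp (w := fun i => m * n₂ * w i) hw_rel.1, ← Real.exp_add, Real.exp_lt_exp] at hr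
  nlinarith

end Ratio

section Whitening

open scoped RealInnerProductSpace

variable {E : Type*} [NormedAddCommGroup E] [InnerProductSpace ℝ E] [FiniteDimensional ℝ E]
  [CompleteSpace E]

lemma exists_whitening {T : E →L[ℝ] E} (hT : ∀ u v, ⟪T u, v⟫ = ⟪u, T v⟫)
    (hpos : ∀ v, v ≠ 0 → 0 < ⟪T v, v⟫) : ∃ M : E →L[ℝ] E, ∀ v, T (M.adjoint (M v)) = v := by
  have hsym : (T : E →ₗ[ℝ] E).IsSymmetric := hT
  set b := hsym.eigenvectorBasis rfl
  set ev := hsym.eigenvalues rfl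
  have hTb : ∀ i, T (b i) = ev i • b i := hsym.apply_eigenvectorBasis rfl
  have hev : ∀ i, 0 < ev i := fun i => by
    have h := hpos (b i) (b.orthonormal.ne_zero i)
    rwa [hTb, real_inner_smul_left, real_inner_self_eq_norm_sq, b.norm_eq_one, one_pow,
      mul_one] at h
  set M := ∑ i, (√(ev i))⁻¹ • InnerProductSpace.rankOne ℝ (b i) (b i)
  have hM_adjoint : M.adjoint = M := by
    simp only [M, map_sum, LinearIsometryEquiv.map_smulₛₗ, InnerProductSpace.adjoint_rankOne,
      conj_trivial]
  have hMb : ∀ j, M (b j) = (√(ev j))⁻¹ • b j := fun j => by simp [M, b.inner_eq_ite]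
  suffices hTMM : (T ∘L M ∘L M : E →ₗ[ℝ] E) = LinearMap.id from
    ⟨M, fun v => by rw [hM_adjoint]; exact LinearMap.congr_fun hTMM v⟩
  refine b.toBasis.ext fun j => ?_
  have hscale : (√(ev j))⁻¹ * (√(ev j))⁻¹ * ev j = 1 := by
    rw [← mul_inv, Real.mul_self_sqrt (hev j).le, inv_mul_cancel₀ (hev j).ne']
  simp only [b.coe_toBasis, ContinuousLinearMap.coe_coe, ContinuousLinearMap.comp_apply, hMb,
    map_smul, hTb, smul_smul, hscale, one_smul, LinearMap.id_apply]

end Whitening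

/-! ### Asymptotic equivalence of the statistic and a quadratic form -/

section Equivalence

variable {α : Type*} {d p : ℕ} {l : Filter α} {PX PY : Measure (Vec d)}
  {g : Vec d → Vec p → Vec p} {Ux Uy Θx Θy : Set (Vec p)} {θx₀ θy₀ : Vec p} {n₁ n₂ m : α → ℕ}
  {xs : ∀ a, Fin (n₁ a) → Fin (m a) → Vec d} {ys : ∀ a, Fin (n₂ a) → Fin (m a) → Vec d}
  {ρ ε : ℝ} {A M : Vec p →L[ℝ] Vec p}

lemma eventually_gelLogRatio_div_le (hx : GoodSample l g PX θx₀ n₁ m xs)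
    (hy : GoodSample l g PY θy₀ n₂ m ys)
    (hMx : RegularModel g PX Ux θx₀) (hMy : RegularModel g PY Uy θy₀)
    (hρ : Tendsto (fun a => √((n₂ a : ℝ) / n₁ a)) l (𝓝 ρ))
    (hA : ∀ v, ρ • A (meanJacobian g PY θy₀ v) = meanJacobian g PX θx₀ v)
    (hM : ∀ v, contrastCov g PX PY θx₀ θy₀ A (M.adjoint (M v)) = v)
    (hΘx : Θx ∈ 𝓝 θx₀) (hΘy : Θy ∈ 𝓝 θy₀) (hε : 0 < ε) (t : ℝ) :
    ∀ᶠ a in l, ‖M (contrast g θx₀ θy₀ A (xs a) (ys a))‖ ^ 2 ≤ t - ε →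
      gelLogRatio g Θx Θy (θy₀ - θx₀) (xs a) (ys a) / (m a : EReal) ≤ (t : EReal) := by
  filter_upwards [eventually_exists_negTwoLog_add_le hx hy hMx hMy hρ hA hM hΘx hΘy hε,
    hx.law.n_tendsto.eventually_gt_atTop 0, hy.law.n_tendsto.eventually_gt_atTop 0]
    with a ⟨θ, hθx, hθy, w, u, hw, hu, hw0, hu0, hle⟩ hn₁ hn₂ ht
  exact gelLogRatio_div_le hn₁ hn₂ (hx.law.m_pos a) hw hu hθx hθy hw0 hu0 (by abel) (by linarith)

/-- Consistency, in the form in which the upper bound on the quadratic form uses it: solutions in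
`Θ` of weighted estimating equations whose weights have a bounded log-likelihood ratio converge to
`θ₀`, along every filter finer than `l`. -/
def Consistent (l : Filter α) (g : Vec d → Vec p → Vec p) (θ₀ : Vec p) (Θ : Set (Vec p))
    (n m : α → ℕ) (x : ∀ a, Fin (n a) → Fin (m a) → Vec d) : Prop :=
  ∀ l' ≤ l, ∀ (t : ℝ) (w : ∀ a, Fin (n a) → ℝ) (θ : α → Vec p), LevelLE l' n t w →
    (∀ᶠ a in l', θ a ∈ Θ) → (∀ᶠ a in l', groupAvg (w a) (x a) (fun y => g y (θ a)) = 0) →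
    ∀ δ > 0, ∀ᶠ a in l', θ a ∈ Metric.closedBall θ₀ δ

lemma exists_weights_of_eventually_gelLogRatio_div_le (hx : GoodSample l g PX θx₀ n₁ m xs)
    (hy : GoodSample l g PY θy₀ n₂ m ys) {π : Vec p} {t s : ℝ}
    (ht : ∀ᶠ a in l, gelLogRatio g Θx Θy π (xs a) (ys a) / (m a : EReal) ≤ (t : EReal))
    (hts : t < s) :
    ∃ (w : ∀ a, Fin (n₁ a) → ℝ) (u : ∀ a, Fin (n₂ a) → ℝ) (θ : α → Vec p),
      (∀ᶠ a in l, IsRelWeight (w a)) ∧ (∀ᶠ a in l, IsRelWeight (u a)) ∧ (∀ᶠ a in l, θ a ∈ Θx) ∧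
      (∀ᶠ a in l, groupAvg (w a) (xs a) (fun y => g y (θ a)) = 0) ∧
      (∀ᶠ a in l, groupAvg (u a) (ys a) (fun y => g y (θ a + π)) = 0) ∧
      ∀ᶠ a in l, negTwoLog (w a) + negTwoLog (u a) ≤ s := by
  have hex : ∀ᶠ a in l, ∃ (w : Fin (n₁ a) → ℝ) (u : Fin (n₂ a) → ℝ) (θ : Vec p),
      IsRelWeight w ∧ IsRelWeight u ∧ θ ∈ Θx ∧ groupAvg w (xs a) (fun y => g y θ) = 0 ∧
      groupAvg u (ys a) (fun y => g y (θ + π)) = 0 ∧ negTwoLog w + negTwoLog u ≤ s := by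
    filter_upwards [ht, hx.law.n_tendsto.eventually_gt_atTop 0,
      hy.law.n_tendsto.eventually_gt_atTop 0] with a ha hn₁ hn₂
    obtain ⟨w, u, θx, hθx, θy, -, hw, hu, hw0, hu0, rfl, hle⟩ :=
      exists_of_gelLogRatio_div_le hn₁ hn₂ (hx.law.m_pos a) ha hts
    exact ⟨w, u, θx, hw, hu, hθx, hw0, by rwa [add_sub_cancel], hle⟩
  simpa only [Filter.skolem, eventually_and] using hex

lemma eventually_norm_contrast_sq_le (hx : GoodSample l g PX θx₀ n₁ m xs)
    (hy : GoodSample l g PY θy₀ n₂ m ys)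
    (hMx : RegularModel g PX Ux θx₀) (hMy : RegularModel g PY Uy θy₀)
    (hρ : Tendsto (fun a => √((n₂ a : ℝ) / n₁ a)) l (𝓝 ρ))
    (hA : ∀ v, ρ • A (meanJacobian g PY θy₀ v) = meanJacobian g PX θx₀ v)
    (hM : ∀ v, contrastCov g PX PY θx₀ θy₀ A (M.adjoint (M v)) = v)
    (hcons : Consistent l g θx₀ Θx n₁ m xs) (hε : 0 < ε) (t : ℝ) :
    ∀ᶠ a in l, gelLogRatio g Θx Θy (θy₀ - θx₀) (xs a) (ys a) / (m a : EReal) ≤ (t : EReal) →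
      ‖M (contrast g θx₀ θy₀ A (xs a) (ys a))‖ ^ 2 ≤ t + ε := by
  set l' := l ⊓ 𝓟 {a | gelLogRatio g Θx Θy (θy₀ - θx₀) (xs a) (ys a) / (m a : EReal) ≤ (t : EReal)}
  suffices H : ∀ᶠ a in l', ‖M (contrast g θx₀ θy₀ A (xs a) (ys a))‖ ^ 2 ≤ t + ε from
    eventually_inf_principal.1 H
  have hle : l' ≤ l := inf_le_left
  have hx' : GoodSample l' g PX θx₀ n₁ m xs := hx.comp hle
  have hy' : GoodSample l' g PY θy₀ n₂ m ys := hy.comp hle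
  obtain ⟨w, u, θ, hw, hu, hθ, hwθ, huθ, hlevel⟩ :=
    exists_weights_of_eventually_gelLogRatio_div_le hx' hy'
      (mem_inf_of_right (mem_principal_self _)) (show t < t + ε / 2 by linarith)
  have hw_level : LevelLE l' n₁ (t + ε / 2) w := by
    filter_upwards [hw, hu, hlevel] with a hw hu hlevel
    exact ⟨hw, by linarith [hu.negTwoLog_nonneg]⟩
  obtain ⟨R, hR⟩ := hx'.exists_norm_normSum_le
  obtain ⟨C, hC⟩ := hx'.groups.exists_rate hx'.law hMx.isOpen hMx.mem hMx.regularOn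
    hMx.integrable_fderiv hMx.injective_jacobian hR hw_level hwθ
    (hcons l' hle _ w θ hw_level hθ hwθ)
  filter_upwards [eventually_norm_contrast_sq_le_negTwoLog_add hx' hy' hMx hMy (hρ.mono_left hle)
    hA hM hC hw hwθ hu huθ (half_pos hε), hlevel] with a hcontrast hlevel
  linarith

lemma groupAvg_eq_zero_unique {n m : ℕ} (hn : 0 < n) (hm : 0 < m) {x : Fin n → Fin m → Vec d}
    (hwd : SolutionWellDefined g x) {w : Fin n → ℝ} (hw : IsRelWeight w) {θ θ' : Vec p}
    (hθ : groupAvg w x (fun y => g y θ) = 0) (hθ' : groupAvg w x (fun y => g y θ') = 0) :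
    θ = θ' := by
  have hscale : ∀ i, (m : ℝ) * n * (w i / (m * n)) = w i := fun i =>
    mul_div_cancel₀ _ (by positivity)
  obtain ⟨hweight, hpos⟩ := (isRelWeight_iff hn hm hscale).1 hw
  exact hwd _ hweight hpos _ _ ((solvesWeighted_iff hn hm hscale).2 hθ)
    ((solvesWeighted_iff hn hm hscale).2 hθ')

lemma GoodSample.consistent_of_wellDefined (hx : GoodSample l g PX θx₀ n₁ m xs)
    (hMx : RegularModel g PX Ux θx₀) (hwd : ∀ᶠ a in l, SolutionWellDefined g (xs a))
    (Θ : Set (Vec p)) : Consistent l g θx₀ Θ n₁ m xs := by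
  intro l' hle t w θ hw _ hθ δ hδ
  have hx' : GoodSample l' g PX θx₀ n₁ m xs := hx.comp hle
  obtain ⟨R, hR⟩ := hx'.exists_norm_normSum_le
  refine hx'.groups.localized_of_unique hx'.law hMx.isOpen hMx.mem hMx.regularOn
    hMx.integrable_fderiv hMx.injective_jacobian hR hw ?_ hδ
  filter_upwards [hle hwd, hw, hθ, hx'.law.n_tendsto.eventually_gt_atTop 0]
    with a hwd hw hθ hn θ' hθ'
  exact groupAvg_eq_zero_unique hn (hx.law.m_pos a) hwd hw.1 hθ' hθ

lemma GoodSample.consistent_of_compact (hx : GoodSample l g PX θx₀ n₁ m xs)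
    (hP : IsParameter g PX θx₀) (hg : ∀ θ, Measurable fun y => g y θ) (hU : IsOpen Ux)
    (hR : RegularOn g PX Ux) {K : Set (Vec p)} (hK : IsCompact K) (hKc : Convex ℝ K)
    (hKU : K ⊆ Ux) (hθK : θx₀ ∈ K) : Consistent l g θx₀ K n₁ m xs := by
  intro l' hle t w θ hw hθK' hθ δ hδ
  exact (hx.comp hle).law.localized_of_compact hP hg hU hR hK hKc hKU hθK hw hθK' hθ hδ

end Equivalence

/-! ### Convergence in probability as convergence along a filter -/

section ProbFilter

variable {Ω : Type*} [MeasurableSpace Ω] {μ : Measure Ω}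

/-- The filter of the sequences of events whose probability tends to one: a property holds with
probability tending to one iff it holds eventually along `probFilter μ`, and convergence in
probability is convergence along `probFilter μ`. -/
def probFilter (μ : Measure Ω) : Filter (ℕ × Ω) where
  sets := {s | Tendsto (fun k => μ {ω | (k, ω) ∉ s}) atTop (𝓝 0)}
  univ_sets := by simp
  sets_of_superset {s t} hs hst :=
    tendsto_of_tendsto_of_tendsto_of_le_of_le tendsto_const_nhds hs (fun _ => zero_le)
      fun k => measure_mono fun ω hω h => hω (hst h)
  inter_sets {s t} hs ht := by
    refine tendsto_of_tendsto_of_tendsto_of_le_of_le tendsto_const_nhds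
      ((Tendsto.add hs ht).trans_eq (by rw [add_zero])) (fun _ => zero_le)
      fun k => (measure_mono fun ω hω => ?_).trans (measure_union_le _ _)
    exact not_and_or.1 hω

lemma eventually_probFilter {q : ℕ × Ω → Prop} :
    (∀ᶠ a in probFilter μ, q a) ↔ Tendsto (fun k => μ {ω | ¬ q (k, ω)}) atTop (𝓝 0) := Iff.rfl

lemma eventually_probFilter_of_ae {q : ℕ × Ω → Prop} (h : ∀ k, ∀ᵐ ω ∂μ, q (k, ω)) :
    ∀ᶠ a in probFilter μ, q a :=
  eventually_probFilter.2 (tendsto_const_nhds.congr fun k => (ae_iff.1 (h k)).symm)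

lemma tendsto_fst_probFilter : Tendsto Prod.fst (probFilter μ) atTop :=
  tendsto_atTop.2 fun K => eventually_probFilter.2 <| tendsto_const_nhds.congr' <|
    (eventually_ge_atTop K).mono fun k hk => by simp [hk]

lemma tendsto_probFilter_of_integral {f : ℕ × Ω → ℝ} (hf : ∀ k, Integrable (fun ω => f (k, ω)) μ)
    (h : Tendsto (fun k => ∫ ω, |f (k, ω)| ∂μ) atTop (𝓝 0)) :
    Tendsto f (probFilter μ) (𝓝 0) := by
  refine Metric.tendsto_nhds.2 fun ε hε => eventually_probFilter.2 ?_
  have hlim : Tendsto (fun k => ENNReal.ofReal (ε⁻¹ * ∫ ω, |f (k, ω)| ∂μ)) atTop (𝓝 0) := by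
    simpa using ENNReal.tendsto_ofReal (h.const_mul ε⁻¹)
  refine tendsto_of_tendsto_of_tendsto_of_le_of_le tendsto_const_nhds hlim (fun _ => zero_le)
    fun k => ?_
  have hmarkov := mul_meas_ge_le_integral_of_nonneg (ae_of_all μ fun ω => abs_nonneg (f (k, ω)))
    (hf k).abs ε
  simp only [Real.dist_eq, sub_zero, not_lt]
  rw [← ENNReal.ofReal_toReal ((hf k).abs.measure_ge_lt_top hε).ne]
  exact ENNReal.ofReal_le_ofReal ((le_inv_mul_iff₀ hε).2 hmarkov)

end ProbFilter

/-! ### A weak law of large numbers for arrays -/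

section WeakLaw

variable {Ω : Type*} [MeasurableSpace Ω] {μ : Measure Ω} [IsProbabilityMeasure μ]

lemma integral_abs_le_sqrt {f : Ω → ℝ} (hf : MemLp f 2 μ) :
    ∫ ω, |f ω| ∂μ ≤ √(∫ ω, f ω ^ 2 ∂μ) := by
  have hvar := variance_eq_sub hf.abs
  simp only [Pi.pow_apply, Pi.abs_apply, sq_abs] at hvar
  exact Real.le_sqrt_of_sq_le (by linarith [variance_nonneg |f| μ])

lemma integral_abs_sub_integral_le {f : Ω → ℝ} (hf : Integrable f μ) :
    ∫ ω, |f ω - ∫ ω', f ω' ∂μ| ∂μ ≤ 2 * ∫ ω, |f ω| ∂μ := by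
  calc ∫ ω, |f ω - ∫ ω', f ω' ∂μ| ∂μ
      ≤ ∫ ω, (|f ω| + ∫ ω', |f ω'| ∂μ) ∂μ :=
        integral_mono (hf.sub (integrable_const _)).abs (hf.abs.add (integrable_const _))
          fun ω => (abs_sub _ _).trans (add_le_add_right abs_integral_le_integral_abs _)
    _ = 2 * ∫ ω, |f ω| ∂μ := by
        rw [integral_add hf.abs (integrable_const _)]
        simp only [integral_const, probReal_univ, one_smul]
        ring

variable {ι : Type*} [Fintype ι] [Nonempty ι] {W : ι → Ω → ℝ} {M τ : ℝ}

omit [IsProbabilityMeasure μ] in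
lemma integral_abs_avg_le (hW : ∀ i, Integrable (W i) μ) (hτ : ∀ i, ∫ ω, |W i ω| ∂μ ≤ τ) :
    ∫ ω, |(Fintype.card ι : ℝ)⁻¹ * ∑ i, W i ω| ∂μ ≤ τ := by
  have hcard : (0 : ℝ) < Fintype.card ι := by exact_mod_cast Fintype.card_pos
  calc ∫ ω, |(Fintype.card ι : ℝ)⁻¹ * ∑ i, W i ω| ∂μ
      ≤ ∫ ω, (Fintype.card ι : ℝ)⁻¹ * ∑ i, |W i ω| ∂μ := by
        refine integral_mono ((integrable_finsetSum _ fun i _ => hW i).const_mul _).abs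
          ((integrable_finsetSum _ fun i _ => (hW i).abs).const_mul _) fun ω => ?_
        simp only [abs_mul, abs_of_pos (inv_pos.2 hcard)]
        gcongr
        exact Finset.abs_sum_le_sum_abs _ _
    _ = (Fintype.card ι : ℝ)⁻¹ * ∑ i, ∫ ω, |W i ω| ∂μ := by
        rw [integral_const_mul, integral_finsetSum _ fun i _ => (hW i).abs]
    _ ≤ τ := by
        rw [inv_mul_le_iff₀ hcard]
        simpa using Finset.sum_le_card_nsmul Finset.univ _ _ fun i _ => hτ i

lemma integral_abs_avg_sub_integral_le (hW : ∀ i, AEMeasurable (W i) μ)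
    (hM : ∀ i ω, |W i ω| ≤ M) (hind : Pairwise fun i j => IndepFun (W i) (W j) μ) :
    ∫ ω, |(Fintype.card ι : ℝ)⁻¹ * ∑ i, (W i ω - ∫ ω', W i ω' ∂μ)| ∂μ ≤
      √(M ^ 2 / Fintype.card ι) := by
  set N : ℝ := (Fintype.card ι : ℝ)
  have hN : 0 < N := by simp only [N]; exact_mod_cast Fintype.card_pos
  have hL2 : ∀ i, MemLp (W i) 2 μ := fun i =>
    MemLp.of_bound (hW i).aestronglyMeasurable M (ae_of_all _ (hM i))
  have hvar_le : ∀ i, Var[W i; μ] ≤ M ^ 2 := fun i =>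
    (variance_le_sq_of_bounded (ae_of_all _ fun ω => abs_le.1 (hM i ω)) (hW i)).trans_eq (by ring)
  have hvar : Var[∑ i, W i; μ] ≤ N * M ^ 2 := by
    rw [IndepFun.variance_sum (fun i _ => hL2 i) fun i _ j _ hij => hind hij]
    simpa using Finset.sum_le_card_nsmul Finset.univ _ _ fun i _ => hvar_le i
  have hcentered : ∀ ω, ∑ i, (W i ω - ∫ ω', W i ω' ∂μ) =
      (∑ i, W i) ω - ∫ ω', (∑ i, W i) ω' ∂μ := fun ω => by
    simp only [Finset.sum_apply, Finset.sum_sub_distrib]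
    rw [integral_finsetSum _ fun i _ => (hL2 i).integrable one_le_two]
  have hsum_L2 : MemLp (∑ i, W i) 2 μ := memLp_finsetSum' _ fun i _ => hL2 i
  simp only [hcentered]
  refine (integral_abs_le_sqrt ((hsum_L2.sub (memLp_const _)).const_mul _)).trans
    (Real.sqrt_le_sqrt ?_)
  calc ∫ ω, (N⁻¹ * ((∑ i, W i) ω - ∫ ω', (∑ i, W i) ω' ∂μ)) ^ 2 ∂μ
      = N⁻¹ ^ 2 * Var[∑ i, W i; μ] := by
        simp only [mul_pow]
        rw [integral_const_mul, variance_eq_integral hsum_L2.aemeasurable]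
    _ ≤ N⁻¹ ^ 2 * (N * M ^ 2) := by gcongr
    _ = M ^ 2 / N := by field_simp

/-- Truncation of a real number at the level `M`, as a continuous map; it serves to reduce the weak
law to bounded variables. -/
def clip (M x : ℝ) : ℝ := max (-M) (min x M)

lemma abs_clip_le (hM : 0 ≤ M) (x : ℝ) : |clip M x| ≤ M :=
  abs_le.2 ⟨le_max_left _ _, max_le (by linarith) (min_le_right _ _)⟩

lemma abs_sub_clip (hM : 0 ≤ M) (x : ℝ) : |x - clip M x| = max (|x| - M) 0 := by
  grind [clip]

lemma measurable_clip (M : ℝ) : Measurable (clip M) := by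
  unfold clip
  fun_prop

lemma integral_abs_avg_sub_le {c : ℝ} (hW : ∀ i, Integrable (W i) μ)
    (hc : ∀ i, ∫ ω, W i ω ∂μ = c) (hind : Pairwise fun i j => IndepFun (W i) (W j) μ) (hM : 0 ≤ M)
    (hτ : ∀ i, ∫ ω, max (|W i ω| - M) 0 ∂μ ≤ τ) :
    ∫ ω, |(Fintype.card ι : ℝ)⁻¹ * ∑ i, W i ω - c| ∂μ ≤ √(M ^ 2 / Fintype.card ι) + 2 * τ := by
  set V : ι → Ω → ℝ := fun i ω => clip M (W i ω)
  set R : ι → Ω → ℝ := fun i ω => W i ω - V i ω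
  have hV : ∀ i, AEMeasurable (V i) μ := fun i =>
    (measurable_clip M).comp_aemeasurable (hW i).aemeasurable
  have hV_int : ∀ i, Integrable (V i) μ := fun i =>
    Integrable.of_bound (hV i).aestronglyMeasurable M (ae_of_all _ fun ω => abs_clip_le hM _)
  have hR_int : ∀ i, Integrable (R i) μ := fun i => (hW i).sub (hV_int i)
  have hV_le := integral_abs_avg_sub_integral_le hV (fun i ω => abs_clip_le hM (W i ω))
    fun i j hij => (hind hij).comp (measurable_clip M) (measurable_clip M)
  have hR_le : ∫ ω, |(Fintype.card ι : ℝ)⁻¹ * ∑ i, (R i ω - ∫ ω', R i ω' ∂μ)| ∂μ ≤ 2 * τ := by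
    refine integral_abs_avg_le (fun i => (hR_int i).sub (integrable_const _)) fun i =>
      (integral_abs_sub_integral_le (hR_int i)).trans ?_
    simpa only [R, V, abs_sub_clip hM, mul_le_mul_iff_right₀ two_pos] using hτ i
  have hsplit : ∀ ω, (Fintype.card ι : ℝ)⁻¹ * ∑ i, W i ω - c =
      (Fintype.card ι : ℝ)⁻¹ * ∑ i, (V i ω - ∫ ω', V i ω' ∂μ) +
        (Fintype.card ι : ℝ)⁻¹ * ∑ i, (R i ω - ∫ ω', R i ω' ∂μ) := fun ω => by
    have hcenter : ∀ i, ∫ ω', R i ω' ∂μ = c - ∫ ω', V i ω' ∂μ := fun i => by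
      rw [integral_sub (hW i) (hV_int i), hc i]
    rw [← mul_add, ← Finset.sum_add_distrib]
    simp only [hcenter, R, sub_add_sub_comm, add_sub_cancel, Finset.sum_sub_distrib,
      Finset.sum_const, Finset.card_univ, nsmul_eq_mul]
    field_simp
  have hV_avg : Integrable
      (fun ω => (Fintype.card ι : ℝ)⁻¹ * ∑ i, (V i ω - ∫ ω', V i ω' ∂μ)) μ :=
    (integrable_finsetSum _ fun i _ => (hV_int i).sub (integrable_const _)).const_mul _
  have hR_avg : Integrable
      (fun ω => (Fintype.card ι : ℝ)⁻¹ * ∑ i, (R i ω - ∫ ω', R i ω' ∂μ)) μ :=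
    (integrable_finsetSum _ fun i _ => (hR_int i).sub (integrable_const _)).const_mul _
  simp only [hsplit]
  refine (integral_mono (hV_avg.add hR_avg).abs (hV_avg.abs.add hR_avg.abs)
    fun ω => abs_add_le _ _).trans ?_
  exact (integral_add hV_avg.abs hR_avg.abs).trans_le (add_le_add hV_le hR_le)

lemma tendsto_avg_probFilter {ι : ℕ → Type*} [∀ k, Fintype (ι k)]
    (hι : Tendsto (fun k => Fintype.card (ι k)) atTop atTop) {W : ∀ k, ι k → Ω → ℝ} {c : ℝ}
    (hW : ∀ k i, Integrable (W k i) μ) (hc : ∀ k i, ∫ ω, W k i ω ∂μ = c)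
    (hind : ∀ k, Pairwise fun i j => IndepFun (W k i) (W k j) μ)
    (hui : ∀ τ > 0, ∃ M ≥ 0, ∀ k i, ∫ ω, max (|W k i ω| - M) 0 ∂μ ≤ τ) :
    Tendsto (fun a : ℕ × Ω => (Fintype.card (ι a.1) : ℝ)⁻¹ * ∑ i, W a.1 i a.2) (probFilter μ)
      (𝓝 c) := by
  rw [← tendsto_sub_nhds_zero_iff]
  have hint : ∀ k, Integrable (fun ω => (Fintype.card (ι k) : ℝ)⁻¹ * ∑ i, W k i ω - c) μ :=
    fun k => ((integrable_finsetSum _ fun i _ => hW k i).const_mul _).sub (integrable_const _)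
  refine tendsto_probFilter_of_integral hint (Metric.tendsto_nhds.2 fun ε hε => ?_)
  obtain ⟨M, hM, hMτ⟩ := hui (ε / 4) (by positivity)
  have hsqrt : Tendsto (fun k => √(M ^ 2 / (Fintype.card (ι k) : ℝ))) atTop (𝓝 0) := by
    simpa using (tendsto_const_nhds.div_atTop (tendsto_natCast_atTop_atTop.comp hι)).sqrt
  filter_upwards [hsqrt.eventually (gt_mem_nhds (half_pos hε)), hι.eventually_gt_atTop 0]
    with k hsqrt hcard
  have : Nonempty (ι k) := Fintype.card_pos_iff.1 hcard
  rw [dist_zero_right, Real.norm_of_nonneg (integral_nonneg fun ω => abs_nonneg _)]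
  linarith [integral_abs_avg_sub_le (hW k) (hc k) (hind k) hM (hMτ k)]

end WeakLaw

/-! ### Third moments of sums of independent random variables -/

section ThirdMoment

variable {Ω : Type*} [MeasurableSpace Ω] {μ : Measure Ω}

lemma abs_add_pow_three_le (s x : ℝ) :
    |s + x| ^ 3 ≤ |s| ^ 3 + 3 * ((s * |s|) * x) + 3 * (|s| * x ^ 2) + |x| ^ 3 := by
  rcases le_total 0 s with hs | hs <;> rcases le_total 0 x with hx | hx <;>
    rcases le_total 0 (s + x) with h | h <;>
    simp only [abs_of_nonneg, abs_of_nonpos, hs, hx, h] <;>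
    nlinarith [mul_nonneg (sub_nonneg.2 hs) (sq_nonneg (s - 3 / 2 * x)),
      mul_nonneg (sub_nonneg.2 hs) (sq_nonneg (s + 3 / 2 * x)),
      mul_nonneg (sub_nonneg.2 hs) (sq_nonneg x), mul_nonneg (sub_nonneg.2 hs) (sq_nonneg s),
      pow_nonneg (sub_nonneg.2 hx) 3, pow_nonneg (sub_nonneg.2 hs) 3,
      mul_nonneg (sub_nonneg.2 hx) (sq_nonneg x), mul_nonneg (sub_nonneg.2 hx) (sq_nonneg s)]

lemma integrable_abs_pow_three {f : Ω → ℝ} (hf : MemLp f 3 μ) :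
    Integrable (fun ω => |f ω| ^ 3) μ := by
  have hf3 : MemLp f ((3 : ℕ) : ℝ≥0∞) μ := by exact_mod_cast hf
  exact hf3.integrable_norm_pow three_ne_zero

variable [IsProbabilityMeasure μ]

lemma integral_abs_add_pow_three_le {S Z : Ω → ℝ} (hS : MemLp S 3 μ) (hZ : MemLp Z 3 μ)
    (hind : IndepFun S Z μ) (hZ0 : ∫ ω, Z ω ∂μ = 0) :
    ∫ ω, |S ω + Z ω| ^ 3 ∂μ ≤ ∫ ω, |S ω| ^ 3 ∂μ + 3 * ((∫ ω, |S ω| ∂μ) * ∫ ω, Z ω ^ 2 ∂μ) +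
      ∫ ω, |Z ω| ^ 3 ∂μ := by
  have hS2 : MemLp S 2 μ := hS.mono_exponent (by norm_num)
  have hZ2 : MemLp Z 2 μ := hZ.mono_exponent (by norm_num)
  have hS1 := (hS2.integrable one_le_two).abs
  have hind_sq := hind.comp (φ := fun t => t * |t|) (ψ := id) (by fun_prop) measurable_id
  have hind_abs := hind.comp (φ := fun t => |t|) (ψ := fun t => t ^ 2) (by fun_prop) (by fun_prop)
  have hcross_int : Integrable (fun ω => (S ω * |S ω|) * Z ω) μ :=
    hind_sq.integrable_mul (hS2.integrable_mul hS2.abs) (hZ2.integrable one_le_two)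
  have hcross : ∫ ω, (S ω * |S ω|) * Z ω ∂μ = 0 :=
    (hind_sq.integral_fun_mul_eq_mul_integral
      (hS2.integrable_mul hS2.abs).aestronglyMeasurable hZ.aestronglyMeasurable).trans
      (mul_eq_zero_of_right _ hZ0)
  have hprod_int : Integrable (fun ω => |S ω| * Z ω ^ 2) μ :=
    hind_abs.integrable_mul hS1 hZ2.integrable_sq
  have hprod : ∫ ω, |S ω| * Z ω ^ 2 ∂μ = (∫ ω, |S ω| ∂μ) * ∫ ω, Z ω ^ 2 ∂μ :=
    hind_abs.integral_fun_mul_eq_mul_integral hS1.aestronglyMeasurable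
      hZ2.integrable_sq.aestronglyMeasurable
  have hS3_int := integrable_abs_pow_three hS
  have hZ3_int := integrable_abs_pow_three hZ
  have hint₂ := hS3_int.add (hcross_int.const_mul 3)
  have hint₃ := hint₂.add (hprod_int.const_mul 3)
  refine (integral_mono_of_nonneg (ae_of_all _ fun ω => by positivity) (hint₃.add hZ3_int)
    (ae_of_all _ fun ω => abs_add_pow_three_le (S ω) (Z ω))).trans_eq ?_
  rw [integral_add' hint₃ hZ3_int, integral_add' hint₂ (hprod_int.const_mul 3),
    integral_add' hS3_int (hcross_int.const_mul 3), integral_const_mul, integral_const_mul, hcross,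
    hprod, mul_zero, add_zero]

variable {ι : Type*} {ζ : ι → Ω → ℝ} {σ β : ℝ}

lemma integral_sum_sq_eq (hind : iIndepFun ζ μ) (hζ : ∀ i, MemLp (ζ i) 2 μ)
    (hζ0 : ∀ i, ∫ ω, ζ i ω ∂μ = 0) {v : ℝ} (hζv : ∀ i, ∫ ω, ζ i ω ^ 2 ∂μ = v) (s : Finset ι) :
    ∫ ω, (∑ i ∈ s, ζ i ω) ^ 2 ∂μ = s.card * v := by
  simp only [← Finset.sum_apply]
  have hsum : MemLp (∑ i ∈ s, ζ i) 2 μ := memLp_finsetSum' _ fun i _ => hζ i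
  have hsum0 : ∫ ω, (∑ i ∈ s, ζ i) ω ∂μ = 0 := by
    simp only [Finset.sum_apply]
    rw [integral_finsetSum _ fun i _ => (hζ i).integrable one_le_two]
    exact Finset.sum_eq_zero fun i _ => hζ0 i
  rw [← variance_of_integral_eq_zero hsum.aemeasurable hsum0,
    IndepFun.variance_sum (fun i _ => hζ i) fun i _ j _ hij => hind.indepFun hij,
    Finset.sum_congr rfl fun i _ =>
      (variance_of_integral_eq_zero (hζ i).aemeasurable (hζ0 i)).trans (hζv i),
    Finset.sum_const, nsmul_eq_mul]

lemma integral_abs_sum_le_sqrt_card_mul (hind : iIndepFun ζ μ) (hζ : ∀ i, MemLp (ζ i) 2 μ)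
    (hζ0 : ∀ i, ∫ ω, ζ i ω ∂μ = 0) (hσ : 0 ≤ σ) (hζσ : ∀ i, ∫ ω, ζ i ω ^ 2 ∂μ = σ ^ 2)
    (s : Finset ι) : ∫ ω, |∑ i ∈ s, ζ i ω| ∂μ ≤ √(s.card : ℝ) * σ := by
  refine (integral_abs_le_sqrt (memLp_finsetSum s fun i _ => hζ i)).trans_eq ?_
  rw [integral_sum_sq_eq hind hζ hζ0 hζσ, Real.sqrt_mul s.card.cast_nonneg, Real.sqrt_sq hσ]

lemma mul_sqrt_pow_three_add_le {x : ℝ} (hx : 0 ≤ x) (hσ : 0 ≤ σ) (hβ : 0 ≤ β) :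
    (3 * σ ^ 3 + β) * √x ^ 3 + 3 * (√x * σ * σ ^ 2) + β ≤ (3 * σ ^ 3 + β) * √(x + 1) ^ 3 := by
  have hmono : √x ≤ √(x + 1) := Real.sqrt_le_sqrt (by linarith)
  have hone : 1 ≤ √(x + 1) := Real.one_le_sqrt.2 (by linarith)
  have hcube : √x ^ 3 + √(x + 1) ≤ √(x + 1) ^ 3 := by
    nlinarith [Real.sq_sqrt hx, Real.sq_sqrt (show 0 ≤ x + 1 by linarith), sq_nonneg √x]
  calc (3 * σ ^ 3 + β) * √x ^ 3 + 3 * (√x * σ * σ ^ 2) + β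
      = (3 * σ ^ 3 + β) * √x ^ 3 + (3 * σ ^ 3 * √x + β * 1) := by ring
    _ ≤ (3 * σ ^ 3 + β) * √x ^ 3 + (3 * σ ^ 3 * √(x + 1) + β * √(x + 1)) := by gcongr
    _ = (3 * σ ^ 3 + β) * (√x ^ 3 + √(x + 1)) := by ring
    _ ≤ (3 * σ ^ 3 + β) * √(x + 1) ^ 3 := by gcongr

lemma integral_abs_sum_pow_three_le (hind : iIndepFun ζ μ) (hζ : ∀ i, MemLp (ζ i) 3 μ)
    (hζ0 : ∀ i, ∫ ω, ζ i ω ∂μ = 0) (hσ : 0 ≤ σ) (hζσ : ∀ i, ∫ ω, ζ i ω ^ 2 ∂μ = σ ^ 2)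
    (hζβ : ∀ i, ∫ ω, |ζ i ω| ^ 3 ∂μ ≤ β) (s : Finset ι) :
    ∫ ω, |∑ i ∈ s, ζ i ω| ^ 3 ∂μ ≤ (3 * σ ^ 3 + β) * √(s.card : ℝ) ^ 3 := by
  classical
  simp only [← Finset.sum_apply]
  induction s using Finset.induction_on with
  | empty => simp
  | insert a s ha ih =>
    have hβ : 0 ≤ β := (integral_nonneg fun ω => by positivity).trans (hζβ a)
    have hadd := integral_abs_add_pow_three_le (memLp_finsetSum' s fun i _ => hζ i) (hζ a)
      (hind.indepFun_finsetSum_of_notMem₀ (fun i => (hζ i).aemeasurable) ha) (hζ0 a)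
    have habs := integral_abs_sum_le_sqrt_card_mul hind
      (fun i => (hζ i).mono_exponent (by norm_num)) hζ0 hσ hζσ s
    simp only [← Finset.sum_apply] at habs
    rw [hζσ] at hadd
    rw [Finset.sum_insert ha, add_comm, Finset.card_insert_of_notMem ha, Nat.cast_add_one]
    calc ∫ ω, |(∑ i ∈ s, ζ i + ζ a) ω| ^ 3 ∂μ
        ≤ (3 * σ ^ 3 + β) * √(s.card : ℝ) ^ 3 + 3 * (√(s.card : ℝ) * σ * σ ^ 2) + β := by
          refine hadd.trans ?_
          gcongr
          exact hζβ a
      _ ≤ (3 * σ ^ 3 + β) * √((s.card : ℝ) + 1) ^ 3 :=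
          mul_sqrt_pow_three_add_le s.card.cast_nonneg hσ hβ

end ThirdMoment

/-! ### Arrays of independent observations -/

section IIDArray

open scoped RealInnerProductSpace

variable {Ω D : Type*} [MeasurableSpace Ω] [MeasurableSpace D]

/-- For every `k`, the observations `X k i j` are independent with law `P`; this is the triangular
array of a sample divided into `n k` groups of size `m k`. -/
structure IsIIDArray (μ : Measure Ω) (P : Measure D) (n m : ℕ → ℕ)
    (X : (k : ℕ) → Fin (n k) → Fin (m k) → Ω → D) : Prop where
  law : ∀ k i j, HasLaw (X k i j) P μ
  indep : ∀ k, iIndepFun (fun a : Fin (n k) × Fin (m k) => X k a.1 a.2) μ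

variable {μ : Measure Ω} {P : Measure D} {n m : ℕ → ℕ}
  {X : (k : ℕ) → Fin (n k) → Fin (m k) → Ω → D}

section HasLaw

variable {F : Type*} [NormedAddCommGroup F] {Z : Ω → D} {f : D → F}

lemma memLp_comp_of_hasLaw (hZ : HasLaw Z P μ) {q : ℝ≥0∞} (hf : MemLp f q P) :
    MemLp (fun ω => f (Z ω)) q μ := by
  rw [← hZ.map_eq] at hf
  exact hf.comp_of_map hZ.aemeasurable

lemma integrable_comp_of_hasLaw (hZ : HasLaw Z P μ) (hf : Integrable f P) :
    Integrable (fun ω => f (Z ω)) μ :=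
  memLp_one_iff_integrable.1 (memLp_comp_of_hasLaw hZ (memLp_one_iff_integrable.2 hf))

lemma integral_fun_comp_of_hasLaw [NormedSpace ℝ F] (hZ : HasLaw Z P μ)
    (hf : AEStronglyMeasurable f P) : ∫ ω, f (Z ω) ∂μ = ∫ y, f y ∂P :=
  hZ.integral_comp hf

lemma aemeasurable_comp_of_hasLaw {f : D → ℝ} (hZ : HasLaw Z P μ) (hf : AEMeasurable f P) :
    AEMeasurable (fun ω => f (Z ω)) μ := by
  rw [← hZ.map_eq] at hf
  exact hf.comp_aemeasurable hZ.aemeasurable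

end HasLaw

lemma max_sq_sub_le {y M : ℝ} (hM : 0 < M) : max (|y ^ 2| - M) 0 ≤ |y| ^ 3 / √M := by
  have hsqrt := Real.sqrt_pos.2 hM
  refine max_le ?_ (by positivity)
  rw [abs_sq]
  rcases le_total |y| √M with h | h
  · have hsq : y ^ 2 ≤ M := sq_abs y ▸ (Real.le_sqrt (abs_nonneg y) hM.le).1 h
    exact (sub_nonpos.2 hsq).trans (by positivity)
  · rw [le_div_iff₀ hsqrt]
    calc (y ^ 2 - M) * √M ≤ |y| ^ 2 * √M := by rw [sq_abs]; gcongr; linarith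
      _ ≤ |y| ^ 2 * |y| := by gcongr
      _ = |y| ^ 3 := by ring

namespace IsIIDArray

variable {f : D → ℝ}

lemma iIndepFun_comp (h : IsIIDArray μ P n m X) (hf : AEMeasurable f P) (k : ℕ) :
    iIndepFun (fun (a : Fin (n k) × Fin (m k)) ω => f (X k a.1 a.2 ω)) μ :=
  (h.indep k).comp₀ (fun _ => f) (fun a => (h.law k a.1 a.2).aemeasurable)
    (fun a => by rwa [(h.law k a.1 a.2).map_eq])

lemma iIndepFun_group (h : IsIIDArray μ P n m X) (hf : AEMeasurable f P) (k : ℕ) (i : Fin (n k)) :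
    iIndepFun (fun (j : Fin (m k)) ω => f (X k i j ω)) μ :=
  (h.iIndepFun_comp hf k).precomp (g := fun j => (i, j)) (Prod.mk_right_injective i)

lemma tendsto_groupAvg_one [IsProbabilityMeasure μ] (h : IsIIDArray μ P n m X)
    (hn : Tendsto n atTop atTop) (hm : ∀ k, 1 ≤ m k) (hf : Integrable f P) :
    Tendsto (fun a : ℕ × Ω => groupAvg 1 (fun i j => X a.1 i j a.2) f) (probFilter μ)
      (𝓝 (∫ y, f y ∂P)) := by
  have hcard : Tendsto (fun k => Fintype.card (Fin (n k) × Fin (m k))) atTop atTop := by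
    simp only [Fintype.card_prod, Fintype.card_fin]
    exact tendsto_atTop_mono (fun k => Nat.le_mul_of_pos_right _ (hm k)) hn
  have hui : ∀ τ > 0, ∃ M ≥ (0 : ℝ), ∀ k (a : Fin (n k) × Fin (m k)),
      ∫ ω, max (|f (X k a.1 a.2 ω)| - M) 0 ∂μ ≤ τ := fun τ hτ => by
    obtain ⟨M, hM0, hM⟩ := exists_integral_max_norm_sub_lt hf hτ
    refine ⟨M, hM0, fun k a => ?_⟩
    have htrunc := integral_fun_comp_of_hasLaw (h.law k a.1 a.2)
      (integrable_max_norm_sub hf hM0).aestronglyMeasurable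
    simp only [Real.norm_eq_abs] at htrunc hM
    exact htrunc.trans_le hM.le
  refine (tendsto_avg_probFilter (μ := μ) hcard (W := fun k a ω => f (X k a.1 a.2 ω))
    (fun k a => integrable_comp_of_hasLaw (h.law k a.1 a.2) hf)
    (fun k a => integral_fun_comp_of_hasLaw (h.law k a.1 a.2) hf.aestronglyMeasurable)
    (fun k a b hab => (h.iIndepFun_comp hf.aemeasurable k).indepFun hab) hui).congr fun a => ?_
  simp [groupAvg, Fintype.sum_prod_type, Fintype.card_prod]

lemma empiricalLaw [IsProbabilityMeasure μ] (h : IsIIDArray μ P n m X)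
    (hn : Tendsto n atTop atTop) (hm : ∀ k, 1 ≤ m k) :
    EmpiricalLaw (probFilter μ) P (fun a => n a.1) (fun a => m a.1)
      (fun a i j => X a.1 i j a.2) where
  n_tendsto := hn.comp tendsto_fst_probFilter
  m_pos a := hm a.1
  ae q hq := eventually_probFilter_of_ae fun k =>
    ae_all_iff.2 fun (i : Fin (n k)) => ae_all_iff.2 fun (j : Fin (m k)) => by
      rw [← (h.law k i j).map_eq] at hq
      exact ae_of_ae_map (h.law k i j).aemeasurable hq
  lln _ hf := h.tendsto_groupAvg_one hn hm hf

lemma memLp_groupSum (h : IsIIDArray μ P n m X) {q : ℝ≥0∞} (hf : MemLp f q P)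
    (k : ℕ) (i : Fin (n k)) : MemLp (fun ω => groupSum (fun i j => X k i j ω) f i) q μ := by
  simp only [groupSum, smul_eq_mul]
  have hlaw : ∀ j ∈ (Finset.univ : Finset (Fin (m k))), MemLp (fun ω => f (X k i j ω)) q μ :=
    fun j _ => memLp_comp_of_hasLaw (h.law k i j) hf
  exact (memLp_finsetSum _ hlaw).const_mul _

lemma indepFun_groupSum (h : IsIIDArray μ P n m X) (hf : AEMeasurable f P) (k : ℕ) :
    Pairwise fun i i' => IndepFun (fun ω => groupSum (fun i j => X k i j ω) f i)
      (fun ω => groupSum (fun i j => X k i j ω) f i') μ := by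
  classical
  intro i i' hi
  set group : Fin (n k) → Finset (Fin (n k) × Fin (m k)) := fun i =>
    Finset.univ.map ⟨Prod.mk i, Prod.mk_right_injective i⟩ with hgroup
  have hdisj : Disjoint (group i) (group i') := by
    simp [hgroup, Finset.disjoint_left, hi.symm]
  have hind := (h.iIndepFun_comp hf k).indepFun_finset₀ (group i) (group i') hdisj
    fun a => aemeasurable_comp_of_hasLaw (h.law k a.1 a.2) hf
  have hgroupSum : ∀ i, (fun ω => groupSum (fun i j => X k i j ω) f i) =
      (fun v : group i → ℝ => (√(m k : ℝ))⁻¹ • ∑ a, v a) ∘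
        (fun ω (a : group i) => f (X k a.1.1 a.1.2 ω)) := fun i => by
    ext ω
    simp only [groupSum, Function.comp_apply]
    rw [Finset.sum_coe_sort (group i) (fun a => f (X k a.1 a.2 ω)), Finset.sum_map]
    rfl
  rw [hgroupSum i, hgroupSum i']
  exact hind.comp (by fun_prop) (by fun_prop)

variable [IsProbabilityMeasure μ]

lemma integral_groupSum_sq (h : IsIIDArray μ P n m X) (hm : ∀ k, 1 ≤ m k)
    (hf : MemLp f 2 P) (hf0 : ∫ y, f y ∂P = 0) (k : ℕ) (i : Fin (n k)) :
    ∫ ω, (groupSum (fun i j => X k i j ω) f i) ^ 2 ∂μ = ∫ y, f y ^ 2 ∂P := by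
  have hsum := integral_sum_sq_eq (h.iIndepFun_group hf.aemeasurable k i)
    (fun j => memLp_comp_of_hasLaw (h.law k i j) hf)
    (fun j => (integral_fun_comp_of_hasLaw (h.law k i j) hf.aestronglyMeasurable).trans hf0)
    (fun j => integral_fun_comp_of_hasLaw (h.law k i j) hf.integrable_sq.aestronglyMeasurable)
    Finset.univ
  have hmk : (m k : ℝ) ≠ 0 := Nat.cast_ne_zero.2 (Nat.one_le_iff_ne_zero.1 (hm k))
  simp only [groupSum, smul_eq_mul, mul_pow, integral_const_mul, hsum, inv_pow,
    Real.sq_sqrt (Nat.cast_nonneg (m k)), Finset.card_univ, Fintype.card_fin]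
  exact inv_mul_cancel_left₀ hmk _

variable [IsProbabilityMeasure P]

lemma integral_abs_groupSum_pow_three_le (h : IsIIDArray μ P n m X)
    (hm : ∀ k, 1 ≤ m k) (hf : MemLp f 3 P) (hf0 : ∫ y, f y ∂P = 0) :
    ∃ C : ℝ, 0 ≤ C ∧ ∀ k i, ∫ ω, |groupSum (fun i j => X k i j ω) f i| ^ 3 ∂μ ≤ C := by
  have hf2 : MemLp f 2 P := hf.mono_exponent (by norm_num)
  refine ⟨3 * √(∫ y, f y ^ 2 ∂P) ^ 3 + ∫ y, |f y| ^ 3 ∂P,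
    add_nonneg (by positivity) (integral_nonneg fun y => by positivity), fun k i => ?_⟩
  have hsum := integral_abs_sum_pow_three_le (h.iIndepFun_group hf.aemeasurable k i)
    (fun j => memLp_comp_of_hasLaw (h.law k i j) hf)
    (fun j => (integral_fun_comp_of_hasLaw (h.law k i j) hf.aestronglyMeasurable).trans hf0)
    (Real.sqrt_nonneg (∫ y, f y ^ 2 ∂P))
    (fun j => (integral_fun_comp_of_hasLaw (h.law k i j)
      hf2.integrable_sq.aestronglyMeasurable).trans
        (Real.sq_sqrt (integral_nonneg fun y => sq_nonneg (f y))).symm)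
    (fun j => (integral_fun_comp_of_hasLaw (h.law k i j)
      (integrable_abs_pow_three hf).aestronglyMeasurable).le) Finset.univ
  have hmk : 0 < √(m k : ℝ) := Real.sqrt_pos.2 (Nat.cast_pos.2 (hm k))
  simp only [groupSum, smul_eq_mul, abs_mul, mul_pow, integral_const_mul, abs_inv, abs_of_pos hmk,
    inv_pow]
  rw [inv_mul_le_iff₀ (by positivity), mul_comm]
  simpa only [Finset.card_univ, Fintype.card_fin] using hsum

lemma tendsto_avg_groupSum_sq (h : IsIIDArray μ P n m X)
    (hn : Tendsto n atTop atTop) (hm : ∀ k, 1 ≤ m k) (hf : MemLp f 3 P) (hf0 : ∫ y, f y ∂P = 0) :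
    Tendsto (fun a : ℕ × Ω => (n a.1 : ℝ)⁻¹ *
      ∑ i, (groupSum (fun i j => X a.1 i j a.2) f i) ^ 2) (probFilter μ) (𝓝 (∫ y, f y ^ 2 ∂P)) := by
  have hf2 : MemLp f 2 P := hf.mono_exponent (by norm_num)
  obtain ⟨C, hC0, hC⟩ := h.integral_abs_groupSum_pow_three_le hm hf hf0
  have hui : ∀ τ > 0, ∃ M ≥ (0 : ℝ), ∀ k (i : Fin (n k)),
      ∫ ω, max (|groupSum (fun i j => X k i j ω) f i ^ 2| - M) 0 ∂μ ≤ τ := fun τ hτ => by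
    have hM : 0 < ((C + 1) / τ) ^ 2 := by positivity
    refine ⟨((C + 1) / τ) ^ 2, hM.le, fun k i => ?_⟩
    calc ∫ ω, max (|groupSum (fun i j => X k i j ω) f i ^ 2| - ((C + 1) / τ) ^ 2) 0 ∂μ
        ≤ ∫ ω, |groupSum (fun i j => X k i j ω) f i| ^ 3 / √(((C + 1) / τ) ^ 2) ∂μ :=
          integral_mono_of_nonneg (ae_of_all _ fun ω => le_max_right _ _)
            ((integrable_abs_pow_three (h.memLp_groupSum hf k i)).div_const _)
            (ae_of_all _ fun ω => max_sq_sub_le hM)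
      _ ≤ C / ((C + 1) / τ) := by
          rw [integral_div, Real.sqrt_sq (by positivity)]
          gcongr
          exact hC k i
      _ ≤ τ := by
          rw [div_le_iff₀ (by positivity), mul_div_cancel₀ _ hτ.ne']
          linarith
  simpa only [Fintype.card_fin] using tendsto_avg_probFilter (μ := μ) (ι := fun k => Fin (n k))
    (by simpa only [Fintype.card_fin] using hn)
    (fun k i => (h.memLp_groupSum hf2 k i).integrable_sq)
    (fun k i => h.integral_groupSum_sq hm hf2 hf0 k i)
    (fun k i i' hi => (h.indepFun_groupSum hf.aemeasurable k hi).comp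
      (φ := fun t => t ^ 2) (ψ := fun t => t ^ 2) (by fun_prop) (by fun_prop)) hui

lemma tendsto_sum_abs_groupSum_pow_three (h : IsIIDArray μ P n m X)
    (hn : Tendsto n atTop atTop) (hm : ∀ k, 1 ≤ m k) (hf : MemLp f 3 P) (hf0 : ∫ y, f y ∂P = 0) :
    Tendsto (fun a : ℕ × Ω => (√(n a.1 : ℝ) ^ 3)⁻¹ *
      ∑ i, |groupSum (fun i j => X a.1 i j a.2) f i| ^ 3) (probFilter μ) (𝓝 0) := by
  obtain ⟨C, -, hC⟩ := h.integral_abs_groupSum_pow_three_le hm hf hf0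
  have hint : ∀ k i, Integrable (fun ω => |groupSum (fun i j => X k i j ω) f i| ^ 3) μ :=
    fun k i => integrable_abs_pow_three (h.memLp_groupSum hf k i)
  have hlim : Tendsto (fun k => C / √(n k : ℝ)) atTop (𝓝 0) :=
    tendsto_const_nhds.div_atTop (Real.tendsto_sqrt_atTop.comp
      (tendsto_natCast_atTop_atTop.comp hn))
  refine tendsto_probFilter_of_integral
    (fun k => (integrable_finsetSum Finset.univ fun i _ => hint k i).const_mul (√(n k : ℝ) ^ 3)⁻¹)
    (squeeze_zero' (Eventually.of_forall fun k => integral_nonneg fun ω => abs_nonneg _) ?_ hlim)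
  filter_upwards [hn.eventually_gt_atTop 0] with k hk
  have hsqrt : 0 < √(n k : ℝ) := Real.sqrt_pos.2 (Nat.cast_pos.2 hk)
  calc ∫ ω, |(√(n k : ℝ) ^ 3)⁻¹ * ∑ i, |groupSum (fun i j => X k i j ω) f i| ^ 3| ∂μ
      = (√(n k : ℝ) ^ 3)⁻¹ * ∑ i, ∫ ω, |groupSum (fun i j => X k i j ω) f i| ^ 3 ∂μ := by
        rw [← integral_finsetSum _ fun i _ => hint k i, ← integral_const_mul]
        exact integral_congr_ae (ae_of_all _ fun ω => abs_of_nonneg (by positivity))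
    _ ≤ (√(n k : ℝ) ^ 3)⁻¹ * (√(n k : ℝ) ^ 2 * C) := by
        rw [Real.sq_sqrt (Nat.cast_nonneg _)]
        gcongr
        simpa using Finset.sum_le_card_nsmul Finset.univ _ _ fun i _ => hC k i
    _ = C / √(n k : ℝ) := by field_simp [hsqrt.ne']

lemma eventually_abs_groupSum_le (h : IsIIDArray μ P n m X)
    (hn : Tendsto n atTop atTop) (hm : ∀ k, 1 ≤ m k) (hf : MemLp f 3 P) (hf0 : ∫ y, f y ∂P = 0)
    {δ : ℝ} (hδ : 0 < δ) :
    ∀ᶠ a in probFilter μ, ∀ i, |groupSum (fun i j => X a.1 i j a.2) f i| ≤ δ * √(n a.1 : ℝ) := by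
  filter_upwards [(h.tendsto_sum_abs_groupSum_pow_three hn hm hf hf0).eventually
      (gt_mem_nhds (pow_pos hδ 3)),
    tendsto_fst_probFilter.eventually (hn.eventually_gt_atTop 0)] with a hsum hpos i
  have hsqrt : 0 < √(n a.1 : ℝ) := Real.sqrt_pos.2 (Nat.cast_pos.2 hpos)
  rw [inv_mul_lt_iff₀ (by positivity)] at hsum
  refine le_of_pow_le_pow_left₀ three_ne_zero (by positivity) ?_
  calc |groupSum (fun i j => X a.1 i j a.2) f i| ^ 3
      ≤ ∑ i, |groupSum (fun i j => X a.1 i j a.2) f i| ^ 3 :=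
        Finset.single_le_sum (f := fun i => |groupSum (fun i j => X a.1 i j a.2) f i| ^ 3)
          (fun _ _ => by positivity) (Finset.mem_univ i)
    _ ≤ √(n a.1 : ℝ) ^ 3 * δ ^ 3 := hsum.le
    _ = (δ * √(n a.1 : ℝ)) ^ 3 := by ring

end IsIIDArray

section InnerProductSpace

variable {E ι : Type*} [NormedAddCommGroup E] [InnerProductSpace ℝ E]

omit [MeasurableSpace D] in
lemma inner_groupSum {N M : ℕ} (x : Fin N → Fin M → D) (ξ : D → E) (u : E) (i : Fin N) :
    ⟪u, groupSum x ξ i⟫ = groupSum x (fun y => ⟪u, ξ y⟫) i := by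
  simp only [groupSum, inner_smul_right, inner_sum, smul_eq_mul]

lemma inner_secondMoment_comm {N : ℕ} (z : Fin N → E) (u v : E) :
    ⟪secondMoment z u, v⟫ = ⟪u, secondMoment z v⟫ := by
  simp only [secondMoment_apply, real_inner_smul_right, inner_sum, real_inner_comm, mul_comm]

lemma norm_le_sum_abs_inner [Fintype ι] (b : OrthonormalBasis ι ℝ E) (v : E) :
    ‖v‖ ≤ ∑ j, |⟪b j, v⟫| := by
  conv_lhs => rw [← b.sum_repr' v]
  refine (norm_sum_le _ _).trans_eq (Finset.sum_congr rfl fun j _ => ?_)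
  rw [norm_smul, b.norm_eq_one, mul_one, Real.norm_eq_abs]

lemma sum_inner_smul_rankOne [Fintype ι] (b : OrthonormalBasis ι ℝ E) (T : E →L[ℝ] E) :
    ∑ i, ∑ j, ⟪T (b i), b j⟫ • InnerProductSpace.rankOne ℝ (b j) (b i) = T := by
  ext v
  conv_rhs => rw [← b.sum_repr' v, map_sum]
  simp only [sum_apply, smul_apply, InnerProductSpace.rankOne_apply, map_smul]
  refine Finset.sum_congr rfl fun i _ => ?_
  conv_rhs => rw [← b.sum_repr' (T (b i)), Finset.smul_sum]
  exact Finset.sum_congr rfl fun j _ => by rw [smul_comm, real_inner_comm (T (b i))]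

lemma inner_eq_polarization {T : E →L[ℝ] E} (hT : ∀ u v, ⟪T u, v⟫ = ⟪u, T v⟫) (u v : E) :
    ⟪T u, v⟫ = (⟪T (u + v), u + v⟫ - ⟪T u, u⟫ - ⟪T v, v⟫) / 2 := by
  have hvu : ⟪T v, u⟫ = ⟪T u, v⟫ := by rw [hT, real_inner_comm]
  simp only [map_add, inner_add_left, inner_add_right, hvu]
  ring

lemma tendsto_of_tendsto_inner_self [FiniteDimensional ℝ E] {α : Type*} {l : Filter α}
    {T : α → E →L[ℝ] E} {V : E →L[ℝ] E} (hT : ∀ a u v, ⟪T a u, v⟫ = ⟪u, T a v⟫)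
    (hV : ∀ u v, ⟪V u, v⟫ = ⟪u, V v⟫)
    (h : ∀ u, Tendsto (fun a => ⟪T a u, u⟫) l (𝓝 ⟪V u, u⟫)) : Tendsto T l (𝓝 V) := by
  have hentry : ∀ u v, Tendsto (fun a => ⟪T a u, v⟫) l (𝓝 ⟪V u, v⟫) := fun u v => by
    simp only [fun a => inner_eq_polarization (hT a) u v, inner_eq_polarization hV u v]
    exact (((h _).sub (h _)).sub (h _)).div_const 2
  simpa only [sum_inner_smul_rankOne] using
    tendsto_finsetSum Finset.univ fun i _ => tendsto_finsetSum Finset.univ fun j _ =>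
      (hentry (stdOrthonormalBasis ℝ E i) (stdOrthonormalBasis ℝ E j)).smul_const
        (InnerProductSpace.rankOne ℝ (stdOrthonormalBasis ℝ E j) (stdOrthonormalBasis ℝ E i))

variable {ξ : D → E}

lemma integrable_rankOne_self (hξ : MemLp ξ 2 P) :
    Integrable (fun y => InnerProductSpace.rankOne ℝ (ξ y) (ξ y)) P := by
  have hcont : Continuous fun v : E => InnerProductSpace.rankOne ℝ v v :=
    (InnerProductSpace.rankOne ℝ).continuous.clm_apply continuous_id
  refine (hξ.integrable_norm_pow two_ne_zero).mono'
    (hcont.comp_aestronglyMeasurable hξ.aestronglyMeasurable) (ae_of_all _ fun y => ?_)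
  rw [InnerProductSpace.norm_rankOne, ← sq]

lemma inner_integral_rankOne_self [CompleteSpace E] (hξ : MemLp ξ 2 P) (u v : E) :
    ⟪(∫ y, InnerProductSpace.rankOne ℝ (ξ y) (ξ y) ∂P) u, v⟫ =
      ∫ y, ⟪u, ξ y⟫ * ⟪v, ξ y⟫ ∂P := by
  rw [ContinuousLinearMap.integral_apply (integrable_rankOne_self hξ), real_inner_comm,
    ← integral_inner ((integrable_rankOne_self hξ).apply_continuousLinearMap u)]
  simp only [InnerProductSpace.rankOne_apply, inner_smul_right, real_inner_comm]

lemma inner_integral_rankOne_self_comm [CompleteSpace E] (hξ : MemLp ξ 2 P) (u v : E) :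
    ⟪(∫ y, InnerProductSpace.rankOne ℝ (ξ y) (ξ y) ∂P) u, v⟫ =
      ⟪u, (∫ y, InnerProductSpace.rankOne ℝ (ξ y) (ξ y) ∂P) v⟫ := by
  rw [real_inner_comm _ u, inner_integral_rankOne_self hξ, inner_integral_rankOne_self hξ]
  simp only [mul_comm]

variable [IsProbabilityMeasure μ] [IsProbabilityMeasure P] [FiniteDimensional ℝ E]

namespace IsIIDArray

lemma tendsto_secondMoment_groupSum (h : IsIIDArray μ P n m X) (hn : Tendsto n atTop atTop)
    (hm : ∀ k, 1 ≤ m k) (hξ : MemLp ξ 3 P) (hξ0 : ∫ y, ξ y ∂P = 0) :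
    Tendsto (fun a : ℕ × Ω => secondMoment (groupSum (fun i j => X a.1 i j a.2) ξ)) (probFilter μ)
      (𝓝 (∫ y, InnerProductSpace.rankOne ℝ (ξ y) (ξ y) ∂P)) := by
  have : CompleteSpace E := FiniteDimensional.complete ℝ E
  have hξ2 : MemLp ξ 2 P := hξ.mono_exponent (by norm_num)
  refine tendsto_of_tendsto_inner_self (fun a u v => inner_secondMoment_comm _ u v)
    (inner_integral_rankOne_self_comm hξ2) fun u => ?_
  have hu0 : ∫ y, ⟪u, ξ y⟫ ∂P = 0 := by
    rw [integral_inner (hξ2.integrable one_le_two), hξ0, inner_zero_right]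
  simp only [inner_secondMoment_self, inner_groupSum, inner_integral_rankOne_self hξ2, ← sq]
  exact h.tendsto_avg_groupSum_sq hn hm (hξ.const_inner u) hu0

lemma eventually_norm_groupSum_le (h : IsIIDArray μ P n m X) (hn : Tendsto n atTop atTop)
    (hm : ∀ k, 1 ≤ m k) (hξ : MemLp ξ 3 P) (hξ0 : ∫ y, ξ y ∂P = 0) {δ : ℝ} (hδ : 0 < δ) :
    ∀ᶠ a in probFilter μ, ∀ i, ‖groupSum (fun i j => X a.1 i j a.2) ξ i‖ ≤ δ * √(n a.1 : ℝ) := by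
  have : CompleteSpace E := FiniteDimensional.complete ℝ E
  set b := stdOrthonormalBasis ℝ E
  set d : ℝ := (Module.finrank ℝ E : ℝ)
  have hcoord : ∀ᶠ a in probFilter μ, ∀ j i,
      |groupSum (fun i j => X a.1 i j a.2) (fun y => ⟪b j, ξ y⟫) i| ≤
        δ / (d + 1) * √(n a.1 : ℝ) := by
    refine eventually_all.2 fun j =>
      h.eventually_abs_groupSum_le hn hm (hξ.const_inner _) ?_ (by positivity)
    rw [integral_inner (hξ.integrable (by norm_num)), hξ0, inner_zero_right]
  filter_upwards [hcoord] with a ha i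
  calc ‖groupSum (fun i j => X a.1 i j a.2) ξ i‖
      ≤ ∑ j, |⟪b j, groupSum (fun i j => X a.1 i j a.2) ξ i⟫| := norm_le_sum_abs_inner b _
    _ ≤ ∑ _j : Fin (Module.finrank ℝ E), δ / (d + 1) * √(n a.1 : ℝ) :=
        Finset.sum_le_sum fun j _ => by rw [inner_groupSum]; exact ha j i
    _ = d / (d + 1) * (δ * √(n a.1 : ℝ)) := by
        rw [Finset.sum_const, Finset.card_univ, Fintype.card_fin, nsmul_eq_mul]
        ring
    _ ≤ δ * √(n a.1 : ℝ) :=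
        mul_le_of_le_one_left (by positivity) (div_le_one_of_le₀ (by simp) (by positivity))

lemma regularGroups (h : IsIIDArray μ P n m X) (hn : Tendsto n atTop atTop) (hm : ∀ k, 1 ≤ m k)
    (hξ : MemLp ξ 3 P) (hξ0 : ∫ y, ξ y ∂P = 0) :
    RegularGroups (probFilter μ) P ξ (fun a => n a.1) (fun a => m a.1)
      (fun a i j => X a.1 i j a.2) where
  second := h.tendsto_secondMoment_groupSum hn hm hξ hξ0
  max_le _ hδ := h.eventually_norm_groupSum_le hn hm hξ hξ0 hδ

end IsIIDArray

end InnerProductSpace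

end IIDArray

/-! ### The chi-square law -/

section ChiSquare

section MeasureReal

variable {ν : Measure ℝ} {t : ℝ}

lemma tendsto_measure_Iic_nhds [IsFiniteMeasure ν] (ht : ν {t} = 0) :
    Tendsto (fun s => ν (Set.Iic s)) (𝓝 t) (𝓝 (ν (Set.Iic t))) := by
  refine tendsto_measure_of_ae_tendsto_indicator_of_isFiniteMeasure _ measurableSet_Iic
    (fun s => measurableSet_Iic) ?_
  filter_upwards [measure_eq_zero_iff_ae_notMem.1 ht] with x hx
  rcases lt_or_gt_of_ne hx with h | h
  · filter_upwards [lt_mem_nhds h] with s hs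
    exact iff_of_true hs.le h.le
  · filter_upwards [gt_mem_nhds h] with s hs
    exact iff_of_false (not_le.2 hs) (not_le.2 h)

lemma tendsto_measure_Ioi_nhds [IsProbabilityMeasure ν] (ht : ν {t} = 0) :
    Tendsto (fun s => ν (Set.Ioi s)) (𝓝 t) (𝓝 (ν (Set.Ioi t))) := by
  simp only [← Set.compl_Iic, prob_compl_eq_one_sub measurableSet_Iic]
  exact ENNReal.Tendsto.sub tendsto_const_nhds (tendsto_measure_Iic_nhds ht)
    (Or.inl ENNReal.one_ne_top)

end MeasureReal

lemma finite_setOf_sq_add_eq (c t : ℝ) : {x : ℝ | x ^ 2 + c = t}.Finite := by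
  refine (Set.toFinite {√(t - c), -√(t - c)}).subset fun x hx => ?_
  have hx : x ^ 2 = t - c := eq_sub_iff_add_eq.2 hx
  exact (abs_eq (Real.sqrt_nonneg _)).1 (by rw [← hx, Real.sqrt_sq_eq_abs])

variable {p : ℕ}

instance isProbabilityMeasure_chiSquare (p : ℕ) : IsProbabilityMeasure (chiSquare p) :=
  Measure.isProbabilityMeasure_map (Measurable.aemeasurable (by fun_prop))

lemma chiSquare_singleton (hp : 1 ≤ p) (t : ℝ) : chiSquare p {t} = 0 := by
  obtain ⟨q, rfl⟩ := Nat.exists_eq_add_of_le' hp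
  rw [chiSquare, Measure.map_apply (by fun_prop) (measurableSet_singleton t)]
  set S : Set (ℝ × (Fin q → ℝ)) := {z | z.1 ^ 2 + ∑ i, z.2 i ^ 2 = t} with hS
  have hS_meas : MeasurableSet S := measurableSet_eq_fun (by fun_prop) measurable_const
  have hpreimage : (fun z : Fin (q + 1) → ℝ => ∑ i, z i ^ 2) ⁻¹' {t} =
      (MeasurableEquiv.piFinSuccAbove (fun _ : Fin (q + 1) => ℝ) 0) ⁻¹' S := by
    ext z
    simp [hS, Fin.sum_univ_succ, MeasurableEquiv.piFinSuccAbove, Fin.tail]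
  rw [hpreimage, (measurePreserving_piFinSuccAbove (fun _ : Fin (q + 1) => gaussianReal 0 1)
    0).measure_preimage hS_meas.nullMeasurableSet, Measure.prod_apply_symm hS_meas]
  have : NullSingletonClass (gaussianReal 0 1) := nullSingletonClass_gaussianReal one_ne_zero
  exact (lintegral_eq_zero_iff (measurable_measure_prodMk_right hS_meas)).2 <|
    ae_of_all _ fun y => (finite_setOf_sq_add_eq (∑ i, y i ^ 2) t).measure_zero (gaussianReal 0 1)

lemma stdGaussian_norm_sq_preimage {s : Set ℝ} (hs : MeasurableSet s) :
    stdGaussian (Vec p) ((fun v => ‖v‖ ^ 2) ⁻¹' s) = chiSquare p s := by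
  rw [chiSquare, ← map_pi_eq_stdGaussian,
    Measure.map_apply (by fun_prop) (hs.preimage (by fun_prop)), Measure.map_apply (by fun_prop) hs]
  congr 1
  ext z
  simp [EuclideanSpace.norm_sq_eq]

lemma tendsto_chiSquare_Iic (hp : 1 ≤ p) (t : ℝ) :
    Tendsto (fun s => chiSquare p (Set.Iic s)) (𝓝 t) (𝓝 (chiSquare p (Set.Iic t))) :=
  tendsto_measure_Iic_nhds (chiSquare_singleton hp t)

lemma tendsto_chiSquare_Ioi (hp : 1 ≤ p) (t : ℝ) :
    Tendsto (fun s => chiSquare p (Set.Ioi s)) (𝓝 t) (𝓝 (chiSquare p (Set.Ioi t))) :=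
  tendsto_measure_Ioi_nhds (chiSquare_singleton hp t)

end ChiSquare

/-! ### The central limit theorem for the contrast -/

section CentralLimit

open scoped RealInnerProductSpace

variable {Ω D : Type*} [MeasurableSpace Ω] [MeasurableSpace D] {μ : Measure Ω} {P Q : Measure D}

lemma map_eq_dirac_of_integral_sq_eq_zero [IsProbabilityMeasure P] {f : D → ℝ} (hf : MemLp f 2 P)
    (h : ∫ y, f y ^ 2 ∂P = 0) : P.map f = Measure.dirac 0 := by
  have hf0 : f =ᵐ[P] fun _ => 0 := by
    filter_upwards [(integral_eq_zero_iff_of_nonneg (fun y => sq_nonneg (f y))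
      hf.integrable_sq).1 h] with y hy
    exact pow_eq_zero_iff two_ne_zero |>.1 hy
  rw [Measure.map_congr hf0, Measure.map_const, measure_univ, one_smul]

lemma tendsto_charFun_map_pow [IsProbabilityMeasure P] {f : D → ℝ} (hf : MemLp f 2 P)
    (hf0 : ∫ y, f y ∂P = 0) :
    Tendsto (fun N : ℕ => charFun (P.map f) (√(N : ℝ))⁻¹ ^ N) atTop
      (𝓝 (Complex.exp (-((∫ y, f y ^ 2 ∂P : ℝ) : ℂ) / 2))) := by
  set v := ∫ y, f y ^ 2 ∂P with hv
  have hv0 : 0 ≤ v := integral_nonneg fun y => sq_nonneg _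
  rcases hv0.eq_or_lt with hv_zero | hv_pos
  · rw [map_eq_dirac_of_integral_sq_eq_zero hf hv_zero.symm, ← hv_zero]
    simp
  · have hstd := tendsto_charFun_inv_sqrt_mul_pow (P := P) (X := fun y => (√v)⁻¹ * f y)
      (hf.aemeasurable.const_mul _) (by rw [integral_const_mul, hf0, mul_zero])
      (by
        simp only [Pi.pow_apply, mul_pow, inv_pow, Real.sq_sqrt hv0, integral_const_mul]
        rw [← hv, inv_mul_cancel₀ hv_pos.ne']) √v
    rw [← Complex.ofReal_pow, Real.sq_sqrt hv0] at hstd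
    refine hstd.congr fun N => ?_
    rw [charFun_map_mul_comp hf.aemeasurable]
    congr 2
    field_simp

lemma charFun_map_const_mul_of_hasLaw {Z : Ω → D} (hZ : HasLaw Z P μ) {f : D → ℝ}
    (hf : AEMeasurable f P) (r : ℝ) :
    charFun (μ.map fun ω => r * f (Z ω)) 1 = charFun (P.map f) r := by
  rw [charFun_map_mul_comp (aemeasurable_comp_of_hasLaw hZ hf), mul_one, ← hZ.map_eq,
    AEMeasurable.map_map_of_aemeasurable (hZ.map_eq ▸ hf) hZ.aemeasurable]
  rfl

lemma charFun_map_sum_add_sum [IsProbabilityMeasure μ] {ι κ : Type*} [Fintype ι] [Fintype κ]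
    {X : ι → Ω → D} {Y : κ → Ω → D} (hX : ∀ a, HasLaw (X a) P μ)
    (hY : ∀ b, HasLaw (Y b) Q μ) (hind : iIndepFun (Sum.elim X Y) μ) {f h : D → ℝ}
    (hf : Measurable f) (hh : Measurable h) (r s : ℝ) :
    charFun (μ.map fun ω => r * ∑ a, f (X a ω) + s * ∑ b, h (Y b ω)) 1 =
      charFun (P.map f) r ^ Fintype.card ι * charFun (Q.map h) s ^ Fintype.card κ := by
  set Z : ι ⊕ κ → Ω → ℝ := Sum.elim (fun a ω => r * f (X a ω)) (fun b ω => s * h (Y b ω)) with hZ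
  have hZ_indep : iIndepFun Z μ := by
    convert! hind.comp (Sum.elim (fun _ y => r * f y) (fun _ y => s * h y))
      (by rintro (a | b) <;> simp only [Sum.elim_inl, Sum.elim_inr] <;> fun_prop) using 1
    ext c ω
    rcases c with a | b <;> rfl
  have hZ_meas : ∀ c, AEMeasurable (Z c) μ := by
    rintro (a | b)
    · exact (hf.comp_aemeasurable (hX a).aemeasurable).const_mul r
    · exact (hh.comp_aemeasurable (hY b).aemeasurable).const_mul s
  have hZ_sum : (fun ω => r * ∑ a, f (X a ω) + s * ∑ b, h (Y b ω)) = fun ω => ∑ c, Z c ω := by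
    ext ω
    simp [hZ, Fintype.sum_sum_type, Finset.mul_sum]
  rw [hZ_sum, hZ_indep.charFun_map_fun_sum_eq_prod hZ_meas]
  simp [Finset.prod_apply, Fintype.prod_sum_type, hZ,
    charFun_map_const_mul_of_hasLaw (hX _) hf.aemeasurable,
    charFun_map_const_mul_of_hasLaw (hY _) hh.aemeasurable]

lemma charFun_map_eq_charFun_inner {E : Type*} [NormedAddCommGroup E] [InnerProductSpace ℝ E]
    [MeasurableSpace E] [BorelSpace E] [SecondCountableTopology E] {Z : Ω → E}
    (hZ : AEMeasurable Z μ) (t : E) :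
    charFun (μ.map Z) t = charFun (μ.map fun ω => ⟪t, Z ω⟫) 1 := by
  have hinner : AEMeasurable (fun ω => ⟪t, Z ω⟫) μ := by fun_prop
  rw [charFun_apply, charFun_apply, integral_map hZ (by fun_prop),
    integral_map hinner (by fun_prop)]
  simp [real_inner_comm]

variable {d p : ℕ} {g : Vec d → Vec p → Vec p} {θ : Vec p}

lemma inner_normSum {n m : ℕ} (g : Vec d → Vec p → Vec p) (θ u : Vec p)
    (x : Fin n → Fin m → Vec d) :
    ⟪u, normSum g θ x⟫ = (√((n * m : ℕ) : ℝ))⁻¹ * ∑ a : Fin n × Fin m, ⟪u, g (x a.1 a.2) θ⟫ := by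
  rw [normSum_eq, inner_smul_right, inner_sum]
  simp only [groupSum, inner_smul_right, inner_sum, ← Finset.mul_sum, Fintype.sum_prod_type]
  rw [Nat.cast_mul, Real.sqrt_mul (Nat.cast_nonneg n), mul_inv, mul_assoc]

lemma aemeasurable_normSum {n m : ℕ} (hg : Measurable fun y => g y θ)
    {X : Fin n → Fin m → Ω → Vec d} (hX : ∀ i k, AEMeasurable (X i k) μ) :
    AEMeasurable (fun ω => normSum g θ fun i k => X i k ω) μ := by
  simp only [normSum_eq, groupSum]
  apply AEMeasurable.fun_const_smul
  refine Finset.aemeasurable_fun_sum _ fun i _ => ?_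
  apply AEMeasurable.fun_const_smul
  exact Finset.aemeasurable_fun_sum _ fun k _ => hg.comp_aemeasurable (hX i k)

variable {n₁ n₂ m : ℕ → ℕ} {PX PY : Measure (Vec d)}
  {X : (k : ℕ) → Fin (n₁ k) → Fin (m k) → Ω → Vec d}
  {Y : (k : ℕ) → Fin (n₂ k) → Fin (m k) → Ω → Vec d} {θx θy : Vec p} {A M : Vec p →L[ℝ] Vec p}

lemma aemeasurable_contrast {N₁ N₂ K : ℕ} (hgx : Measurable fun y => g y θx)
    (hgy : Measurable fun y => g y θy) {X : Fin N₁ → Fin K → Ω → Vec d}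
    {Y : Fin N₂ → Fin K → Ω → Vec d} (h : IsTwoSample μ PX PY X Y) (A : Vec p →L[ℝ] Vec p) :
    AEMeasurable (fun ω => contrast g θx θy A (fun i j => X i j ω) (fun i j => Y i j ω)) μ :=
  (aemeasurable_normSum hgx fun i j => (h.law_X i j).aemeasurable).sub
    (A.continuous.measurable.comp_aemeasurable
      (aemeasurable_normSum hgy fun i j => (h.law_Y i j).aemeasurable))

lemma inner_add_inner_neg_adjoint_eq_norm_sq {S T : Vec p →L[ℝ] Vec p}
    (hM : ∀ v, (S + A ∘L T ∘L A.adjoint) (M.adjoint (M v)) = v) (t : Vec p) :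
    ⟪S (M.adjoint t), M.adjoint t⟫ +
      ⟪T (-A.adjoint (M.adjoint t)), -A.adjoint (M.adjoint t)⟫ = ‖t‖ ^ 2 := by
  have hM_inj : Function.Injective (M : Vec p →ₗ[ℝ] Vec p) := fun u v h => by
    rw [← hM u, ← hM v]
    exact congrArg (fun w => (S + A ∘L T ∘L A.adjoint) (M.adjoint w)) h
  obtain ⟨v, rfl⟩ := LinearMap.injective_iff_surjective.1 hM_inj t
  exact inner_add_inner_neg_adjoint_eq hM v

variable [IsProbabilityMeasure μ] [IsProbabilityMeasure PX] [IsProbabilityMeasure PY]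

lemma tendsto_charFun_normSum_add (hXY : ∀ k, IsTwoSample μ PX PY (X k) (Y k))
    (hm : ∀ k, 1 ≤ m k) (hn₁ : Tendsto n₁ atTop atTop) (hn₂ : Tendsto n₂ atTop atTop)
    (hgx : Measurable fun y => g y θx) (hgy : Measurable fun y => g y θy)
    (hgX : MemLp (fun y => g y θx) 2 PX) (hgY : MemLp (fun y => g y θy) 2 PY)
    (hX0 : ∫ y, g y θx ∂PX = 0) (hY0 : ∫ y, g y θy ∂PY = 0) (u v : Vec p) :
    Tendsto (fun k => charFun (μ.map fun ω => ⟪u, normSum g θx fun i j => X k i j ω⟫ +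
      ⟪v, normSum g θy fun i j => Y k i j ω⟫) 1) atTop
      (𝓝 (Complex.exp (-((⟪momentOp g PX θx u, u⟫ + ⟪momentOp g PY θy v, v⟫ : ℝ) : ℂ) / 2))) := by
  have hN : ∀ {n : ℕ → ℕ}, Tendsto n atTop atTop → Tendsto (fun k => n k * m k) atTop atTop :=
    fun hn => tendsto_atTop_mono (fun k => Nat.le_mul_of_pos_right _ (hm k)) hn
  have hlimX := (tendsto_charFun_map_pow (hgX.const_inner u)
    (by rw [integral_inner (hgX.integrable one_le_two), hX0, inner_zero_right])).comp (hN hn₁)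
  have hlimY := (tendsto_charFun_map_pow (hgY.const_inner v)
    (by rw [integral_inner (hgY.integrable one_le_two), hY0, inner_zero_right])).comp (hN hn₂)
  have hlim := hlimX.mul hlimY
  rw [← Complex.exp_add] at hlim
  rw [momentOp, momentOp, inner_integral_rankOne_self hgX, inner_integral_rankOne_self hgY]
  convert! hlim using 2 with k
  · have hprod := charFun_map_sum_add_sum
      (fun a : Fin (n₁ k) × Fin (m k) => (hXY k).law_X a.1 a.2)
      (fun a : Fin (n₂ k) × Fin (m k) => (hXY k).law_Y a.1 a.2) (hXY k).indep
      (measurable_const.inner hgx : Measurable fun y => ⟪u, g y θx⟫)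
      (measurable_const.inner hgy : Measurable fun y => ⟪v, g y θy⟫)
      (√((n₁ k * m k : ℕ) : ℝ))⁻¹ (√((n₂ k * m k : ℕ) : ℝ))⁻¹
    simp only [inner_normSum]
    simpa only [Fintype.card_prod, Fintype.card_fin, Function.comp_apply] using hprod
  · simp only [← sq]
    push_cast
    ring_nf

lemma tendsto_charFun_contrast (hXY : ∀ k, IsTwoSample μ PX PY (X k) (Y k))
    (hm : ∀ k, 1 ≤ m k) (hn₁ : Tendsto n₁ atTop atTop) (hn₂ : Tendsto n₂ atTop atTop)
    (hgx : Measurable fun y => g y θx) (hgy : Measurable fun y => g y θy)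
    (hgX : MemLp (fun y => g y θx) 2 PX) (hgY : MemLp (fun y => g y θy) 2 PY)
    (hX0 : ∫ y, g y θx ∂PX = 0) (hY0 : ∫ y, g y θy ∂PY = 0)
    (hM : ∀ v, contrastCov g PX PY θx θy A (M.adjoint (M v)) = v) (t : Vec p) :
    Tendsto (fun k => charFun (μ.map fun ω =>
        M (contrast g θx θy A (fun i j => X k i j ω) (fun i j => Y k i j ω))) t) atTop
      (𝓝 (charFun (stdGaussian (Vec p)) t)) := by
  have hlim := tendsto_charFun_normSum_add hXY hm hn₁ hn₂ hgx hgy hgX hgY hX0 hY0 (M.adjoint t)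
    (-A.adjoint (M.adjoint t))
  rw [inner_add_inner_neg_adjoint_eq_norm_sq hM] at hlim
  rw [charFun_stdGaussian]
  convert! hlim using 3 with k
  · rw [charFun_map_eq_charFun_inner (Z := fun ω => M (contrast _ _ _ _ _ _))
      (M.continuous.measurable.comp_aemeasurable (aemeasurable_contrast hgx hgy (hXY k) A))]
    congr 2
    ext ω
    simp only [contrast, map_sub, inner_sub_right, inner_neg_left,
      ContinuousLinearMap.adjoint_inner_left]
    ring
  · push_cast
    rfl

lemma tendsto_measure_norm_contrast_sq_le (hXY : ∀ k, IsTwoSample μ PX PY (X k) (Y k))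
    (hm : ∀ k, 1 ≤ m k) (hn₁ : Tendsto n₁ atTop atTop) (hn₂ : Tendsto n₂ atTop atTop)
    (hgx : Measurable fun y => g y θx) (hgy : Measurable fun y => g y θy)
    (hgX : MemLp (fun y => g y θx) 2 PX) (hgY : MemLp (fun y => g y θy) 2 PY)
    (hX0 : ∫ y, g y θx ∂PX = 0) (hY0 : ∫ y, g y θy ∂PY = 0)
    (hM : ∀ v, contrastCov g PX PY θx θy A (M.adjoint (M v)) = v) (hp : 1 ≤ p) (t : ℝ) :
    Tendsto (fun k => μ {ω | ‖M (contrast g θx θy A (fun i j => X k i j ω)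
      (fun i j => Y k i j ω))‖ ^ 2 ≤ t}) atTop (𝓝 (chiSquare p (Set.Iic t))) := by
  set Z : ℕ → Ω → Vec p := fun k ω =>
    M (contrast g θx θy A (fun i j => X k i j ω) (fun i j => Y k i j ω))
  have hZ_meas : ∀ k, AEMeasurable (Z k) μ := fun k =>
    M.continuous.measurable.comp_aemeasurable (aemeasurable_contrast hgx hgy (hXY k) A)
  set law : ℕ → ProbabilityMeasure (Vec p) := fun k =>
    ⟨μ.map (Z k), Measure.isProbabilityMeasure_map (hZ_meas k)⟩
  have hlaw : Tendsto law atTop (𝓝 ⟨stdGaussian (Vec p), inferInstance⟩) :=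
    ProbabilityMeasure.tendsto_of_tendsto_charFun <|
      tendsto_charFun_contrast hXY hm hn₁ hn₂ hgx hgy hgX hgY hX0 hY0 hM
  have hfrontier : stdGaussian (Vec p) (frontier {v | ‖v‖ ^ 2 ≤ t}) = 0 :=
    measure_mono_null (frontier_le_subset_eq (by fun_prop) continuous_const) <|
      (stdGaussian_norm_sq_preimage (measurableSet_singleton t)).trans (chiSquare_singleton hp t)
  have hlim := ProbabilityMeasure.tendsto_measure_of_null_frontier_of_tendsto' hlaw hfrontier
  rw [← stdGaussian_norm_sq_preimage measurableSet_Iic]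
  exact hlim.congr fun k => Measure.map_apply_of_aemeasurable (hZ_meas k)
    (measurableSet_le (by fun_prop) measurable_const)

end CentralLimit

/-! ### Tightness of the normalized sums -/

section Tightness

open scoped RealInnerProductSpace

variable {Ω : Type*} [MeasurableSpace Ω] {μ : Measure Ω} {d p : ℕ}
  {n m : ℕ → ℕ} {P : Measure (Vec d)} {X : (k : ℕ) → Fin (n k) → Fin (m k) → Ω → Vec d}
  {g : Vec d → Vec p → Vec p} {θ : Vec p}

lemma measure_setOf_le_add {r s : Ω → Prop} :
    μ {ω | r ω} ≤ μ {ω | s ω} + μ {ω | ¬ (r ω → s ω)} := by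
  refine (measure_mono fun ω (hr : r ω) => ?_).trans (measure_union_le _ _)
  by_cases hs : s ω
  · exact Or.inl hs
  · exact Or.inr fun h => hs (h hr)

lemma eventually_probFilter_of_forall_exists {q : ℕ × Ω → Prop}
    (h : ∀ η : ℝ≥0∞, 0 < η → ∃ s : Set (ℕ × Ω), (∀ᶠ k in atTop, μ {ω | (k, ω) ∉ s} ≤ η) ∧
      ∀ᶠ a in probFilter μ ⊓ 𝓟 s, q a) : ∀ᶠ a in probFilter μ, q a := by
  rw [eventually_probFilter, ENNReal.tendsto_nhds_zero]
  intro η hη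
  obtain ⟨s, hs, hq⟩ := h (η / 2) (ENNReal.half_pos hη.ne')
  have hsq := eventually_probFilter.1 (eventually_inf_principal.1 hq)
  filter_upwards [ENNReal.tendsto_nhds_zero.1 hsq _ (ENNReal.half_pos hη.ne'), hs] with k hsq hs
  calc μ {ω | ¬ q (k, ω)}
      ≤ μ {ω | (k, ω) ∉ s} + μ {ω | ¬ (¬ q (k, ω) → (k, ω) ∉ s)} := measure_setOf_le_add
    _ ≤ η / 2 + η / 2 := by simpa only [not_imp_not] using add_le_add hs hsq
    _ = η := ENNReal.add_halves η

lemma norm_sq_eq_sum_inner_basisFun_sq (v : Vec p) :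
    ‖v‖ ^ 2 = ∑ i, ⟪EuclideanSpace.basisFun (Fin p) ℝ i, v⟫ ^ 2 := by
  rw [← (EuclideanSpace.basisFun (Fin p) ℝ).sum_sq_norm_inner_right]
  simp only [Real.norm_eq_abs, sq_abs]

namespace IsIIDArray

lemma memLp_inner_normSum (h : IsIIDArray μ P n m X) (hg : MemLp (fun y => g y θ) 2 P)
    (u : Vec p) (k : ℕ) : MemLp (fun ω => ⟪u, normSum g θ fun i j => X k i j ω⟫) 2 μ := by
  have hf : MemLp (fun y => ⟪u, g y θ⟫) 2 P := hg.const_inner u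
  have hfX : ∀ a : Fin (n k) × Fin (m k), MemLp (fun ω => ⟪u, g (X k a.1 a.2 ω) θ⟫) 2 μ :=
    fun a => memLp_comp_of_hasLaw (h.law k a.1 a.2) hf
  simp only [inner_normSum]
  exact (memLp_finsetSum _ fun a _ => hfX a).const_mul _

lemma integrable_norm_normSum_sq (h : IsIIDArray μ P n m X) (hg : MemLp (fun y => g y θ) 2 P)
    (k : ℕ) : Integrable (fun ω => ‖normSum g θ fun i j => X k i j ω‖ ^ 2) μ := by
  simp only [norm_sq_eq_sum_inner_basisFun_sq]
  exact integrable_finsetSum _ fun i _ => (h.memLp_inner_normSum hg _ k).integrable_sq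

variable [IsProbabilityMeasure μ] [IsProbabilityMeasure P]

lemma integral_inner_normSum_sq_le (h : IsIIDArray μ P n m X) (hg : MemLp (fun y => g y θ) 2 P)
    (hg0 : ∫ y, g y θ ∂P = 0) (u : Vec p) (k : ℕ) :
    ∫ ω, ⟪u, normSum g θ fun i j => X k i j ω⟫ ^ 2 ∂μ ≤ ∫ y, ⟪u, g y θ⟫ ^ 2 ∂P := by
  have hf : MemLp (fun y => ⟪u, g y θ⟫) 2 P := hg.const_inner u
  have hf0 : ∫ y, ⟪u, g y θ⟫ ∂P = 0 := by
    rw [integral_inner (hg.integrable one_le_two), hg0, inner_zero_right]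
  have hsum := integral_sum_sq_eq (h.iIndepFun_comp hf.aemeasurable k)
    (fun a => memLp_comp_of_hasLaw (h.law k a.1 a.2) hf)
    (fun a => (integral_fun_comp_of_hasLaw (h.law k a.1 a.2) hf.aestronglyMeasurable).trans hf0)
    (fun a => integral_fun_comp_of_hasLaw (h.law k a.1 a.2)
      hf.integrable_sq.aestronglyMeasurable) Finset.univ
  simp only [inner_normSum, mul_pow, inv_pow, integral_const_mul, hsum, Finset.card_univ,
    Fintype.card_prod, Fintype.card_fin]
  rw [Real.sq_sqrt (Nat.cast_nonneg _), ← mul_assoc]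
  exact mul_le_of_le_one_left (integral_nonneg fun y => sq_nonneg _) inv_mul_le_one

lemma exists_integral_norm_normSum_sq_le (h : IsIIDArray μ P n m X)
    (hg : MemLp (fun y => g y θ) 2 P) (hg0 : ∫ y, g y θ ∂P = 0) :
    ∃ C : ℝ, 0 ≤ C ∧ ∀ k, ∫ ω, ‖normSum g θ fun i j => X k i j ω‖ ^ 2 ∂μ ≤ C := by
  refine ⟨∑ i, ∫ y, ⟪EuclideanSpace.basisFun (Fin p) ℝ i, g y θ⟫ ^ 2 ∂P,
    Finset.sum_nonneg fun i _ => integral_nonneg fun y => sq_nonneg _, fun k => ?_⟩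
  simp only [norm_sq_eq_sum_inner_basisFun_sq]
  rw [integral_finsetSum _ fun i _ => (h.memLp_inner_normSum hg _ k).integrable_sq]
  exact Finset.sum_le_sum fun i _ => h.integral_inner_normSum_sq_le hg hg0 _ k

lemma exists_measure_norm_normSum_le (h : IsIIDArray μ P n m X) (hg : MemLp (fun y => g y θ) 2 P)
    (hg0 : ∫ y, g y θ ∂P = 0) {η : ℝ≥0∞} (hη : 0 < η) :
    ∃ R : ℝ, ∀ k, μ {ω | ¬ ‖normSum g θ fun i j => X k i j ω‖ ≤ R} ≤ η := by
  rcases eq_or_ne η ⊤ with rfl | hη_top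
  · exact ⟨0, fun k => le_top⟩
  have hη_pos : 0 < η.toReal := ENNReal.toReal_pos hη.ne' hη_top
  obtain ⟨C, hC0, hC⟩ := h.exists_integral_norm_normSum_sq_le hg hg0
  set r := (C + 1) / η.toReal with hr
  have hr0 : 0 < r := by positivity
  refine ⟨√r, fun k => ?_⟩
  have hmarkov := mul_meas_ge_le_integral_of_nonneg (ae_of_all μ fun ω => sq_nonneg _)
    (h.integrable_norm_normSum_sq hg k) r
  have hreal : μ.real {ω | r ≤ ‖normSum g θ fun i j => X k i j ω‖ ^ 2} ≤ η.toReal := by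
    refine le_of_mul_le_mul_left ((hmarkov.trans (hC k)).trans ?_) hr0
    rw [hr, div_mul_cancel₀ _ hη_pos.ne']
    linarith
  refine (measure_mono fun ω (hω : ¬ _) => ?_).trans
    ((ENNReal.toReal_le_toReal (measure_ne_top _ _) hη_top).1 hreal)
  exact Real.sqrt_le_left (norm_nonneg _) |>.1 (not_le.1 hω).le

end IsIIDArray

end Tightness

/-! ### From the regularity conditions to the expansion -/

section Conditions

open scoped RealInnerProductSpace Matrix

lemma memLp_natCast_of_integrable_norm_pow {D E : Type*} [MeasurableSpace D]
    [NormedAddCommGroup E] {P : Measure D} {f : D → E} (hf : AEStronglyMeasurable f P) {n : ℕ}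
    (hn : n ≠ 0) (h : Integrable (fun y => ‖f y‖ ^ n) P) : MemLp f n P := by
  rw [← integrable_norm_rpow_iff hf (by exact_mod_cast hn) (ENNReal.natCast_ne_top n)]
  simpa using h

lemma exists_smul_comp_eq {E : Type*} [NormedAddCommGroup E] [NormedSpace ℝ E]
    [FiniteDimensional ℝ E] {ρ : ℝ} (hρ : ρ ≠ 0) (S : E →L[ℝ] E) {J : E →L[ℝ] E}
    (hJ : Function.Injective J) : ∃ A : E →L[ℝ] E, ∀ v, ρ • A (J v) = S v := by
  let e := LinearEquiv.ofInjectiveEndo (J : E →ₗ[ℝ] E) hJ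
  have he : ∀ v, e.symm (J v) = v := e.symm_apply_apply
  refine ⟨ρ⁻¹ • (S ∘L LinearMap.toContinuousLinearMap (e.symm : E →ₗ[ℝ] E)), fun v => ?_⟩
  simp [he, smul_smul, hρ]

variable {d p : ℕ} {g : Vec d → Vec p → Vec p} {P PX PY : Measure (Vec d)} {θ θx θy : Vec p}
  {U : Set (Vec p)}

namespace FullRankJacobian

/-- A mean Jacobian of positive rank is an honest integral, for the integral of a non-integrable
function is `0`. -/
lemma integrable_fderiv (h : FullRankJacobian g P θ) (hp : 1 ≤ p) :
    Integrable (fun y => fderiv ℝ (g y) θ) P := by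
  by_contra hint
  have hzero : meanJacobian g P θ = 0 := integral_undef hint
  rw [FullRankJacobian, hzero, ContinuousLinearMap.toLinearMap_zero, LinearMap.range_zero,
    finrank_bot] at h
  omega

lemma injective_meanJacobian (h : FullRankJacobian g P θ) :
    Function.Injective (meanJacobian g P θ) := by
  refine LinearMap.injective_iff_surjective.2 (LinearMap.range_eq_top.1 ?_)
  exact Submodule.eq_top_of_finrank_eq (h.trans finrank_euclideanSpace_fin.symm)

end FullRankJacobian

lemma inner_momentOp_nonneg (hg : MemLp (fun y => g y θ) 2 P) (v : Vec p) :
    0 ≤ ⟪momentOp g P θ v, v⟫ := by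
  rw [momentOp, inner_integral_rankOne_self hg]
  exact integral_nonneg fun y => mul_self_nonneg _

lemma exists_contrastCov_whitening (hgX : MemLp (fun y => g y θx) 2 PX)
    (hgY : MemLp (fun y => g y θy) 2 PY)
    (hpos : ∀ v, v ≠ 0 → 0 < ⟪momentOp g PX θx v, v⟫) (A : Vec p →L[ℝ] Vec p) :
    ∃ M : Vec p →L[ℝ] Vec p, ∀ v, contrastCov g PX PY θx θy A (M.adjoint (M v)) = v := by
  have hcov : ∀ u v, ⟪contrastCov g PX PY θx θy A u, v⟫ =
      ⟪momentOp g PX θx u, v⟫ + ⟪momentOp g PY θy (A.adjoint u), A.adjoint v⟫ := fun u v => by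
    rw [contrastCov, add_apply, inner_add_left, ContinuousLinearMap.adjoint_inner_right]
    rfl
  refine exists_whitening (fun u v => ?_) fun v hv => ?_
  · rw [hcov, real_inner_comm _ u, hcov, momentOp, momentOp, inner_integral_rankOne_self_comm hgX u,
      inner_integral_rankOne_self_comm hgY (A.adjoint u), real_inner_comm u,
      real_inner_comm (A.adjoint u)]
  · rw [hcov]
    exact add_pos_of_pos_of_nonneg (hpos v hv) (inner_momentOp_nonneg hgY _)

variable [IsProbabilityMeasure P]

lemma varMatrix_apply_eq (hg : MemLp (fun y => g y θ) 2 P) (h0 : ∫ y, g y θ ∂P = 0)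
    (i j : Fin p) :
    varMatrix g P θ i j = ⟪momentOp g P θ (EuclideanSpace.basisFun (Fin p) ℝ i),
      EuclideanSpace.basisFun (Fin p) ℝ j⟫ := by
  have hcoord : ∀ k, ∫ y, g y θ k ∂P = 0 := fun k => by
    have hinner := integral_inner (𝕜 := ℝ) (hg.integrable one_le_two)
      (EuclideanSpace.basisFun (Fin p) ℝ k)
    rw [h0, inner_zero_right] at hinner
    simpa [EuclideanSpace.inner_single_left] using hinner
  rw [momentOp, inner_integral_rankOne_self hg]
  simp [varMatrix, covariance, hcoord, EuclideanSpace.inner_single_left]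

lemma inner_momentOp_self_eq (hg : MemLp (fun y => g y θ) 2 P) (h0 : ∫ y, g y θ ∂P = 0)
    (v : Vec p) : ⟪momentOp g P θ v, v⟫ = v.ofLp ⬝ᵥ varMatrix g P θ *ᵥ v.ofLp := by
  have hv : v = ∑ i, v i • EuclideanSpace.basisFun (Fin p) ℝ i :=
    ((EuclideanSpace.basisFun (Fin p) ℝ).sum_repr v).symm
  conv_lhs => rw [real_inner_comm, hv]
  simp only [map_sum, map_smul, sum_inner, inner_sum, inner_smul_left, inner_smul_right,
    RCLike.conj_to_real, dotProduct, Matrix.mulVec, varMatrix_apply_eq hg h0, Finset.mul_sum]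
  refine Finset.sum_congr rfl fun i _ => Finset.sum_congr rfl fun j _ => ?_
  rw [real_inner_comm]
  ring

lemma inner_momentOp_pos (hV : (varMatrix g P θ).PosDef) (hg : MemLp (fun y => g y θ) 2 P)
    (h0 : ∫ y, g y θ ∂P = 0) {v : Vec p} (hv : v ≠ 0) : 0 < ⟪momentOp g P θ v, v⟫ := by
  rw [inner_momentOp_self_eq hg h0]
  exact hV.dotProduct_mulVec_pos fun h => hv (WithLp.ofLp_injective 2 h)

lemma regularModel_of_posDef (hp : 1 ≤ p) (h0 : ∫ y, g y θ ∂P = 0)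
    (hV : (varMatrix g P θ).PosDef) (hU : IsOpen U) (hθU : θ ∈ U) (hR : RegularOn g P U)
    (hg : MemLp (fun y => g y θ) 2 P) (hJ : FullRankJacobian g P θ) : RegularModel g P U θ where
  isOpen := hU
  mem := hθU
  regularOn := hR
  integrable_fderiv := hJ.integrable_fderiv hp
  injective_jacobian := hJ.injective_meanJacobian
  inner_momentOp_pos _ := inner_momentOp_pos hV hg h0

end Conditions

section Sandwich

variable {Ω : Type*} [MeasurableSpace Ω] {μ : Measure Ω}

lemma tendsto_measure_of_frequently_imp {R : ℝ → ℕ → Ω → Prop} {S : ℕ → Ω → Prop}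
    {ψ : ℝ → ℝ≥0∞} {t : ℝ} (hψ : Tendsto ψ (𝓝 t) (𝓝 (ψ t)))
    (hR : ∀ s, Tendsto (fun k => μ {ω | R s k ω}) atTop (𝓝 (ψ s)))
    (hRS : ∃ᶠ s in 𝓝 t, ∀ᶠ a in probFilter μ, R s a.1 a.2 → S a.1 a.2)
    (hSR : ∃ᶠ s in 𝓝 t, ∀ᶠ a in probFilter μ, S a.1 a.2 → R s a.1 a.2) :
    Tendsto (fun k => μ {ω | S k ω}) atTop (𝓝 (ψ t)) := by
  refine tendsto_order.2 ⟨fun c hc => ?_, fun c hc => ?_⟩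
  · obtain ⟨s, himp, hcs⟩ := (hRS.and_eventually (hψ.eventually (lt_mem_nhds hc))).exists
    have hlim := ENNReal.Tendsto.sub (hR s) (eventually_probFilter.1 himp)
      (Or.inr ENNReal.zero_ne_top)
    rw [tsub_zero] at hlim
    filter_upwards [hlim.eventually (lt_mem_nhds hcs)] with k hk
    exact hk.trans_le (tsub_le_iff_right.2 measure_setOf_le_add)
  · obtain ⟨s, himp, hcs⟩ := (hSR.and_eventually (hψ.eventually (gt_mem_nhds hc))).exists
    have hlim := (hR s).add (eventually_probFilter.1 himp)
    rw [add_zero] at hlim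
    filter_upwards [hlim.eventually (gt_mem_nhds hcs)] with k hk
    exact measure_setOf_le_add.trans_lt hk

lemma tendsto_measure_lt [IsProbabilityMeasure μ] {ν : Measure ℝ} [IsProbabilityMeasure ν]
    {Q : ℕ → Ω → ℝ} (hQm : ∀ k, AEMeasurable (Q k) μ) {t : ℝ}
    (hQ : Tendsto (fun k => μ {ω | Q k ω ≤ t}) atTop (𝓝 (ν (Set.Iic t)))) :
    Tendsto (fun k => μ {ω | t < Q k ω}) atTop (𝓝 (ν (Set.Ioi t))) := by
  rw [← Set.compl_Iic, prob_compl_eq_one_sub measurableSet_Iic]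
  refine (ENNReal.Tendsto.sub tendsto_const_nhds hQ (Or.inl ENNReal.one_ne_top)).congr fun k => ?_
  rw [← prob_compl_eq_one_sub₀ (nullMeasurableSet_le (hQm k) aemeasurable_const), Set.compl_ofPred]
  simp only [not_le]

lemma tendstoChiSquare_of_eventually [IsProbabilityMeasure μ] {p : ℕ} (hp : 1 ≤ p)
    {T : ℕ → Ω → EReal} {Q : ℕ → Ω → ℝ} (hQm : ∀ k, AEMeasurable (Q k) μ)
    (hQ : ∀ t, Tendsto (fun k => μ {ω | Q k ω ≤ t}) atTop (𝓝 (chiSquare p (Set.Iic t))))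
    (hTQ : ∀ t : ℝ, ∀ ε > 0, ∀ᶠ a in probFilter μ, Q a.1 a.2 ≤ t - ε → T a.1 a.2 ≤ (t : EReal))
    (hQT : ∀ t : ℝ, ∀ ε > 0, ∀ᶠ a in probFilter μ, T a.1 a.2 ≤ (t : EReal) → Q a.1 a.2 ≤ t + ε) :
    TendstoChiSquare μ T p := by
  intro t
  have hbelow : ∃ᶠ s in 𝓝 t, ∀ᶠ a in probFilter μ, Q a.1 a.2 ≤ s → T a.1 a.2 ≤ (t : EReal) :=
    (frequently_lt_nhds t).mono fun s hs => by
      simpa only [sub_sub_cancel] using hTQ t (t - s) (sub_pos.2 hs)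
  have habove : ∃ᶠ s in 𝓝 t, ∀ᶠ a in probFilter μ, T a.1 a.2 ≤ (t : EReal) → Q a.1 a.2 ≤ s :=
    (frequently_gt_nhds t).mono fun s hs => by
      simpa only [add_sub_cancel] using hQT t (s - t) (sub_pos.2 hs)
  refine ⟨tendsto_measure_of_frequently_imp (tendsto_chiSquare_Iic hp t) hQ hbelow habove,
    tendsto_measure_of_frequently_imp (R := fun s k ω => s < Q k ω) (tendsto_chiSquare_Ioi hp t)
      (fun s => tendsto_measure_lt hQm (hQ s)) ?_ ?_⟩
  · simpa only [← not_le, not_imp_not] using habove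
  · simpa only [← not_le, not_imp_not] using hbelow

end Sandwich

section Samples

variable {Ω : Type*} [MeasurableSpace Ω] {μ : Measure Ω} {d p : ℕ} {n₁ n₂ m : ℕ → ℕ}
  {PX PY : Measure (Vec d)} {X : (k : ℕ) → Fin (n₁ k) → Fin (m k) → Ω → Vec d}
  {Y : (k : ℕ) → Fin (n₂ k) → Fin (m k) → Ω → Vec d} {g : Vec d → Vec p → Vec p}
  {θx θy : Vec p} {Ux Uy Θx Θy : Set (Vec p)}

lemma isIIDArray_left (h : ∀ k, IsTwoSample μ PX PY (X k) (Y k)) : IsIIDArray μ PX n₁ m X where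
  law k := (h k).law_X
  indep k := (h k).indep.precomp Sum.inl_injective

lemma isIIDArray_right (h : ∀ k, IsTwoSample μ PX PY (X k) (Y k)) : IsIIDArray μ PY n₂ m Y where
  law k := (h k).law_Y
  indep k := (h k).indep.precomp Sum.inr_injective

variable [IsProbabilityMeasure μ] [IsProbabilityMeasure PX]

lemma IsIIDArray.goodSample (h : IsIIDArray μ PX n₁ m X) (hn : Tendsto n₁ atTop atTop)
    (hm : ∀ k, 1 ≤ m k) (hg : MemLp (fun y => g y θx) 3 PX) (h0 : ∫ y, g y θx ∂PX = 0)
    {l : Filter (ℕ × Ω)} (hl : l ≤ probFilter μ) {R : ℝ}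
    (hR : ∀ᶠ a in l, ‖normSum g θx fun i j => X a.1 i j a.2‖ ≤ R) :
    GoodSample l g PX θx (fun a => n₁ a.1) (fun a => m a.1) (fun a i j => X a.1 i j a.2) where
  law := (h.empiricalLaw hn hm).comp hl
  groups := (h.regularGroups hn hm hg h0).comp hl
  bounded := Asymptotics.IsBigO.of_bound R (by simpa using hR)

variable [IsProbabilityMeasure PY]

/-- By tightness of the normalized sums, it suffices to argue on events on which they are bounded;
that these only have probability close to one does no harm. -/
lemma eventually_probFilter_of_goodSample (hXY : ∀ k, IsTwoSample μ PX PY (X k) (Y k))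
    (hm : ∀ k, 1 ≤ m k) (hn₁ : Tendsto n₁ atTop atTop) (hn₂ : Tendsto n₂ atTop atTop)
    (hgX : MemLp (fun y => g y θx) 3 PX) (hgY : MemLp (fun y => g y θy) 3 PY)
    (hX0 : ∫ y, g y θx ∂PX = 0) (hY0 : ∫ y, g y θy ∂PY = 0) {q : ℕ × Ω → Prop}
    (hq : ∀ l ≤ probFilter μ,
      GoodSample l g PX θx (fun a => n₁ a.1) (fun a => m a.1) (fun a i j => X a.1 i j a.2) →
      GoodSample l g PY θy (fun a => n₂ a.1) (fun a => m a.1) (fun a i j => Y a.1 i j a.2) →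
      ∀ᶠ a in l, q a) : ∀ᶠ a in probFilter μ, q a := by
  refine eventually_probFilter_of_forall_exists fun η hη => ?_
  obtain ⟨R, hR⟩ := (isIIDArray_left hXY).exists_measure_norm_normSum_le
    (hgX.mono_exponent (by norm_num)) hX0 (ENNReal.half_pos hη.ne')
  obtain ⟨R', hR'⟩ := (isIIDArray_right hXY).exists_measure_norm_normSum_le
    (hgY.mono_exponent (by norm_num)) hY0 (ENNReal.half_pos hη.ne')
  let s : Set (ℕ × Ω) := {a | ‖normSum g θx fun i j => X a.1 i j a.2‖ ≤ R ∧
    ‖normSum g θy fun i j => Y a.1 i j a.2‖ ≤ R'}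
  have hs : s ∈ probFilter μ ⊓ 𝓟 s := mem_inf_of_right (mem_principal_self s)
  refine ⟨s, Eventually.of_forall fun k => ?_, hq _ inf_le_left
    ((isIIDArray_left hXY).goodSample hn₁ hm hgX hX0 inf_le_left
      (mem_of_superset hs fun a ha => ha.1))
    ((isIIDArray_right hXY).goodSample hn₂ hm hgY hY0 inf_le_left
      (mem_of_superset hs fun a ha => ha.2))⟩
  calc μ {ω | (k, ω) ∉ s}
      ≤ μ {ω | ¬ ‖normSum g θx fun i j => X k i j ω‖ ≤ R} +
        μ {ω | ¬ ‖normSum g θy fun i j => Y k i j ω‖ ≤ R'} :=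
        (measure_mono fun ω hω => not_and_or.1 hω).trans (measure_union_le _ _)
    _ ≤ η / 2 + η / 2 := add_le_add (hR k) (hR' k)
    _ = η := ENNReal.add_halves η

theorem tendstoChiSquare_gelLogRatio (hp : 1 ≤ p) (hXY : ∀ k, IsTwoSample μ PX PY (X k) (Y k))
    (hm : ∀ k, 1 ≤ m k) (hn₁ : Tendsto n₁ atTop atTop) (hn₂ : Tendsto n₂ atTop atTop) {c : ℝ}
    (hc : 0 < c) (hratio : Tendsto (fun k => (n₁ k : ℝ) / (n₂ k : ℝ)) atTop (𝓝 c))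
    (hgx : Measurable fun y => g y θx) (hgy : Measurable fun y => g y θy)
    (hgX : MemLp (fun y => g y θx) 3 PX) (hgY : MemLp (fun y => g y θy) 3 PY)
    (hX0 : ∫ y, g y θx ∂PX = 0) (hY0 : ∫ y, g y θy ∂PY = 0)
    (hx : RegularModel g PX Ux θx) (hy : RegularModel g PY Uy θy)
    (hΘx : Θx ∈ 𝓝 θx) (hΘy : Θy ∈ 𝓝 θy)
    (hcons : ∀ l ≤ probFilter μ, GoodSample l g PX θx (fun a => n₁ a.1) (fun a => m a.1)
        (fun a i j => X a.1 i j a.2) →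
      Consistent l g θx Θx (fun a => n₁ a.1) (fun a => m a.1) (fun a i j => X a.1 i j a.2)) :
    TendstoChiSquare μ (fun k ω => gelLogRatio g Θx Θy (θy - θx)
      (fun i j => X k i j ω) (fun i j => Y k i j ω) / (m k : EReal)) p := by
  have hgX2 : MemLp (fun y => g y θx) 2 PX := hgX.mono_exponent (by norm_num)
  have hgY2 : MemLp (fun y => g y θy) 2 PY := hgY.mono_exponent (by norm_num)
  have hρ : ∀ l ≤ probFilter μ, Tendsto (fun a => √((n₂ a.1 : ℝ) / n₁ a.1)) l (𝓝 √c⁻¹) :=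
    fun l hl => by
      simpa only [inv_div, Function.comp_def] using
        (hratio.inv₀ hc.ne').sqrt.comp (tendsto_fst_probFilter.mono_left hl)
  have hρ0 : √c⁻¹ ≠ 0 := (Real.sqrt_pos.2 (inv_pos.2 hc)).ne'
  obtain ⟨A, hA⟩ := exists_smul_comp_eq hρ0 (meanJacobian g PX θx) hy.injective_jacobian
  obtain ⟨M, hM⟩ := exists_contrastCov_whitening hgX2 hgY2 hx.inner_momentOp_pos A
  have hM_norm : Measurable fun v : Vec p => ‖M v‖ ^ 2 := by fun_prop
  refine tendstoChiSquare_of_eventually hp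
    (Q := fun k ω => ‖M (contrast g θx θy A (fun i j => X k i j ω) (fun i j => Y k i j ω))‖ ^ 2)
    (fun k => hM_norm.comp_aemeasurable (aemeasurable_contrast hgx hgy (hXY k) A))
    (tendsto_measure_norm_contrast_sq_le hXY hm hn₁ hn₂ hgx hgy hgX2 hgY2 hX0 hY0 hM hp)
    (fun t ε hε => eventually_probFilter_of_goodSample hXY hm hn₁ hn₂ hgX hgY hX0 hY0
      fun l hl hlx hly => ?_)
    (fun t ε hε => eventually_probFilter_of_goodSample hXY hm hn₁ hn₂ hgX hgY hX0 hY0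
      fun l hl hlx hly => ?_)
  · exact eventually_gelLogRatio_div_le hlx hly hx hy (hρ l hl) hA hM hΘx hΘy hε t
  · exact eventually_norm_contrast_sq_le hlx hly hx hy (hρ l hl) hA hM (hcons l hl hlx) hε t

end Samples

end

theorem theorem3_general {d p : ℕ} (hp : 1 ≤ p)
    (g : Vec d → Vec p → Vec p) (hg : ∀ θ, Measurable fun x => g x θ)
    (PX PY : Measure (Vec d)) [IsProbabilityMeasure PX] [IsProbabilityMeasure PY]
    (θx₀ θy₀ : Vec p) (hθx : IsParameter g PX θx₀) (hθy : ∫ y, g y θy₀ ∂PY = 0)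
    (hVX : (varMatrix g PX θx₀).PosDef) (hVY : (varMatrix g PY θy₀).PosDef)
    (Ux Uy : Set (Vec p)) (hUx : IsOpen Ux) (hUy : IsOpen Uy)
    (hθUx : θx₀ ∈ Ux) (hθUy : θy₀ ∈ Uy)
    (hRX : RegularOn g PX Ux) (hRY : RegularOn g PY Uy)
    (hMX : Integrable (fun x => ‖g x θx₀‖ ^ 3) PX) (hMY : Integrable (fun y => ‖g y θy₀‖ ^ 3) PY)
    (hJX : FullRankJacobian g PX θx₀) (hJY : FullRankJacobian g PY θy₀)
    (n₁ n₂ m : ℕ → ℕ) (c : ℝ) (hc : 0 < c) (hm : ∀ k, 1 ≤ m k)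
    (hn₁ : Tendsto n₁ atTop atTop) (hn₂ : Tendsto n₂ atTop atTop)
    (hratio : Tendsto (fun k => (n₁ k : ℝ) / (n₂ k : ℝ)) atTop (𝓝 c))
    {Ω : Type*} [MeasurableSpace Ω] (μ : Measure Ω) [IsProbabilityMeasure μ]
    (X : (k : ℕ) → Fin (n₁ k) → Fin (m k) → Ω → Vec d)
    (Y : (k : ℕ) → Fin (n₂ k) → Fin (m k) → Ω → Vec d)
    (hXY : ∀ k, IsTwoSample μ PX PY (X k) (Y k)) :
    (Tendsto (fun k => μ {ω | ¬ SolutionWellDefined g fun i j => X k i j ω}) atTop (𝓝 0) →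
      ∀ Θx ∈ 𝓝 θx₀, ∀ Θy ∈ 𝓝 θy₀,
      TendstoChiSquare μ (fun k ω => gelLogRatio g Θx Θy (θy₀ - θx₀)
        (fun i j => X k i j ω) (fun i j => Y k i j ω) / (m k : EReal)) p) ∧
    ∀ Kx ∈ 𝓝 θx₀, IsCompact Kx → Convex ℝ Kx → Kx ⊆ Ux → ∀ Θy ∈ 𝓝 θy₀,
      TendstoChiSquare μ (fun k ω => gelLogRatio g Kx Θy (θy₀ - θx₀)
        (fun i j => X k i j ω) (fun i j => Y k i j ω) / (m k : EReal)) p := by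
  have hgX : MemLp (fun x => g x θx₀) 3 PX := memLp_natCast_of_integrable_norm_pow
    (hg θx₀).aestronglyMeasurable three_ne_zero hMX
  have hgY : MemLp (fun y => g y θy₀) 3 PY := memLp_natCast_of_integrable_norm_pow
    (hg θy₀).aestronglyMeasurable three_ne_zero hMY
  have hx : RegularModel g PX Ux θx₀ := regularModel_of_posDef hp hθx.eq_zero hVX hUx hθUx hRX
    (hgX.mono_exponent (by norm_num)) hJX
  have hy : RegularModel g PY Uy θy₀ := regularModel_of_posDef hp hθy hVY hUy hθUy hRY
    (hgY.mono_exponent (by norm_num)) hJY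
  refine ⟨fun hwd Θx hΘx Θy hΘy => ?_, fun Kx hKx hKcomp hKconv hKU Θy hΘy => ?_⟩
  · exact tendstoChiSquare_gelLogRatio hp hXY hm hn₁ hn₂ hc hratio (hg θx₀) (hg θy₀) hgX hgY
      hθx.eq_zero hθy hx hy hΘx hΘy fun l hl h =>
        h.consistent_of_wellDefined hx (hl (eventually_probFilter.2 hwd)) Θx
  · exact tendstoChiSquare_gelLogRatio hp hXY hm hn₁ hn₂ hc hratio (hg θx₀) (hg θy₀) hgX hgY
      hθx.eq_zero hθy hx hy hKx hΘy fun l _ h =>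
        h.consistent_of_compact hθx hg hUx hRX hKcomp hKconv hKU (mem_of_mem_nhds hKx)

theorem theorem3 {d p : ℕ} (hp : 1 ≤ p)
    (g : Vec d → Vec p → Vec p) (hg : ∀ θ, Measurable fun x => g x θ)
    -- the two populations, their parameters, and the null hypothesis
    (PX PY : Measure (Vec d)) [IsProbabilityMeasure PX] [IsProbabilityMeasure PY]
    (θx₀ θy₀ π₀ : Vec p)
    (hθx : IsParameter g PX θx₀) (hθy : IsParameter g PY θy₀)
    (hH₀ : θy₀ - θx₀ = π₀)
    -- positive definite covariance matrices
    (hVX : (varMatrix g PX θx₀).PosDef) (hVY : (varMatrix g PY θy₀).PosDef)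
    -- smoothness in neighbourhoods of the parameters, with integrable bounds
    (Ux Uy : Set (Vec p)) (hUx : IsOpen Ux) (hUy : IsOpen Uy)
    (hθUx : θx₀ ∈ Ux) (hθUy : θy₀ ∈ Uy)
    (hRX : RegularOn g PX Ux) (hRY : RegularOn g PY Uy)
    -- third moments and the condition on the characteristic functions
    (hMX : MomentAndCramer g PX θx₀) (hMY : MomentAndCramer g PY θy₀)
    -- the expected Jacobians have rank `p`
    (hJX : FullRankJacobian g PX θx₀) (hJY : FullRankJacobian g PY θy₀)
    -- sample sizes: `n₁, n₂ → ∞`, `n₁ / n₂ → c ∈ (0, ∞)`, and arbitrary group sizes `m`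
    (n₁ n₂ m : ℕ → ℕ) (c : ℝ) (hc : 0 < c) (hm : ∀ k, 1 ≤ m k)
    (hn₁ : Tendsto n₁ atTop atTop) (hn₂ : Tendsto n₂ atTop atTop)
    (hratio : Tendsto (fun k => (n₁ k : ℝ) / (n₂ k : ℝ)) atTop (𝓝 c))
    -- the grouped samples
    {Ω : Type*} [MeasurableSpace Ω] (μ : Measure Ω) [IsProbabilityMeasure μ]
    (X : (k : ℕ) → Fin (n₁ k) → Fin (m k) → Ω → Vec d)
    (Y : (k : ℕ) → Fin (n₂ k) → Fin (m k) → Ω → Vec d)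
    (hXY : ∀ k, IsTwoSample μ PX PY (X k) (Y k)) :
    -- if `θx(v)` and `θy(w)` are well defined with probability tending to one, then the statistic
    -- with unrestricted `θx`, `θy` converges
    (Tendsto (fun k => μ {ω | ¬ SolutionWellDefined g fun i j => X k i j ω}) atTop (𝓝 0) →
      Tendsto (fun k => μ {ω | ¬ SolutionWellDefined g fun i j => Y k i j ω}) atTop (𝓝 0) →
      TendstoChiSquare μ (fun k ω => gelLogRatio g Set.univ Set.univ π₀
        (fun i j => X k i j ω) (fun i j => Y k i j ω) / (m k : EReal)) p) ∧
    -- in any case it converges if `θx`, `θy` range over compact convex neighbourhoods of the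
    -- parameters on which the smoothness conditions hold
    (∀ Kx Ky : Set (Vec p), IsCompact Kx → IsCompact Ky → Convex ℝ Kx → Convex ℝ Ky →
      Kx ∈ 𝓝 θx₀ → Ky ∈ 𝓝 θy₀ → Kx ⊆ Ux → Ky ⊆ Uy →
      TendstoChiSquare μ (fun k ω => gelLogRatio g Kx Ky π₀
        (fun i j => X k i j ω) (fun i j => Y k i j ω) / (m k : EReal)) p) := by
  subst hH₀
  obtain ⟨hwellDefined, hcompact⟩ := theorem3_general hp g hg PX PY θx₀ θy₀ hθx hθy.eq_zero hVX hVY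
    Ux Uy hUx hUy hθUx hθUy hRX hRY hMX.moment hMY.moment hJX hJY n₁ n₂ m c hc hm hn₁ hn₂ hratio
    μ X Y hXY
  exact ⟨fun hwd _ => hwellDefined hwd _ univ_mem _ univ_mem,
    fun Kx Ky hKx _ hKxc _ hKx₀ hKy₀ hKxU _ => hcompact Kx hKx₀ hKx hKxc hKxU Ky hKy₀⟩
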